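/- Let $\mathcal M$ be a matroid on a finite ground set $E$ with set of bases $\mathcal B$, given by an independence oracle, let $c_1,c_2:E\to\mathbb R$, and let $C:\mathbb N\to\mathbb R$ be a penalty function. Write $c_i(X)=\sum_{e\in X}c_i(e)$. Consider the problem $(P^{\triangle})$: $$\min\{\,c_1(X)+c_2(Y)+C(|X\triangle Y|)\;:\;X,Y\in\mathcal B\,\}.$$ (a) $(P^{\triangle})$ can be solved in strongly polynomial time: there is one algorithm which, for every $n$, every matroid on $E=\{0,\dots,n-1\}$ and all $c_1,c_2,C$, given $n$, the real numbers $c_1(e),c_2(e)$ $(e\in E)$ and $C(0),\dots,C(n)$, and the independence oracle, computes an optimal solution $(X,Y)$; the number of its steps (arithmetic operations $+,-,\cdot,/$ and comparisons of real numbers, oracle calls, and bookkeeping operations) is bounded by a polynomial in $n$; and if the given numbers are rational, then all real-number memory cells contain only rational numbers throughout the computation, each of encoding length bounded by a polynomial in $n$ and the encoding length of the given numbers. (b) For $k\in\{0,\dots,K\}$ with $K=\operatorname{rk}(\mathcal M)$, let $(P_{=k})$ be the problem $\min\{c_1(X)+c_2(Y): X,Y\in\mathcal B,\ |X\cap Y|=k\}$,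 and let $F$ be the set of those $k\in\{0,\dots,K\}$ for which $(P_{=k})$ is feasible. For each $k\in F$ let $(X_k,Y_k)$ be any optimal solution of $(P_{=k})$. Then $c_1(X_k)+c_2(Y_k)+C(2\operatorname{rk}(\mathcal M)-2k)$ attains a minimum over $k\in F$, and for every minimizing $k\in F$ the pair $(X_k,Y_k)$ is an optimal solution of $(P^{\triangle})$. -/

import Mathlib

/-! ## Optimization over pairs of bases -/

namespace MatroidPair

open Finset

variable {E : Type*} [DecidableEq E]

/-- The linear cost `c(X) = ∑_{e ∈ X} c(e)`. -/
def cost (c : E → ℝ) (X : Finset E) : ℝ := ∑ e ∈ X, c e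

/-- The rank of a matroid (on a finite type): the common cardinality of its bases. -/
noncomputable def rk (M : Matroid E) : ℕ := M.eRank.toNat

/-- `(X, Y)` is feasible for `(P_{=k})`: `X` is a basis of `M₁`, `Y` is a basis of `M₂`,
and `|X ∩ Y| = k`. -/
def FeasibleEq (M₁ M₂ : Matroid E) (k : ℕ) (X Y : Finset E) : Prop :=
  M₁.IsBase (X : Set E) ∧ M₂.IsBase (Y : Set E) ∧ (X ∩ Y).card = k

/-- `(X, Y)` is an optimal solution of `(P_{=k})`: it is feasible and minimizes `c₁(X) + c₂(Y)`
among the feasible pairs. -/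
def OptimalEq (M₁ M₂ : Matroid E) (c₁ c₂ : E → ℝ) (k : ℕ) (X Y : Finset E) : Prop :=
  FeasibleEq M₁ M₂ k X Y ∧
    ∀ X' Y', FeasibleEq M₁ M₂ k X' Y' → cost c₁ X + cost c₂ Y ≤ cost c₁ X' + cost c₂ Y'

/-- The objective `c₁(X) + c₂(Y) + C(|X △ Y|)` of problem `(P^△)`. -/
def objTri (c₁ c₂ : E → ℝ) (C : ℕ → ℝ) (X Y : Finset E) : ℝ :=
  cost c₁ X + cost c₂ Y + C (symmDiff X Y).card

/-- `(X, Y)` is an optimal solution of `(P^△)`: both are bases of `M`, and they minimize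
`c₁(X) + c₂(Y) + C(|X △ Y|)` among all pairs of bases. -/
def OptimalTri (M : Matroid E) (c₁ c₂ : E → ℝ) (C : ℕ → ℝ) (X Y : Finset E) : Prop :=
  M.IsBase (X : Set E) ∧ M.IsBase (Y : Set E) ∧
    ∀ X' Y' : Finset E, M.IsBase (X' : Set E) → M.IsBase (Y' : Set E) →
      objTri c₁ c₂ C X Y ≤ objTri c₁ c₂ C X' Y'

end MatroidPair

/-! ## A random access machine with real arithmetic and an independence oracle

The memory has two sorts of cells, holding natural numbers (bookkeeping) and real numbers (data).
Each sort is arranged in arrays; a program names finitely many arrays and accesses them at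
computed indices. -/

namespace OracleRAM

/-- Expressions over the natural-number cells: literals, indirect access `a[i]`, sum and truncated
difference. There is no multiplication, so that `t` unit-cost steps can only
produce numbers with `O(t + log n)` bits. -/
inductive NatExpr : Type
  | lit (k : ℕ)
  | cell (a : ℕ) (i : NatExpr)
  | add (e f : NatExpr)
  | sub (e f : NatExpr)

/-- The elementary arithmetic operations on real numbers. -/
inductive ArithOp : Type
  | add
  | sub
  | mul
  | div

/-- Tests: `e < f` for natural-number expressions, and `b[i] ≤ b'[i']` for two real cells. -/
inductive Test : Type
  | natLt (e f : NatExpr)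
  | realLe (b : ℕ) (i : NatExpr) (b' : ℕ) (i' : NatExpr)

/-- Programs. A program is a finite object; it does not depend on the input. -/
inductive Prog : Type
  /-- do nothing -/
  | skip
  /-- natural-number assignment `a[i] := e` -/
  | setNat (a : ℕ) (i e : NatExpr)
  /-- real assignment of an integer constant `b[i] := z` -/
  | setReal (b : ℕ) (i : NatExpr) (z : ℤ)
  /-- real copy `b[i] := b'[i']` -/
  | copyReal (b : ℕ) (i : NatExpr) (b' : ℕ) (i' : NatExpr)
  /-- one arithmetic operation `b[i] := b₁[i₁] op b₂[i₂]` on reals -/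
  | arith (op : ArithOp) (b : ℕ) (i : NatExpr) (b₁ : ℕ) (i₁ : NatExpr) (b₂ : ℕ) (i₂ : NatExpr)
  /-- oracle call: `a[i] := 1` if the set stored in array `s` is independent, else `a[i] := 0` -/
  | query (a : ℕ) (i : NatExpr) (s : ℕ)
  /-- run the first program, then the second -/
  | seq (P Q : Prog)
  /-- conditional -/
  | ite (c : Test) (P Q : Prog)
  /-- while loop -/
  | loop (c : Test) (P : Prog)

/-- The contents of the memory: `nat a i` and `real b i` are the cells `a[i]` and `b[i]`. -/
structure Memory : Type where
  nat : ℕ → ℕ → ℕ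
  real : ℕ → ℕ → ℝ

/-- `a[i] := v` for natural numbers. -/
def Memory.writeNat (m : Memory) (a i v : ℕ) : Memory :=
  { m with nat := Function.update m.nat a (Function.update (m.nat a) i v) }

/-- `b[i] := v` for real numbers. -/
def Memory.writeReal (m : Memory) (b i : ℕ) (v : ℝ) : Memory :=
  { m with real := Function.update m.real b (Function.update (m.real b) i v) }

/-- The subset of `{0, …, n - 1}` whose indicator vector (nonzero means present) is array `a`. -/
def Memory.toFinset (m : Memory) (n a : ℕ) : Finset (Fin n) :=
  Finset.univ.filter fun e => m.nat a e ≠ 0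

/-- The value of an expression. -/
def NatExpr.eval (m : Memory) : NatExpr → ℕ
  | lit k => k
  | cell a i => m.nat a (i.eval m)
  | add e f => e.eval m + f.eval m
  | sub e f => e.eval m - f.eval m

/-- The value of an arithmetic operation. A division by zero returns zero. -/
noncomputable def ArithOp.eval : ArithOp → ℝ → ℝ → ℝ
  | add, x, y => x + y
  | sub, x, y => x - y
  | mul, x, y => x * y
  | div, x, y => x / y

/-- The truth value of a test. -/
def Test.Holds (m : Memory) : Test → Prop
  | natLt e f => e.eval m < f.eval m
  | realLe b i b' i' => m.real b (i.eval m) ≤ m.real b' (i'.eval m)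

/-- A configuration: the stack of programs still to be run, and the memory. -/
structure Config : Type where
  todo : List Prog
  mem : Memory

open Classical in
/-- One computation step on a ground set `{0, …, n - 1}` with independence oracle `Ind`. Each
assignment, real operation, oracle call, evaluation of a test, and unfolding of a sequence is
one step. A fixed program has finitely many expressions of fixed size, so evaluating them in one
step affects running times by a constant factor only. -/
noncomputable def step {n : ℕ} (Ind : Finset (Fin n) → Prop) : Config → Config
  | ⟨[], m⟩ => ⟨[], m⟩
  | ⟨.skip :: K, m⟩ => ⟨K, m⟩
  | ⟨.setNat a i e :: K, m⟩ => ⟨K, m.writeNat a (i.eval m) (e.eval m)⟩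
  | ⟨.setReal b i z :: K, m⟩ => ⟨K, m.writeReal b (i.eval m) (z : ℝ)⟩
  | ⟨.copyReal b i b' i' :: K, m⟩ => ⟨K, m.writeReal b (i.eval m) (m.real b' (i'.eval m))⟩
  | ⟨.arith op b i b₁ i₁ b₂ i₂ :: K, m⟩ =>
      ⟨K, m.writeReal b (i.eval m) (op.eval (m.real b₁ (i₁.eval m)) (m.real b₂ (i₂.eval m)))⟩
  | ⟨.query a i s :: K, m⟩ =>
      ⟨K, m.writeNat a (i.eval m) (if Ind (m.toFinset n s) then 1 else 0)⟩
  | ⟨.seq P Q :: K, m⟩ => ⟨P :: Q :: K, m⟩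
  | ⟨.ite c P Q :: K, m⟩ => if c.Holds m then ⟨P :: K, m⟩ else ⟨Q :: K, m⟩
  | ⟨.loop c P :: K, m⟩ => if c.Holds m then ⟨P :: .loop c P :: K, m⟩ else ⟨K, m⟩

/-- An input: a matroid on the ground set `{0, …, n - 1}`, two cost functions, and a penalty
function. -/
structure Input (n : ℕ) : Type where
  M : Matroid (Fin n)
  ground : M.E = Set.univ
  c₁ : Fin n → ℝ
  c₂ : Fin n → ℝ
  C : ℕ → ℝ

/-- The initial memory. The natural cell `0[0]` contains `n`, the real arrays `0`, `1`, `2` contain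
`c₁`, `c₂` and the values `C(0), …, C(n)` (the only ones that can occur as `C(|X △ Y|)`), and all
other cells contain zero. The matroid is not stored; it is accessible only through the oracle. -/
noncomputable def Input.initMem {n : ℕ} (I : Input n) : Memory where
  nat a i := if a = 0 ∧ i = 0 then n else 0
  real b i :=
    if b = 0 then (if h : i < n then I.c₁ ⟨i, h⟩ else 0)
    else if b = 1 then (if h : i < n then I.c₂ ⟨i, h⟩ else 0)
    else if b = 2 then (if i ≤ n then I.C i else 0)
    else 0

/-- The configuration after `t` steps of program `P` on input `I`. -/
noncomputable def Input.run {n : ℕ} (I : Input n) (P : Prog) (t : ℕ) : Config :=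
  (step (n := n) fun S => I.M.Indep (S : Set (Fin n)))^[t] ⟨[P], I.initMem⟩

/-- The encoding length of a rational number: binary digits of numerator and denominator. -/
def bitSize (x : ℚ) : ℕ := Nat.size x.num.natAbs + Nat.size x.den

/-- A problem that asks, for each input, for a pair of sets with property `IsSol`, is *solvable in
strongly polynomial time* if one program solves all inputs such that
* the number of steps (arithmetic operations, comparisons, oracle calls, bookkeeping)
  is bounded by a polynomial in `n`, whatever the real data are; the two sets are then found
  in the natural arrays `1` and `2`;
* if the data are rational, then all numbers that occur in the computation are
  rational with encoding length bounded by a polynomial in `n` and the encoding length of the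
  data. -/
def SolvableInStronglyPolynomialTime
    (IsSol : ∀ n : ℕ, Input n → Finset (Fin n) → Finset (Fin n) → Prop) : Prop :=
  ∃ (P : Prog) (p q : Polynomial ℕ), ∀ (n : ℕ) (I : Input n),
    (∃ t ≤ p.eval n, (I.run P t).todo = [] ∧
      IsSol n I ((I.run P t).mem.toFinset n 1) ((I.run P t).mem.toFinset n 2)) ∧
    (∀ (d₁ d₂ : Fin n → ℚ) (D : Fin (n + 1) → ℚ),
      (∀ e, I.c₁ e = d₁ e) → (∀ e, I.c₂ e = d₂ e) → (∀ j : Fin (n + 1), I.C j = D j) →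
      ∀ t b i : ℕ, ∃ x : ℚ, (I.run P t).mem.real b i = x ∧
        bitSize x ≤ q.eval (n + (∑ e, bitSize (d₁ e) + ∑ e, bitSize (d₂ e) + ∑ j, bitSize (D j))))

end OracleRAM

/-!
Part (b) holds because bases have common size `rk M`, so that `|X △ Y| = 2 rk M - 2 |X ∩ Y|`: the
penalty is constant on the pairs with a given intersection size, and minimizing over all pairs of
bases is minimizing over that size. For part (a) it remains to find, in polynomial time, a cheapest
pair for each intersection size that occurs.

**Optimality certificate.** Consider pairs `W 0`, `W 1` of bases of two matroids with costs `c 0`,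
`c 1`. A pair is `Certified` if there is a shift `α` of both costs, with values in `[0, l]`, zero
outside `W 0 ∪ W 1` and equal to `l` on `W 0 ∩ W 1`, for which both sets are bases of minimum
shifted weight. Then `l` is a Lagrange multiplier for the intersection size, and the pair is
cheapest among the pairs with the same intersection size (`Certified.cost_le`). Two bases of minimum
cost are certified with `α = 0`.

**Primal-dual step.** An arc `u → v` of type `t` is an exchange `W t - v + u`; it is tight if the
exchange leaves the weight unchanged. If tight arcs lead from an element in neither set to an
element in both, exchanging along a shortest such path keeps both bases minimal
(`IsBFS.isMinBase_toggled`, from `IsMinBase.exchanges`) and lowers the intersection size by one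
(`Certified.augment`). Otherwise the weights outside the reached set are raised by the minimum slack
of the arcs that leave it; this preserves the certificate (`Certified.raise`) and enlarges the
reached set (`reach_card_lt`). If no arc leaves it, `l` can grow without bound, and the intersection
is as small as it can be (`Certified.card_inter_le`). So `(n + 1) ^ 2` steps run through cheapest
pairs for all intersection sizes from the initial one down to the smallest. Applied to `(M, M)` with
the costs `(c₁, c₂)`, this treats the sizes below that of the initial pair `(X, Y)`; applied to
`(M, M✶)` with the costs `(c₁, -c₂)` and the sets `X`, `Yᶜ`, it treats the sizes above, as
`|X ∩ Yᶜ| = rk M - |X ∩ Y|`. The program keeps the pair with the best objective value seen; since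
every pair of bases is matched by a certified pair of the same intersection size that has been seen,
it is optimal (`main_spec`).

**Running time and encoding length.** The algorithm is written in a small language `SProg` with
loops of `n + k` rounds only, which has a total denotation `SProg.exec` and compiles to machine
programs. The number of steps is a polynomial that depends only on the program text
(`SProg.exists_steps`). The only real operations are copying, addition and subtraction, so after `t`
steps every real cell holds a fraction over a common denominator of the data, whose numerator is at
most `2 ^ t` times the largest initial one (`bounded_step`); this gives the bound on the encoding
length. Both are combined in `solvable_of_exec`, which leaves only the functional correctness of the
program to be shown.
-/

/-! ### Minimum weight bases and simultaneous exchanges -/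

namespace MatroidPair

open Finset

section MinBase

variable {E : Type*} [DecidableEq E] {N : Matroid E} {w : E → ℝ} {W : Finset E}

/-- `W` is a basis of `N` of minimum `w`-weight. -/
def IsMinBase (N : Matroid E) (w : E → ℝ) (W : Finset E) : Prop :=
  N.IsBase (W : Set E) ∧ ∀ W' : Finset E, N.IsBase (W' : Set E) → cost w W ≤ cost w W'

/-- The exchange `W - v + u` is possible: `u ∉ W`, `v ∈ W`, and `W - v + u` is a basis. -/
def Exch (N : Matroid E) (W : Finset E) (u v : E) : Prop :=
  u ∉ W ∧ v ∈ W ∧ N.IsBase (insert u (W.erase v) : Finset E)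

lemma cost_insert_erase {u v : E} (hu : u ∉ W) (hv : v ∈ W) :
    cost w (insert u (W.erase v)) = cost w W + w u - w v := by
  have h := Finset.add_sum_erase W w hv
  rw [cost, Finset.sum_insert (by simp [hu]), cost]
  linarith

lemma IsMinBase.le_of_exch (h : IsMinBase N w W) {u v : E} (he : Exch N W u v) : w v ≤ w u := by
  have := h.2 _ he.2.2
  rw [cost_insert_erase he.1 he.2.1] at this
  linarith

/-- Symmetric exchange between two bases. -/
lemma exists_symm_exch {B B' : Finset E} (hB : N.IsBase (B : Set E)) (hB' : N.IsBase (B' : Set E))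
    {y : E} (hy : y ∈ B') (hyB : y ∉ B) : ∃ x, Exch N B y x ∧ Exch N B' x y := by
  have hyE : y ∈ N.E := hB'.subset_ground (by simpa using hy)
  have hyB' : y ∉ (B : Set E) := by simpa using hyB
  have hycl : y ∈ N.closure (B : Set E) := by rwa [hB.closure_eq]
  have hC := hB.fundCircuit_isCircuit hyE hyB'
  have hynot : y ∉ N.closure ((B' : Set E) \ {y}) :=
    hB'.indep.notMem_closure_sdiff_of_mem (by simpa using hy)
  have hex : ∃ x ∈ N.fundCircuit y B \ {y}, x ∉ N.closure ((B' : Set E) \ {y}) := by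
    by_contra! hcon
    exact hynot (N.closure_subset_closure_of_subset_closure hcon
      (hC.mem_closure_sdiff_singleton_of_mem (N.mem_fundCircuit y B)))
  obtain ⟨x, ⟨hxC, hxy⟩, hx⟩ := hex
  have hxy : x ≠ y := hxy
  have hxB : x ∈ B := by
    have := N.fundCircuit_subset_insert y B hxC
    simpa [hxy] using this
  have hxE : x ∈ N.E := hB.subset_ground (by simpa using hxB)
  have hxB' : x ∉ B' := fun h => hx (N.mem_closure_of_mem' (by simp [h, hxy]) hxE)
  refine ⟨x, ⟨hyB, hxB, ?_⟩, hxB', hy, ?_⟩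
  · have h1 := (hB.indep.mem_fundCircuit_iff hycl hyB').1 hxC
    have h2 := hB.exchange_isBase_of_indep' (by simpa using hxB) hyB' h1
    rw [← Set.insert_sdiff_singleton_comm hxy.symm] at h2
    simpa using h2
  · have := hB'.exchange_base_of_notMem_closure (e := y) (by simpa using hy) hx hxE
    simpa using this

/-- A basis that no single exchange improves has minimum weight. -/
lemma isMinBase_of_exch (hW : N.IsBase (W : Set E)) (h : ∀ u v, Exch N W u v → w v ≤ w u) :
    IsMinBase N w W := by
  refine ⟨hW, fun W' hW' => ?_⟩
  induction hk : (W' \ W).card generalizing W' with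
  | zero =>
    have hsub : W' ⊆ W := by simpa [Finset.sdiff_eq_empty_iff_subset] using hk
    have : (W' : Set E) = W := hW'.eq_of_subset_isBase hW (by simpa using hsub)
    rw [Finset.coe_injective this]
  | succ k ih =>
    obtain ⟨y, hy⟩ : (W' \ W).Nonempty := by rw [← Finset.card_pos]; omega
    rw [Finset.mem_sdiff] at hy
    obtain ⟨x, h1, h2⟩ := exists_symm_exch hW hW' hy.1 hy.2
    have := ih _ h2.2.2 (by
      have : insert x (W'.erase y) \ W = (W' \ W).erase y := by
        ext e
        have := h1.2.1
        simp only [mem_sdiff, mem_insert, mem_erase]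
        grind
      rw [this, Finset.card_erase_of_mem (by simp [hy])]; omega)
    rw [cost_insert_erase h2.1 h2.2.1] at this
    have := h _ _ h1
    linarith

/-- If `W - v + u'` is not a basis, then `v` lies outside the fundamental circuit of `u'`, and
swapping `v` for `u` does not change that circuit. Hence the exchanges that bring in `u'`
are the same before and after the swap. -/
lemma exch_swap_iff {u v u' v' : E} (hW : N.IsBase (W : Set E)) (h : Exch N W u v)
    (hu' : u' ∉ W) (hE : u' ∈ N.E)
    (hne : u' ≠ u) (hv' : v' ∈ W) (hvv : v' ≠ v) (hno : ¬ Exch N W u' v) :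
    Exch N (insert u (W.erase v)) u' v' ↔ Exch N W u' v' := by
  obtain ⟨hu, hv, hb⟩ := h
  have hmem : v' ∈ insert u (W.erase v) := by simp [hv', hvv]
  have hnot : u' ∉ insert u (W.erase v) := by simp [hu', hne]
  have key : ∀ B : Finset E, N.IsBase (B : Set E) → u' ∉ B → ∀ x ∈ B,
      (Exch N B u' x ↔ x ∈ N.fundCircuit u' B) := by
    intro B hB hB' x hx
    have hux : u' ≠ x := by rintro rfl; exact hB' hx
    rw [hB.indep.mem_fundCircuit_iff (by rwa [hB.closure_eq]) (by simpa using hB'),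
      ← Set.insert_sdiff_singleton_comm hux]
    constructor
    · intro h; simpa using h.2.2.indep
    · intro h
      exact ⟨hB', hx, by
        have := hB.exchange_isBase_of_indep (by simpa using hB') h
        simpa using this⟩
  rw [key _ hb hnot _ hmem, key _ hW hu' _ hv']
  rw [key _ hW hu' _ hv] at hno
  have hC := hW.fundCircuit_isCircuit hE (by simpa using hu')
  have hsub : N.fundCircuit u' W ⊆ insert u' ((insert u (W.erase v) : Finset E) : Set E) := by
    intro x hx
    have h1 := N.fundCircuit_subset_insert u' W hx
    have h2 : x ≠ v := by rintro rfl; exact hno hx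
    simp only [Set.mem_insert_iff, mem_coe, coe_insert, coe_erase, Set.mem_sdiff,
      Set.mem_singleton_iff] at h1 ⊢
    tauto
  rw [hC.eq_fundCircuit_of_subset hb.indep hsub]

/-- Simultaneous exchange: if the pairs `(inn j, out j)` can be ordered so that `out j` lies in the
fundamental circuit of `inn i` only for `j ≤ i`, then all of them can be exchanged at once. -/
lemma isBase_of_exchanges {ι κ : Type*} [DecidableEq ι] [LinearOrder κ] (key : ι → κ) (J : Finset ι)
    (inn out : ι → E) (hE : ∀ i ∈ J, inn i ∈ N.E) (W : Finset E) (hW : N.IsBase (W : Set E))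
    (hJ : ∀ i ∈ J, Exch N W (inn i) (out i)) (hinn : Set.InjOn inn J) (hout : Set.InjOn out J)
    (hno : ∀ i ∈ J, ∀ j ∈ J, i ≠ j → key i ≤ key j → ¬ Exch N W (inn i) (out j)) :
    N.IsBase ((W \ J.image out ∪ J.image inn : Finset E) : Set E) := by
  induction J using Finset.induction_on_max_value key generalizing W with
  | empty => simpa using hW
  | insert a s ha hmax ih =>
    have hexa := hJ a (by simp)
    have hne : ∀ i ∈ s, i ≠ a := fun i hi h => ha (h ▸ hi)
    have hinne : ∀ i ∈ s, inn i ≠ inn a := fun i hi h =>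
      hne i hi (hinn (by simp [hi]) (by simp) h)
    have houte : ∀ i ∈ s, out i ≠ out a := fun i hi h =>
      hne i hi (hout (by simp [hi]) (by simp) h)
    have hiff : ∀ i ∈ s, ∀ j ∈ s, Exch N (insert (inn a) (W.erase (out a))) (inn i) (out j) ↔
        Exch N W (inn i) (out j) := by
      intro i hi j hj
      exact exch_swap_iff hW hexa (hJ i (by simp [hi])).1 (hE i (by simp [hi])) (hinne i hi)
        (hJ j (by simp [hj])).2.1 (houte j hj)
        (hno i (by simp [hi]) a (by simp) (hne i hi) (hmax i hi))
    have := ih (fun i hi => hE i (by simp [hi])) _ hexa.2.2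
      (fun i hi => (hiff i hi i hi).2 (hJ i (by simp [hi])))
      (hinn.mono (by simp)) (hout.mono (by simp))
      (fun i hi j hj hij hk => by
        rw [hiff i hi j hj]
        exact hno i (by simp [hi]) j (by simp [hj]) hij hk)
    convert this using 2
    ext e
    have h1 : ∀ i ∈ s, out i ≠ inn a := fun i hi h => hexa.1 (h ▸ (hJ i (by simp [hi])).2.1)
    have h2 := hexa.1
    simp only [image_insert, mem_union, mem_sdiff, mem_insert, mem_image, mem_erase]
    grind

/-- The weighted version of `isBase_of_exchanges`: all the exchanges are tight, and among the tight
exchanges the pairs are triangular with respect to `key`. Ordering the pairs by weight first makes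
them triangular among all exchanges, since a basis of minimum weight admits no improving one. -/
lemma IsMinBase.exchanges {ι : Type*} [DecidableEq ι] (key : ι → ℕ) (J : Finset ι)
    (inn out : ι → E) (hE : N.E = Set.univ) (hW : IsMinBase N w W)
    (hJ : ∀ i ∈ J, Exch N W (inn i) (out i) ∧ w (inn i) ≤ w (out i))
    (hinn : Set.InjOn inn J) (hout : Set.InjOn out J) (hkey : Set.InjOn key J)
    (hno : ∀ i ∈ J, ∀ j ∈ J, key i < key j → Exch N W (inn i) (out j) →
      ¬ w (inn i) ≤ w (out j)) :
    IsMinBase N w (W \ J.image out ∪ J.image inn) := by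
  have hw : ∀ i ∈ J, w (inn i) = w (out i) := fun i hi =>
    le_antisymm (hJ i hi).2 (hW.le_of_exch (hJ i hi).1)
  refine ⟨isBase_of_exchanges (fun i => toLex (w (out i), key i)) J inn out (by simp [hE]) W hW.1
    (fun i hi => (hJ i hi).1) hinn hout ?_, fun W' hW' => ?_⟩
  · intro i hi j hj hij hk he
    have hle := hW.le_of_exch he
    rw [hw i hi] at hle
    rw [Prod.Lex.toLex_le_toLex] at hk
    rcases hk with hk | ⟨hk, hk'⟩
    · exact absurd hk (not_lt.2 hle)
    · exact hno i hi j hj (lt_of_le_of_ne hk' fun h => hij (hkey hi hj h)) he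
        (by rw [hw i hi]; exact hk.le)
  · have hdisj : Disjoint (W \ J.image out) (J.image inn) := by
      rw [Finset.disjoint_left]
      intro e he he'
      obtain ⟨i, hi, rfl⟩ := Finset.mem_image.1 he'
      exact (hJ i hi).1.1 (Finset.mem_sdiff.1 he).1
    have hsub : J.image out ⊆ W := by
      intro e he
      obtain ⟨i, hi, rfl⟩ := Finset.mem_image.1 he
      exact (hJ i hi).1.2.1
    have h1 : ∑ e ∈ J.image out, w e = ∑ e ∈ J.image inn, w e := by
      rw [Finset.sum_image hout, Finset.sum_image hinn]
      exact (Finset.sum_congr rfl hw).symm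
    have h2 := Finset.sum_sdiff (f := w) hsub
    have : cost w (W \ J.image out ∪ J.image inn) = cost w W := by
      rw [cost, cost, Finset.sum_union hdisj, ← h1, h2]
    rw [this]
    exact hW.2 W' hW'

end MinBase

end MatroidPair

namespace MatroidPair
open Finset

/-! ### Pairs of bases with small intersection -/

section Pair

variable {E : Type*} [DecidableEq E] {N : Fin 2 → Matroid E} {c w : Fin 2 → E → ℝ}
  {W : Fin 2 → Finset E} {α : E → ℝ} {l : ℝ}

/-- `α` is a potential with bound `l` for the pair `W 0`, `W 1` and the shifted weights `w`: it
takes values between `0` and `l`, vanishes on the elements in neither set, and equals `l` on the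
elements in both. -/
structure IsPotential (c w : Fin 2 → E → ℝ) (W : Fin 2 → Finset E) (α : E → ℝ) (l : ℝ) : Prop where
  shift : ∀ t e, w t e = c t e + α e
  nonneg : ∀ e, 0 ≤ α e
  le : ∀ e, α e ≤ l
  none : ∀ e, (∀ t, e ∉ W t) → α e = 0
  both : ∀ e, (∀ t, e ∈ W t) → α e = l

/-- Bases of minimum shifted weight, together with a potential. By `cost_le_of_isPotential` this
certifies that the pair is cheapest among all pairs of bases with the same intersection size. -/
def Certified (N : Fin 2 → Matroid E) (c w : Fin 2 → E → ℝ) (W : Fin 2 → Finset E) : Prop :=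
  (∀ t, IsMinBase (N t) (w t) (W t)) ∧ ∃ α l, IsPotential c w W α l

omit [DecidableEq E] in
lemma IsPotential.cost_eq (h : IsPotential c w W α l) (t : Fin 2) (S : Finset E) :
    cost (w t) S = cost (c t) S + cost α S := by
  simp only [cost, h.shift, Finset.sum_add_distrib]

/-- The Lagrangian lower bound: `l` is the price of one common element. -/
lemma cost_le_of_isPotential [Fintype E] (hW : ∀ t, IsMinBase (N t) (w t) (W t))
    (h : IsPotential c w W α l) {W' : Fin 2 → Finset E} (hW' : ∀ t, (N t).IsBase (W' t : Set E)) :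
    cost (c 0) (W 0) + cost (c 1) (W 1) ≤ cost (c 0) (W' 0) + cost (c 1) (W' 1) +
      l * ((W' 0 ∩ W' 1).card - (W 0 ∩ W 1).card) := by
  have h0 := (hW 0).2 _ (hW' 0)
  have h1 := (hW 1).2 _ (hW' 1)
  rw [h.cost_eq, h.cost_eq] at h0 h1
  have hs : ∀ V : Fin 2 → Finset E,
      cost α (V 0) + cost α (V 1) = cost α (V 0 ∪ V 1) + cost α (V 0 ∩ V 1) := fun V =>
    (Finset.sum_union_inter).symm
  have e1 : cost α (W 0 ∪ W 1) = ∑ e, α e := by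
    refine Finset.sum_subset (Finset.subset_univ _) fun e _ he => h.none e ?_
    simpa [Fin.forall_fin_two] using he
  have e2 : cost α (W 0 ∩ W 1) = l * (W 0 ∩ W 1).card := by
    rw [cost, Finset.sum_congr rfl (g := fun _ => l), Finset.sum_const, nsmul_eq_mul, mul_comm]
    intro e he
    exact h.both e (by simpa [Fin.forall_fin_two] using he)
  have e3 : cost α (W' 0 ∪ W' 1) ≤ ∑ e, α e :=
    Finset.sum_le_sum_of_subset_of_nonneg (Finset.subset_univ _) fun e _ _ => h.nonneg e
  have e4 : cost α (W' 0 ∩ W' 1) ≤ l * (W' 0 ∩ W' 1).card := by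
    rw [mul_comm, ← nsmul_eq_mul]
    exact Finset.sum_le_card_nsmul _ _ _ fun e _ => h.le e
  have := hs W
  have := hs W'
  linarith

/-- A certified pair is cheapest among the pairs of bases with the same intersection size. -/
lemma Certified.cost_le [Fintype E] (h : Certified N c w W) {W' : Fin 2 → Finset E}
    (hW' : ∀ t, (N t).IsBase (W' t : Set E)) (hc : (W' 0 ∩ W' 1).card = (W 0 ∩ W 1).card) :
    cost (c 0) (W 0) + cost (c 1) (W 1) ≤ cost (c 0) (W' 0) + cost (c 1) (W' 1) := by
  obtain ⟨hW, α, l, hp⟩ := h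
  have := cost_le_of_isPotential hW hp hW'
  rw [hc] at this
  linarith

/-- Raising the weights by `δ` outside `R` keeps the pair certified. -/
lemma raise_isPotential {R : Finset E} {δ : ℝ} (hδ : 0 ≤ δ)
    (hW : ∀ t, IsMinBase (N t) (w t) (W t)) (hp : IsPotential c w W α l)
    (hsrc : ∀ e, (∀ t, e ∉ W t) → e ∈ R) (hsink : ∀ e, (∀ t, e ∈ W t) → e ∉ R)
    (harc : ∀ t, ∀ u ∈ R, ∀ v ∉ R, Exch (N t) (W t) u v → w t v + δ ≤ w t u) :
    (∀ t, IsMinBase (N t) (fun e => w t e + if e ∈ R then 0 else δ) (W t)) ∧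
      IsPotential c (fun t e => w t e + if e ∈ R then 0 else δ) W
        (fun e => α e + if e ∈ R then 0 else δ) (l + δ) := by
  refine ⟨fun t => isMinBase_of_exch (hW t).1 fun u v he => ?_, ⟨?_, ?_, ?_, ?_, ?_⟩⟩
  · have := (hW t).le_of_exch he
    have := harc t u
    by_cases hu : u ∈ R <;> by_cases hv : v ∈ R <;> simp only [hu, hv, if_true, if_false]
    · linarith
    · have := harc t u hu v hv he; linarith
    · linarith
    · linarith
  · intro t e; simp only [hp.shift]; ring
  · intro e; have := hp.nonneg e; split_ifs <;> linarith
  · intro e; have := hp.le e; split_ifs <;> linarith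
  · intro e he; simp [hp.none e he, hsrc e he]
  · intro e he; simp [hp.both e he, hsink e he]

lemma Certified.raise {R : Finset E} {δ : ℝ} (hδ : 0 ≤ δ) (h : Certified N c w W)
    (hsrc : ∀ e, (∀ t, e ∉ W t) → e ∈ R) (hsink : ∀ e, (∀ t, e ∈ W t) → e ∉ R)
    (harc : ∀ t, ∀ u ∈ R, ∀ v ∉ R, Exch (N t) (W t) u v → w t v + δ ≤ w t u) :
    Certified N c (fun t e => w t e + if e ∈ R then 0 else δ) W := by
  obtain ⟨hW, α, l, hp⟩ := h
  obtain ⟨h1, h2⟩ := raise_isPotential hδ hW hp hsrc hsink harc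
  exact ⟨h1, _, _, h2⟩

/-- If no exchange leaves `R`, the price of a common element can be raised arbitrarily, so no pair
of bases has a smaller intersection. -/
lemma Certified.card_inter_le [Fintype E] {R : Finset E} (h : Certified N c w W)
    (hsrc : ∀ e, (∀ t, e ∉ W t) → e ∈ R) (hsink : ∀ e, (∀ t, e ∈ W t) → e ∉ R)
    (harc : ∀ t, ∀ u ∈ R, ∀ v ∉ R, ¬ Exch (N t) (W t) u v)
    {W' : Fin 2 → Finset E} (hW' : ∀ t, (N t).IsBase (W' t : Set E)) :
    (W 0 ∩ W 1).card ≤ (W' 0 ∩ W' 1).card := by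
  obtain ⟨hW, α, l, hp⟩ := h
  by_contra! hlt
  set x := cost (c 0) (W' 0) + cost (c 1) (W' 1) - (cost (c 0) (W 0) + cost (c 1) (W 1))
  obtain ⟨δ, hδ, hbig⟩ : ∃ δ : ℝ, 0 ≤ δ ∧ |x| < l + δ ∧ 0 ≤ l + δ :=
    ⟨|x| + |l| + 1, by positivity, by have := neg_abs_le l; linarith,
      by have := neg_abs_le l; have := abs_nonneg x; linarith⟩
  obtain ⟨h1, h2⟩ := raise_isPotential hδ hW hp hsrc hsink
    (fun t u hu v hv he => absurd he (harc t u hu v hv))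
  have h3 := cost_le_of_isPotential h1 h2 hW'
  have h4 : ((W' 0 ∩ W' 1).card : ℝ) + 1 ≤ (W 0 ∩ W 1).card := by exact_mod_cast hlt
  have h5 : (l + δ) * ((W' 0 ∩ W' 1).card - (W 0 ∩ W 1).card) ≤ (l + δ) * (-1) :=
    mul_le_mul_of_nonneg_left (by linarith) hbig.2
  have := le_abs_self x
  linarith [hbig.1]

/-! ### Tight exchanges and augmenting paths -/

/-- The arc `u → v` of type `t`: the exchange `W t - v + u` is possible and does not raise the
weight (hence leaves it unchanged if `W t` has minimum weight). -/
def Tight (N : Fin 2 → Matroid E) (w : Fin 2 → E → ℝ) (W : Fin 2 → Finset E) (t : Fin 2)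
    (u v : E) : Prop :=
  Exch (N t) (W t) u v ∧ w t u ≤ w t v

/-- Breadth first search labels for the tight arcs, starting from the elements outside both sets.
`L v` is the number of elements on a shortest path to `v`, or zero if there is none; `pred v` is
the last but one element of that path and `typ v` the type of its last arc. -/
structure IsBFS (N : Fin 2 → Matroid E) (w : Fin 2 → E → ℝ) (W : Fin 2 → Finset E)
    (L : E → ℕ) (pred : E → E) (typ : E → Fin 2) : Prop where
  source : ∀ v, L v = 1 ↔ ∀ t, v ∉ W t
  parent : ∀ v, 2 ≤ L v → L (pred v) + 1 = L v ∧ Tight N w W (typ v) (pred v) v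
  closed : ∀ t u v, L u ≠ 0 → Tight N w W t u v → L v ≠ 0 ∧ L v ≤ L u + 1

/-- The pair after the first `k` arcs of the search path to `s`, traversed backwards from `s`, have
been exchanged. -/
def toggled (W : Fin 2 → Finset E) (pred : E → E) (typ : E → Fin 2) (s : E) :
    ℕ → Fin 2 → Finset E
  | 0 => W
  | k + 1 => fun t =>
      if typ (pred^[k] s) = t then
        insert (pred^[k + 1] s) ((toggled W pred typ s k t).erase (pred^[k] s))
      else toggled W pred typ s k t

variable {L : E → ℕ} {pred : E → E} {typ : E → Fin 2} {s : E}

lemma IsBFS.level (h : IsBFS N w W L pred typ) {k : ℕ} (hk : k + 1 ≤ L s) :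
    L (pred^[k] s) = L s - k := by
  induction k with
  | zero => simp
  | succ k ih =>
    have h1 := ih (by omega)
    have h2 := (h.parent (pred^[k] s) (by omega)).1
    rw [Function.iterate_succ_apply']
    omega

lemma IsBFS.tight (h : IsBFS N w W L pred typ) {k : ℕ} (hk : k + 2 ≤ L s) :
    Tight N w W (typ (pred^[k] s)) (pred^[k + 1] s) (pred^[k] s) := by
  have h1 := h.level (s := s) (k := k) (by omega)
  rw [Function.iterate_succ_apply']
  exact (h.parent (pred^[k] s) (by omega)).2

lemma IsBFS.injOn (h : IsBFS N w W L pred typ) {i j : ℕ} (hi : i + 1 ≤ L s) (hj : j + 1 ≤ L s)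
    (hij : pred^[i] s = pred^[j] s) : i = j := by
  have h1 := h.level hi
  have h2 := h.level hj
  rw [hij] at h1
  omega

lemma IsBFS.mem_toggled (h : IsBFS N w W L pred typ) {k : ℕ} (hk : k + 1 ≤ L s) (t : Fin 2) (e : E) :
    e ∈ toggled W pred typ s k t ↔
      (e ∈ W t ∧ ∀ i < k, typ (pred^[i] s) = t → e ≠ pred^[i] s) ∨
        ∃ i < k, typ (pred^[i] s) = t ∧ e = pred^[i + 1] s := by
  induction k with
  | zero => simp [toggled]
  | succ k ih =>
    have ih := ih (by omega)
    simp only [toggled]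
    have hT := h.tight (s := s) (k := k) (by omega)
    split_ifs with ht
    · rw [ht] at hT
      rw [Finset.mem_insert, Finset.mem_erase, ih]
      constructor
      · rintro (he | ⟨he, ⟨h1, h2⟩ | ⟨i, hi, h1, h2⟩⟩)
        · exact Or.inr ⟨k, by omega, ht, he⟩
        · refine Or.inl ⟨h1, fun i hi hti => ?_⟩
          rcases Nat.lt_succ_iff_lt_or_eq.1 hi with hi | rfl
          · exact h2 i hi hti
          · exact he
        · exact Or.inr ⟨i, by omega, h1, h2⟩
      · rintro (⟨h1, h2⟩ | ⟨i, hi, h1, h2⟩)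
        · exact Or.inr ⟨h2 k (by omega) ht, Or.inl ⟨h1, fun i hi => h2 i (by omega)⟩⟩
        · rcases Nat.lt_succ_iff_lt_or_eq.1 hi with hi | rfl
          · refine Or.inr ⟨?_, Or.inr ⟨i, hi, h1, h2⟩⟩
            -- An element that has just entered `W t` did not belong to it, so it cannot leave it.
            rintro rfl
            have h3 := h.tight (s := s) (k := i) (by omega)
            rw [h1, ← h2] at h3
            exact h3.1.1 hT.1.2.1
          · exact Or.inl h2
    · rw [ih]
      constructor
      · rintro (⟨h1, h2⟩ | ⟨i, hi, h1, h2⟩)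
        · refine Or.inl ⟨h1, fun i hi hti => ?_⟩
          rcases Nat.lt_succ_iff_lt_or_eq.1 hi with hi | rfl
          · exact h2 i hi hti
          · exact absurd hti ht
        · exact Or.inr ⟨i, by omega, h1, h2⟩
      · rintro (⟨h1, h2⟩ | ⟨i, hi, h1, h2⟩)
        · exact Or.inl ⟨h1, fun i hi => h2 i (by omega)⟩
        · rcases Nat.lt_succ_iff_lt_or_eq.1 hi with hi | rfl
          · exact Or.inr ⟨i, hi, h1, h2⟩
          · exact absurd h1 ht

/-- Exchanging along a shortest path of tight arcs preserves minimality: a tight arc between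
non-consecutive elements would shorten the path. -/
lemma IsBFS.isMinBase_toggled (h : IsBFS N w W L pred typ) (hE : ∀ t, (N t).E = Set.univ)
    (hW : ∀ t, IsMinBase (N t) (w t) (W t)) (hs : L s ≠ 0) (t : Fin 2) :
    IsMinBase (N t) (w t) (toggled W pred typ s (L s - 1) t) := by
  set J := (Finset.range (L s - 1)).filter fun i => typ (pred^[i] s) = t with hJ
  have hmem : ∀ i ∈ (J : Set ℕ), i + 2 ≤ L s ∧ typ (pred^[i] s) = t := by
    intro i hi
    simp only [hJ, Finset.coe_filter, Finset.mem_range, Set.mem_ofPred_eq] at hi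
    exact ⟨by omega, hi.2⟩
  have := (hW t).exchanges (fun i => L s - i) J (fun i => pred^[i + 1] s) (fun i => pred^[i] s)
    (hE t) (fun i hi => by
      obtain ⟨h1, h2⟩ := hmem i hi
      have := h.tight h1
      rwa [h2] at this)
    (fun i hi j hj hij => by
      have := hmem i hi
      have := hmem j hj
      have := h.injOn (s := s) (i := i + 1) (j := j + 1) (by omega) (by omega) hij
      omega)
    (fun i hi j hj hij => by
      have := hmem i hi
      have := hmem j hj
      exact h.injOn (s := s) (by omega) (by omega) hij)
    (fun i hi j hj hij => by
      have := hmem i hi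
      have := hmem j hj
      dsimp only at hij
      omega)
    (fun i hi j hj hij he hw => by
      have h1 := hmem i hi
      have h2 := hmem j hj
      have h3 := h.level (s := s) (k := i + 1) (by omega)
      have h4 := h.level (s := s) (k := j) (by omega)
      have h5 := (h.closed t _ _ (by omega) ⟨he, hw⟩).2
      omega)
  convert this using 1
  ext e
  rw [h.mem_toggled (by omega)]
  simp only [hJ, mem_union, mem_sdiff, mem_image, mem_filter, mem_range]
  constructor
  · rintro (⟨h1, h2⟩ | ⟨i, hi, h1, h2⟩)
    · exact Or.inl ⟨h1, fun ⟨i, hi, he⟩ => h2 i hi.1 hi.2 he.symm⟩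
    · exact Or.inr ⟨i, ⟨hi, h1⟩, h2.symm⟩
  · rintro (⟨h1, h2⟩ | ⟨i, hi, h2⟩)
    · exact Or.inl ⟨h1, fun i hi h3 he => h2 ⟨i, ⟨hi, h3⟩, he.symm⟩⟩
    · exact Or.inr ⟨i, hi.1, hi.2, h2.symm⟩

lemma IsBFS.inter_toggled (h : IsBFS N w W L pred typ) (hs : L s ≠ 0) (hsink : ∀ t, s ∈ W t) :
    (∀ e, (∀ t, e ∉ toggled W pred typ s (L s - 1) t) → ∀ t, e ∉ W t) ∧
    ∀ e, (∀ t, e ∈ toggled W pred typ s (L s - 1) t) ↔ (∀ t, e ∈ W t) ∧ e ≠ s := by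
  have hL : 2 ≤ L s := by
    by_contra hlt
    have : L s = 1 := by omega
    exact (h.source s).1 this 0 (hsink 0)
  have hmem := fun t e => h.mem_toggled (s := s) (k := L s - 1) (by omega) t e
  have htight : ∀ i < L s - 1, pred^[i + 1] s ∉ W (typ (pred^[i] s)) ∧
      pred^[i] s ∈ W (typ (pred^[i] s)) := fun i hi =>
    ⟨(h.tight (s := s) (k := i) (by omega)).1.1, (h.tight (s := s) (k := i) (by omega)).1.2.1⟩
  have hinj : ∀ i < L s, ∀ j < L s, pred^[i] s = pred^[j] s → i = j := fun i hi j hj =>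
    h.injOn (by omega) (by omega)
  refine ⟨fun e he t het => ?_, fun e => ⟨fun he => ?_, fun he t => ?_⟩⟩
  · have h1 := (not_or.1 (mt (hmem t e).2 (he t))).1
    push Not at h1
    obtain ⟨i, hi, hit, rfl⟩ := h1 het
    rcases i with _ | i
    · obtain ⟨t', ht'⟩ : ∃ t' : Fin 2, t' ≠ t := ⟨1 - t, by fin_cases t <;> simp⟩
      apply he t'
      rw [hmem]
      refine Or.inl ⟨hsink t', fun j hj hjt hj' => ?_⟩
      have := hinj 0 (by omega) j (by omega) hj'
      subst this
      exact ht' (hjt.symm.trans hit)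
    · apply he (typ (pred^[i] s))
      rw [hmem]
      exact Or.inr ⟨i, by omega, rfl, rfl⟩
  · have hall : ∀ t, e ∈ W t := by
      intro t
      by_contra het
      have := (hmem t e).1 (he t)
      rcases this with h1 | ⟨i, hi, hit, rfl⟩
      · exact het h1.1
      obtain ⟨t', ht'⟩ : ∃ t' : Fin 2, t' ≠ t := ⟨1 - t, by fin_cases t <;> simp⟩
      rcases (hmem t' _).1 (he t') with ⟨h1, h2⟩ | ⟨j, hj, hjt, hj'⟩
      · by_cases hlast : i + 1 < L s - 1
        · have h3 := (htight (i + 1) hlast).2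
          refine h2 (i + 1) hlast ?_ rfl
          have : typ (pred^[i + 1] s) ≠ t := fun h4 => het (h4 ▸ h3)
          omega
        · have h3 := h.level (s := s) (k := i + 1) (by omega)
          exact (h.source (pred^[i + 1] s)).1 (by omega) t' h1
      · have := hinj _ (by omega) _ (by omega) hj'
        have : i = j := by omega
        subst this
        exact ht' (hjt.symm.trans hit)
    refine ⟨hall, ?_⟩
    rintro rfl
    rcases (hmem (typ e) e).1 (he _) with ⟨_, h2⟩ | ⟨j, hj, _, hj'⟩
    · exact h2 0 (by omega) rfl rfl
    · have := hinj 0 (by omega) (j + 1) (by omega) hj'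
      omega
  · rw [hmem]
    refine Or.inl ⟨he.1 t, ?_⟩
    rintro i hi hit rfl
    rcases i with _ | i
    · exact he.2 rfl
    · exact (htight i (by omega)).1 (he.1 _)

/-- Augmentation: exchanging along the search path to a common element `s` removes `s` from the
intersection and keeps the pair certified. -/
lemma Certified.augment (hc : Certified N c w W) (hE : ∀ t, (N t).E = Set.univ)
    (h : IsBFS N w W L pred typ) (hs : L s ≠ 0) (hsink : ∀ t, s ∈ W t) :
    Certified N c w (toggled W pred typ s (L s - 1)) ∧
      (toggled W pred typ s (L s - 1) 0 ∩ toggled W pred typ s (L s - 1) 1).card + 1 =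
        (W 0 ∩ W 1).card := by
  obtain ⟨hW, α, l, hp⟩ := hc
  obtain ⟨h1, h2⟩ := h.inter_toggled hs hsink
  refine ⟨⟨h.isMinBase_toggled hE hW hs, α, l, hp.shift, hp.nonneg, hp.le,
    fun e he => hp.none e (h1 e he), fun e he => hp.both e ((h2 e).1 he).1⟩, ?_⟩
  have : toggled W pred typ s (L s - 1) 0 ∩ toggled W pred typ s (L s - 1) 1 =
      (W 0 ∩ W 1).erase s := by
    ext e
    have := h2 e
    simp only [Fin.forall_fin_two] at this
    simp only [mem_inter, mem_erase]
    tauto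
  rw [this, Finset.card_erase_add_one]
  simpa [Fin.forall_fin_two] using hsink

/-! ### The set reached by tight arcs -/

open Classical in
/-- The elements reachable by tight arcs from the elements outside both sets. -/
noncomputable def reach [Fintype E] (N : Fin 2 → Matroid E) (w : Fin 2 → E → ℝ)
    (W : Fin 2 → Finset E) : Finset E :=
  Finset.univ.filter fun v => ∃ u, (∀ t, u ∉ W t) ∧
    Relation.ReflTransGen (fun x y => ∃ t, Tight N w W t x y) u v

variable [Fintype E]

lemma IsBFS.mem_reach (h : IsBFS N w W L pred typ) (v : E) : v ∈ reach N w W ↔ L v ≠ 0 := by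
  simp only [reach, Finset.mem_filter, Finset.mem_univ, true_and]
  constructor
  · rintro ⟨u, hu, huv⟩
    induction huv with
    | refl => rw [(h.source u).2 hu]; simp
    | tail _ hxy ih =>
      obtain ⟨t, ht⟩ := hxy
      exact (h.closed t _ _ ih ht).1
  · intro hv
    induction hk : L v generalizing v with
    | zero => exact absurd hk hv
    | succ k ih =>
      rcases Nat.eq_zero_or_pos k with rfl | hk0
      · exact ⟨v, (h.source v).1 hk, .refl⟩
      · obtain ⟨h1, h2⟩ := h.parent v (by omega)
        obtain ⟨u, hu, hu'⟩ := ih (pred v) (by omega) (by omega)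
        exact ⟨u, hu, hu'.tail ⟨_, h2⟩⟩

/-- Raising the weights outside the reached set until some arc leaving it becomes tight enlarges the
reached set. -/
lemma reach_card_lt {δ : ℝ} {t : Fin 2} {u v : E} (hu : u ∈ reach N w W) (hv : v ∉ reach N w W)
    (he : Exch (N t) (W t) u v) (hδ : w t u ≤ w t v + δ) :
    (reach N w W).card <
      (reach N (fun t e => w t e + if e ∈ reach N w W then 0 else δ) W).card := by
  set R := reach N w W with hR
  set w' : Fin 2 → E → ℝ := fun t e => w t e + if e ∈ R then 0 else δ with hw'
  have hsub : R ⊆ reach N w' W := by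
    intro x hx
    have hx' := hx
    simp only [hR, reach, Finset.mem_filter, Finset.mem_univ, true_and] at hx'
    obtain ⟨s, hs, hsx⟩ := hx'
    simp only [reach, Finset.mem_filter, Finset.mem_univ, true_and]
    refine ⟨s, hs, ?_⟩
    clear hx
    induction hsx with
    | refl => exact .refl
    | @tail y z hsy hyz ih =>
      refine ih.tail ?_
      obtain ⟨t, ht⟩ := hyz
      have hy : y ∈ R := by
        simp only [hR, reach, Finset.mem_filter, Finset.mem_univ, true_and]
        exact ⟨s, hs, hsy⟩
      have hz : z ∈ R := by
        simp only [hR, reach, Finset.mem_filter, Finset.mem_univ, true_and]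
        exact ⟨s, hs, hsy.tail ⟨t, ht⟩⟩
      exact ⟨t, ht.1, by simpa [hw', hy, hz] using ht.2⟩
  refine Finset.card_lt_card ⟨hsub, fun hsup => hv (hsup ?_)⟩
  have := hsub hu
  simp only [reach, Finset.mem_filter, Finset.mem_univ, true_and] at this ⊢
  obtain ⟨s, hs, hsu⟩ := this
  exact ⟨s, hs, hsu.tail ⟨t, he, by simpa [hw', hu, hv] using hδ⟩⟩

end Pair
end MatroidPair

namespace OracleRAM

/-! ### Structured programs -/

/-- Structured programs: no general loops, only loops `for c in 0, …, n + k - 1` whose counter is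
the cell `c[0]`. The only real operations are copying, addition and subtraction. Such a program has
a total denotation `SProg.exec`, and its running time is bounded by the polynomial `SProg.time`. -/
inductive SProg : Type
  | skip
  | setNat (a : ℕ) (i e : NatExpr)
  | copyReal (b : ℕ) (i : NatExpr) (b' : ℕ) (i' : NatExpr)
  | addReal (b : ℕ) (i : NatExpr) (b₁ : ℕ) (i₁ : NatExpr) (b₂ : ℕ) (i₂ : NatExpr)
  | subReal (b : ℕ) (i : NatExpr) (b₁ : ℕ) (i₁ : NatExpr) (b₂ : ℕ) (i₂ : NatExpr)
  | query (a : ℕ) (i : NatExpr) (s : ℕ)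
  | seq (P Q : SProg)
  | ite (c : Test) (P Q : SProg)
  | forLoop (c k : ℕ) (P : SProg)

namespace SProg

/-- The natural arrays that a program may write to. -/
def natWrites : SProg → List ℕ
  | skip => []
  | setNat a _ _ => [a]
  | copyReal _ _ _ _ => []
  | addReal _ _ _ _ _ _ => []
  | subReal _ _ _ _ _ _ => []
  | query a _ _ => [a]
  | seq P Q => P.natWrites ++ Q.natWrites
  | ite _ P Q => P.natWrites ++ Q.natWrites
  | .forLoop c _ P => c :: P.natWrites

/-- The real arrays that a program may write to. -/
def realWrites : SProg → List ℕ
  | skip => []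
  | setNat _ _ _ => []
  | copyReal b _ _ _ => [b]
  | addReal b _ _ _ _ _ => [b]
  | subReal b _ _ _ _ _ => [b]
  | query _ _ _ => []
  | seq P Q => P.realWrites ++ Q.realWrites
  | ite _ P Q => P.realWrites ++ Q.realWrites
  | .forLoop _ _ P => P.realWrites

/-- No loop body writes to its own counter. -/
def WellFormed : SProg → Prop
  | seq P Q => P.WellFormed ∧ Q.WellFormed
  | ite _ P Q => P.WellFormed ∧ Q.WellFormed
  | .forLoop c _ P => c ∉ P.natWrites ∧ P.WellFormed
  | _ => True

/-- A polynomial bound for the running time. -/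
noncomputable def time : SProg → Polynomial ℕ
  | seq P Q => P.time + Q.time + 1
  | ite _ P Q => P.time + Q.time + 1
  | .forLoop _ k P => (Polynomial.X + Polynomial.C k) * (P.time + 3) + 3
  | _ => 1

/-- The translation to programs of the machine. -/
def compile : SProg → Prog
  | skip => .skip
  | setNat a i e => .setNat a i e
  | copyReal b i b' i' => .copyReal b i b' i'
  | addReal b i b₁ i₁ b₂ i₂ => .arith .add b i b₁ i₁ b₂ i₂
  | subReal b i b₁ i₁ b₂ i₂ => .arith .sub b i b₁ i₁ b₂ i₂
  | query a i s => .query a i s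
  | seq P Q => .seq P.compile Q.compile
  | ite c P Q => .ite c P.compile Q.compile
  | .forLoop c k P => .seq (.setNat c (.lit 0) (.lit 0))
      (.loop (.natLt (.cell c (.lit 0)) (.add (.cell 0 (.lit 0)) (.lit k)))
        (.seq P.compile (.setNat c (.lit 0) (.add (.cell c (.lit 0)) (.lit 1)))))

/-- The memory after `j` iterations of a loop with body `f` and counter `c`. -/
def forIter (f : Memory → Memory) (c : ℕ) (m : Memory) : ℕ → Memory
  | 0 => m.writeNat c 0 0
  | j + 1 => (f (forIter f c m j)).writeNat c 0 (j + 1)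

open Classical in
/-- The memory after a structured program has been run. -/
noncomputable def exec {n : ℕ} (Ind : Finset (Fin n) → Prop) : SProg → Memory → Memory
  | skip, m => m
  | setNat a i e, m => m.writeNat a (i.eval m) (e.eval m)
  | copyReal b i b' i', m => m.writeReal b (i.eval m) (m.real b' (i'.eval m))
  | addReal b i b₁ i₁ b₂ i₂, m =>
      m.writeReal b (i.eval m) (m.real b₁ (i₁.eval m) + m.real b₂ (i₂.eval m))
  | subReal b i b₁ i₁ b₂ i₂, m =>
      m.writeReal b (i.eval m) (m.real b₁ (i₁.eval m) - m.real b₂ (i₂.eval m))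
  | query a i s, m => m.writeNat a (i.eval m) (if Ind (m.toFinset n s) then 1 else 0)
  | seq P Q, m => Q.exec Ind (P.exec Ind m)
  | ite c P Q, m => if c.Holds m then P.exec Ind m else Q.exec Ind m
  | .forLoop c k P, m => forIter (P.exec Ind) c m (n + k)

end SProg

section Memory

variable (m : Memory) (a b i j v : ℕ) (x : ℝ)

lemma Memory.writeNat_nat : (m.writeNat a i v).nat b j = if b = a ∧ j = i then v else m.nat b j := by
  simp only [Memory.writeNat, Function.update_apply]
  split_ifs <;> simp_all

@[simp] lemma Memory.writeNat_nat_self : (m.writeNat a i v).nat a i = v := by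
  simp [Memory.writeNat_nat]

lemma Memory.writeNat_nat_of_ne {a b : ℕ} (h : b ≠ a) : (m.writeNat a i v).nat b = m.nat b := by
  funext j
  simp [Memory.writeNat_nat, h]

@[simp] lemma Memory.writeNat_real : (m.writeNat a i v).real = m.real := rfl

lemma Memory.writeReal_real :
    (m.writeReal a i x).real b j = if b = a ∧ j = i then x else m.real b j := by
  simp only [Memory.writeReal, Function.update_apply]
  split_ifs <;> simp_all

@[simp] lemma Memory.writeReal_real_self : (m.writeReal a i x).real a i = x := by
  simp [Memory.writeReal_real]

lemma Memory.writeReal_real_of_ne {a b : ℕ} (h : b ≠ a) : (m.writeReal a i x).real b = m.real b := by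
  funext j
  simp [Memory.writeReal_real, h]

@[simp] lemma Memory.writeReal_nat : (m.writeReal a i x).nat = m.nat := rfl

end Memory

namespace SProg

variable {n : ℕ} (Ind : Finset (Fin n) → Prop)

lemma exec_nat {P : SProg} {a : ℕ} (ha : a ∉ P.natWrites) (m : Memory) :
    (P.exec Ind m).nat a = m.nat a := by
  induction P generalizing m with
  | skip => rfl
  | setNat | query =>
    simp only [natWrites, List.mem_singleton] at ha
    simp [exec, Memory.writeNat_nat_of_ne _ _ _ ha]
  | copyReal | addReal | subReal => rfl
  | seq P Q ihP ihQ =>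
    simp only [natWrites, List.mem_append, not_or] at ha
    rw [exec, ihQ ha.2, ihP ha.1]
  | ite c P Q ihP ihQ =>
    simp only [natWrites, List.mem_append, not_or] at ha
    rw [exec]
    split_ifs
    · exact ihP ha.1 m
    · exact ihQ ha.2 m
  | forLoop c k P ih =>
    simp only [natWrites, List.mem_cons, not_or] at ha
    rw [exec]
    induction n + k with
    | zero => exact Memory.writeNat_nat_of_ne _ _ _ ha.1
    | succ j ihj => rw [forIter, Memory.writeNat_nat_of_ne _ _ _ ha.1, ih ha.2, ihj]

lemma exec_real {P : SProg} {b : ℕ} (hb : b ∉ P.realWrites) (m : Memory) :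
    (P.exec Ind m).real b = m.real b := by
  induction P generalizing m with
  | skip => rfl
  | setNat | query => rfl
  | copyReal | addReal | subReal =>
    simp only [realWrites, List.mem_singleton] at hb
    simp [exec, Memory.writeReal_real_of_ne _ _ _ hb]
  | seq P Q ihP ihQ =>
    simp only [realWrites, List.mem_append, not_or] at hb
    rw [exec, ihQ hb.2, ihP hb.1]
  | ite c P Q ihP ihQ =>
    simp only [realWrites, List.mem_append, not_or] at hb
    rw [exec]
    split_ifs
    · exact ihP hb.1 m
    · exact ihQ hb.2 m
  | forLoop c k P ih =>
    simp only [realWrites] at hb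
    rw [exec]
    induction n + k with
    | zero => rfl
    | succ j ihj => rw [forIter, Memory.writeNat_real, ih hb, ihj]

/-- The invariant rule for loops. Cells that the loop does not write keep their initial values. -/
lemma exec_for {P : SProg} {c k : ℕ} {m₀ : Memory} (I : ℕ → Memory → Prop)
    (h0 : I 0 (m₀.writeNat c 0 0))
    (hs : ∀ j < n + k, ∀ m, (∀ a ∉ c :: P.natWrites, m.nat a = m₀.nat a) →
      (∀ b ∉ P.realWrites, m.real b = m₀.real b) → m.nat c 0 = j → I j m →
      I (j + 1) ((P.exec Ind m).writeNat c 0 (j + 1))) :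
    I (n + k) ((SProg.forLoop c k P).exec Ind m₀) := by
  rw [exec]
  suffices h : ∀ j ≤ n + k,
      (∀ a ∉ c :: P.natWrites, (forIter (P.exec Ind) c m₀ j).nat a = m₀.nat a) ∧
      (∀ b ∉ P.realWrites, (forIter (P.exec Ind) c m₀ j).real b = m₀.real b) ∧
      (forIter (P.exec Ind) c m₀ j).nat c 0 = j ∧ I j (forIter (P.exec Ind) c m₀ j) from
    (h _ le_rfl).2.2.2
  intro j hj
  induction j with
  | zero =>
    refine ⟨fun a ha => ?_, fun b _ => rfl, by simp [forIter], h0⟩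
    rw [List.mem_cons, not_or] at ha
    exact Memory.writeNat_nat_of_ne _ _ _ ha.1
  | succ j ih =>
    obtain ⟨h1, h2, h3, h4⟩ := ih (by omega)
    refine ⟨fun a ha => ?_, fun b hb => ?_, by simp [forIter], hs j (by omega) _ h1 h2 h3 h4⟩
    · rw [← h1 a ha]
      rw [List.mem_cons, not_or] at ha
      rw [forIter, Memory.writeNat_nat_of_ne _ _ _ ha.1, exec_nat _ ha.2]
    · rw [← h2 b hb, forIter, Memory.writeNat_real, exec_real _ hb]

/-- The compiled program computes the denotation within the time bound. -/
theorem exists_steps {P : SProg} (hP : P.WellFormed) (h0 : 0 ∉ P.natWrites) {m : Memory}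
    (hm : m.nat 0 0 = n) : ∃ t ≤ P.time.eval n, ∀ K,
      (step Ind)^[t] ⟨P.compile :: K, m⟩ = ⟨K, P.exec Ind m⟩ := by
  induction P generalizing m with
  | skip | setNat | copyReal | addReal | subReal | query =>
    exact ⟨1, by simp [time], fun K => rfl⟩
  | seq P Q ihP ihQ =>
    simp only [natWrites, List.mem_append, not_or] at h0
    obtain ⟨t, ht, h⟩ := ihP hP.1 h0.1 hm
    obtain ⟨t', ht', h'⟩ := ihQ hP.2 h0.2 (m := P.exec Ind m) (by rw [exec_nat _ h0.1, hm])
    refine ⟨t' + (t + 1), by simp [time]; omega, fun K => ?_⟩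
    rw [Function.iterate_add_apply, Function.iterate_succ_apply]
    change (step Ind)^[t'] ((step Ind)^[t] ⟨P.compile :: Q.compile :: K, m⟩) = _
    rw [h, h', exec]
  | ite c P Q ihP ihQ =>
    simp only [natWrites, List.mem_append, not_or] at h0
    by_cases hc : c.Holds m
    · obtain ⟨t, ht, h⟩ := ihP hP.1 h0.1 hm
      refine ⟨t + 1, by simp [time]; omega, fun K => ?_⟩
      rw [Function.iterate_succ_apply, compile, step, if_pos hc, h, exec, if_pos hc]
    · obtain ⟨t, ht, h⟩ := ihQ hP.2 h0.2 hm
      refine ⟨t + 1, by simp [time]; omega, fun K => ?_⟩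
      rw [Function.iterate_succ_apply, compile, step, if_neg hc, h, exec, if_neg hc]
  | forLoop c k P ih =>
    simp only [natWrites, List.mem_cons, not_or] at h0
    obtain ⟨hc0, h0⟩ := h0
    obtain ⟨hc, hP⟩ := hP
    set test : Test := .natLt (.cell c (.lit 0)) (.add (.cell 0 (.lit 0)) (.lit k)) with htest
    set lp : Prog := .loop test
      (.seq P.compile (.setNat c (.lit 0) (.add (.cell c (.lit 0)) (.lit 1)))) with hlp
    have key : ∀ j, j ≤ n + k → ∃ t ≤ j * (P.time.eval n + 3), ∀ K,
        (step Ind)^[t] ⟨lp :: K, m.writeNat c 0 0⟩ =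
          ⟨lp :: K, forIter (P.exec Ind) c m j⟩ ∧
        (forIter (P.exec Ind) c m j).nat 0 0 = n ∧ (forIter (P.exec Ind) c m j).nat c 0 = j := by
      intro j
      induction j with
      | zero =>
        intro _
        refine ⟨0, by simp, fun K => ⟨rfl, ?_, by simp [forIter]⟩⟩
        rw [forIter, Memory.writeNat_nat_of_ne _ _ _ hc0, hm]
      | succ j ihj =>
        intro hj
        obtain ⟨t, ht, h⟩ := ihj (by omega)
        obtain ⟨_, h2, h3⟩ := h []
        obtain ⟨t', ht', h'⟩ := ih hP h0 h2
        have hexc : (P.exec Ind (forIter (P.exec Ind) c m j)).nat c 0 = j := by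
          rw [exec_nat _ hc, h3]
        refine ⟨1 + (t' + (2 + t)), by rw [Nat.succ_mul]; omega, fun K => ⟨?_, ?_, ?_⟩⟩
        · rw [Function.iterate_add_apply, Function.iterate_add_apply, Function.iterate_add_apply,
            (h K).1]
          have hT : test.Holds (forIter (P.exec Ind) c m j) := by
            simp only [htest, Test.Holds, NatExpr.eval, h2, h3]; omega
          have h4 : (step Ind)^[2] ⟨lp :: K, forIter (P.exec Ind) c m j⟩ =
              ⟨P.compile :: .setNat c (.lit 0) (.add (.cell c (.lit 0)) (.lit 1)) :: lp :: K,
                forIter (P.exec Ind) c m j⟩ := by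
            rw [Function.iterate_succ_apply, hlp, step, if_pos hT]
            rfl
          rw [h4, h']
          simp only [Function.iterate_one, step, NatExpr.eval, forIter, hexc]
        · rw [forIter, Memory.writeNat_nat_of_ne _ _ _ hc0, exec_nat _ h0, h2]
        · simp [forIter]
    obtain ⟨t, ht, h⟩ := key (n + k) le_rfl
    refine ⟨1 + (t + 2), by simp [time]; omega, fun K => ?_⟩
    obtain ⟨h1, h2, h3⟩ := h K
    rw [Function.iterate_add_apply, Function.iterate_add_apply]
    have h4 : (step Ind)^[2] ⟨(SProg.forLoop c k P).compile :: K, m⟩ =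
        ⟨lp :: K, m.writeNat c 0 0⟩ := rfl
    have hT : ¬ test.Holds (forIter (P.exec Ind) c m (n + k)) := by
      simp only [htest, Test.Holds, NatExpr.eval, h2, h3]; omega
    rw [h4, h1, Function.iterate_one, hlp, step, if_neg hT, exec]

end SProg

/-! ### Encoding lengths in programs without multiplication and division -/

/-- The program uses no multiplication, no division and no real constants. -/
def Prog.Additive : Prog → Prop
  | .setReal _ _ _ => False
  | .arith .mul _ _ _ _ _ _ => False
  | .arith .div _ _ _ _ _ _ => False
  | .seq P Q => P.Additive ∧ Q.Additive
  | .ite _ P Q => P.Additive ∧ Q.Additive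
  | .loop _ P => P.Additive
  | _ => True

lemma SProg.additive_compile (P : SProg) : P.compile.Additive := by
  induction P with
  | seq P Q ihP ihQ => exact ⟨ihP, ihQ⟩
  | ite c P Q ihP ihQ => exact ⟨ihP, ihQ⟩
  | forLoop c k P ih => exact ⟨trivial, ih, trivial⟩
  | _ => trivial

/-- All real cells are integer multiples of `1 / D`, with numerators bounded by `B` in
absolute value. -/
def Memory.Bounded (D : ℕ) (B : ℤ) (m : Memory) : Prop :=
  ∀ b i, ∃ z : ℤ, m.real b i = z / D ∧ |z| ≤ B

lemma Memory.Bounded.writeReal {D : ℕ} {B : ℤ} {m : Memory} (h : m.Bounded D B) {x : ℝ}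
    (hx : ∃ z : ℤ, x = z / D ∧ |z| ≤ B) (b i : ℕ) : (m.writeReal b i x).Bounded D B := by
  intro b' i'
  rw [Memory.writeReal_real]
  split_ifs
  · exact hx
  · exact h b' i'

/-- One step of an additive program at most doubles the numerators. -/
lemma bounded_step {n : ℕ} (Ind : Finset (Fin n) → Prop) {D : ℕ} {B : ℤ} (hB : 0 ≤ B) (s : Config)
    (hs : ∀ P ∈ s.todo, P.Additive) (hm : s.mem.Bounded D B) :
    (∀ P ∈ (step Ind s).todo, P.Additive) ∧ (step Ind s).mem.Bounded D (2 * B) := by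
  have hmono : s.mem.Bounded D (2 * B) := fun b i => by
    obtain ⟨z, h1, h2⟩ := hm b i
    exact ⟨z, h1, by omega⟩
  obtain ⟨todo, m⟩ := s
  dsimp only at hs hm hmono
  rcases todo with _ | ⟨P, K⟩
  · exact ⟨hs, hmono⟩
  have hP := hs P (by simp)
  have hK : ∀ P ∈ K, P.Additive := fun Q hQ => hs Q (by simp [hQ])
  cases P with
  | skip => exact ⟨hK, hmono⟩
  | setNat a i e => exact ⟨hK, hmono⟩
  | setReal b i z => exact hP.elim
  | copyReal b i b' i' => exact ⟨hK, hmono.writeReal (hmono _ _) _ _⟩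
  | arith op b i b₁ i₁ b₂ i₂ =>
    obtain ⟨z₁, h1, h1'⟩ := hm b₁ (i₁.eval m)
    obtain ⟨z₂, h2, h2'⟩ := hm b₂ (i₂.eval m)
    rw [abs_le] at h1' h2'
    refine ⟨hK, hmono.writeReal ?_ _ _⟩
    cases op with
    | add =>
      refine ⟨z₁ + z₂, ?_, by rw [abs_le]; omega⟩
      simp only [ArithOp.eval, h1, h2]; push_cast; ring
    | sub =>
      refine ⟨z₁ - z₂, ?_, by rw [abs_le]; omega⟩
      simp only [ArithOp.eval, h1, h2]; push_cast; ring
    | mul => exact hP.elim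
    | div => exact hP.elim
  | query a i s => exact ⟨hK, hmono⟩
  | seq P Q =>
    refine ⟨?_, hmono⟩
    simp only [step, List.mem_cons, forall_eq_or_imp]
    exact ⟨hP.1, hP.2, hK⟩
  | ite c P Q =>
    rw [step]
    split_ifs
    · refine ⟨?_, hmono⟩
      simp only [List.mem_cons, forall_eq_or_imp]
      exact ⟨hP.1, hK⟩
    · refine ⟨?_, hmono⟩
      simp only [List.mem_cons, forall_eq_or_imp]
      exact ⟨hP.2, hK⟩
  | loop c P =>
    rw [step]
    split_ifs
    · refine ⟨?_, hmono⟩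
      simp only [List.mem_cons, forall_eq_or_imp]
      exact ⟨hP, hP, hK⟩
    · exact ⟨hK, hmono⟩

lemma bounded_iterate_step {n : ℕ} (Ind : Finset (Fin n) → Prop) {D : ℕ} {B : ℤ} (hB : 0 ≤ B)
    (s : Config) (hs : ∀ P ∈ s.todo, P.Additive) (hm : s.mem.Bounded D B) (t : ℕ) :
    ((step Ind)^[t] s).mem.Bounded D (2 ^ t * B) := by
  suffices h : (∀ P ∈ ((step Ind)^[t] s).todo, P.Additive) ∧
      ((step Ind)^[t] s).mem.Bounded D (2 ^ t * B) from h.2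
  induction t with
  | zero => simpa using ⟨hs, hm⟩
  | succ t ih =>
    rw [Function.iterate_succ_apply', pow_succ, mul_comm _ (2 : ℤ), mul_assoc]
    exact bounded_step Ind (by positivity) _ ih.1 ih.2

lemma size_mul_le (a b : ℕ) : Nat.size (a * b) ≤ Nat.size a + Nat.size b := by
  rw [Nat.size_le, pow_add]
  exact Nat.mul_lt_mul'' (Nat.lt_size_self a) (Nat.lt_size_self b)

lemma size_prod_le {ι : Type*} (s : Finset ι) (f : ι → ℕ) :
    Nat.size (∏ i ∈ s, f i) ≤ ∑ i ∈ s, Nat.size (f i) + 1 := by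
  classical
  induction s using Finset.induction_on with
  | empty => simp
  | insert a s ha ih =>
    rw [Finset.prod_insert ha, Finset.sum_insert ha]
    have := size_mul_le (f a) (∏ i ∈ s, f i)
    omega

lemma size_succ_le (a : ℕ) : Nat.size (a + 1) ≤ Nat.size a + 1 := by
  rw [Nat.size_le, pow_succ]
  have := Nat.lt_size_self a
  omega

/-- A fraction with denominator `D` and numerator at most `B` has small encoding length, also after
reduction to lowest terms. -/
lemma bitSize_div_le {D B : ℕ} (hD : D ≠ 0) {z : ℤ} (hz : |z| ≤ B) :
    bitSize ((z : ℚ) / D) ≤ Nat.size B + Nat.size D := by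
  have hD' : (D : ℤ) ≠ 0 := by exact_mod_cast hD
  have h1 : ((z : ℚ) / D) = Rat.divInt z D := by
    rw [Rat.divInt_eq_div]; simp
  rw [bitSize, h1]
  gcongr
  · apply Nat.size_le_size
    by_cases h0 : z = 0
    · simp [h0]
    have h2 : (Rat.divInt z D).num ∣ z := Rat.num_dvd z hD'
    have h3 := Int.natAbs_dvd_natAbs.2 h2
    have h4 := Nat.le_of_dvd (by omega) h3
    rw [Int.abs_eq_natAbs] at hz
    omega
  · apply Nat.size_le_size
    have h2 : ((Rat.divInt z D).den : ℤ) ∣ D := Rat.den_dvd z D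
    exact Nat.le_of_dvd (by omega) (by exact_mod_cast h2)

/-- Rational numbers over a finite index set have a common denominator, and the numerators over it
have a common bound, both of encoding length linear in the total encoding length. -/
lemma exists_common_denominator {ι : Type*} [Fintype ι] (r : ι → ℚ) :
    ∃ D B : ℕ, D ≠ 0 ∧ (∀ i, ∃ z : ℤ, r i = z / D ∧ |z| ≤ B) ∧
      Nat.size D ≤ ∑ i, bitSize (r i) + 1 ∧
      Nat.size B ≤ 2 * ∑ i, bitSize (r i) + Fintype.card ι + 2 := by
  classical
  set D := ∏ i, (r i).den with hD
  set A := ∏ i, ((r i).num.natAbs + 1) with hA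
  have hD0 : D ≠ 0 := Finset.prod_ne_zero_iff.2 fun i _ => (r i).den_ne_zero
  have hsD : Nat.size D ≤ ∑ i, bitSize (r i) + 1 :=
    (size_prod_le _ _).trans (by
      gcongr with i
      exact Nat.le_add_left _ _)
  have hsA : Nat.size A ≤ ∑ i, bitSize (r i) + Fintype.card ι + 1 := by
    refine (size_prod_le _ _).trans ?_
    have : ∑ i, Nat.size ((r i).num.natAbs + 1) ≤ ∑ i, (bitSize (r i) + 1) := by
      gcongr with i
      refine (size_succ_le _).trans ?_
      rw [bitSize]
      omega
    rw [Finset.sum_add_distrib] at this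
    simp only [Finset.sum_const, Finset.card_univ, smul_eq_mul, mul_one] at this
    omega
  refine ⟨D, A * D, hD0, fun i => ?_, hsD, ?_⟩
  · have hdvd : (r i).den ∣ D := Finset.dvd_prod_of_mem _ (Finset.mem_univ i)
    have hdvd' : (r i).num.natAbs + 1 ∣ A :=
      Finset.dvd_prod_of_mem (fun i => (r i).num.natAbs + 1) (Finset.mem_univ i)
    obtain ⟨q, hq⟩ := hdvd
    have hA0 : A ≠ 0 := Finset.prod_ne_zero_iff.2 fun i _ => by omega
    refine ⟨(r i).num * q, ?_, ?_⟩
    · have h1 : (D : ℚ) ≠ 0 := by exact_mod_cast hD0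
      have h2 : ((r i).den : ℚ) ≠ 0 := by exact_mod_cast (r i).den_ne_zero
      rw [eq_div_iff h1]
      nth_rewrite 1 [← Rat.num_div_den (r i)]
      rw [hq]
      push_cast
      field_simp
    · have h1 : (r i).num.natAbs ≤ A :=
        (Nat.le_succ _).trans (Nat.le_of_dvd (by omega) hdvd')
      have h2 : q ≤ D := by
        rw [hq]; exact Nat.le_mul_of_pos_left _ (r i).den_pos
      rw [Int.abs_eq_natAbs, Int.natAbs_mul, Int.natAbs_natCast]
      exact_mod_cast Nat.mul_le_mul h1 h2
  · have := size_mul_le A D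
    omega

lemma eval_mono (p : Polynomial ℕ) {a b : ℕ} (h : a ≤ b) : p.eval a ≤ p.eval b := by
  rw [Polynomial.eval_eq_sum_range, Polynomial.eval_eq_sum_range]
  gcongr

/-- A polynomial-time structured program that finds solutions is strongly polynomial. -/
theorem solvable_of_exec {IsSol : ∀ n : ℕ, Input n → Finset (Fin n) → Finset (Fin n) → Prop}
    (P : SProg) (hP : P.WellFormed) (h0 : 0 ∉ P.natWrites)
    (h : ∀ (n : ℕ) (I : Input n), IsSol n I
      ((P.exec (fun S : Finset (Fin n) => I.M.Indep (S : Set (Fin n))) I.initMem).toFinset n 1)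
      ((P.exec (fun S : Finset (Fin n) => I.M.Indep (S : Set (Fin n))) I.initMem).toFinset n 2)) :
    SolvableInStronglyPolynomialTime IsSol := by
  refine ⟨P.compile, P.time, P.time + 3 * Polynomial.X + 3 * Polynomial.X + 5, fun n I => ?_⟩
  obtain ⟨T, hT, hrun⟩ := SProg.exists_steps (fun S : Finset (Fin n) => I.M.Indep (S : Set (Fin n))) hP h0
    (m := I.initMem) (by simp [Input.initMem])
  have hrunT : I.run P.compile T =
      ⟨[], P.exec (fun S : Finset (Fin n) => I.M.Indep (S : Set (Fin n))) I.initMem⟩ :=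
    hrun []
  refine ⟨⟨T, hT, ?_, ?_⟩, ?_⟩
  · rw [hrunT]
  · rw [hrunT]; exact h n I
  intro d₁ d₂ D hd₁ hd₂ hD t b i
  set r : Fin n ⊕ (Fin n ⊕ Fin (n + 1)) → ℚ := Sum.elim d₁ (Sum.elim d₂ D) with hr
  obtain ⟨Q, B, hQ, hB, hsQ, hsB⟩ := exists_common_denominator r
  have hsum : ∑ i, bitSize (r i) = ∑ e, bitSize (d₁ e) + ∑ e, bitSize (d₂ e) + ∑ j, bitSize (D j) := by
    simp only [hr, Fintype.sum_sum_type, Sum.elim_inl, Sum.elim_inr]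
    omega
  rw [← hsum]
  have hcell : ∀ x, ∃ z : ℤ, ((r x : ℚ) : ℝ) = z / Q ∧ |z| ≤ B := by
    intro x
    obtain ⟨z, h1, h2⟩ := hB x
    exact ⟨z, by rw [h1]; push_cast; rfl, h2⟩
  have hzero : ∃ z : ℤ, (0 : ℝ) = z / Q ∧ |z| ≤ B := ⟨0, by simp, by simp⟩
  have hinit : I.initMem.Bounded Q B := by
    intro b i
    simp only [Input.initMem]
    split_ifs with h1 h2 h3 h4 h5 h6
    · rw [hd₁]; exact hcell (.inl _)
    · exact hzero
    · rw [hd₂]; exact hcell (.inr (.inl _))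
    · exact hzero
    · have := hD ⟨i, by omega⟩
      dsimp only at this
      rw [this]; exact hcell (.inr (.inr _))
    · exact hzero
    · exact hzero
  -- After time `T` the machine has halted, so only the first `T` steps matter.
  obtain ⟨t', ht', heq⟩ : ∃ t' ≤ T, I.run P.compile t = I.run P.compile t' := by
    rcases le_total t T with htT | htT
    · exact ⟨t, htT, rfl⟩
    · refine ⟨T, le_rfl, ?_⟩
      obtain ⟨k, rfl⟩ := Nat.exists_eq_add_of_le htT
      rw [add_comm, Input.run, Function.iterate_add_apply]
      change (step _)^[k] (I.run P.compile T) = _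
      rw [hrunT]
      exact Function.iterate_fixed rfl k
  obtain ⟨z, hz, hzB⟩ := bounded_iterate_step (fun S : Finset (Fin n) => I.M.Indep (S : Set (Fin n)))
    (Int.natCast_nonneg B) ⟨[P.compile], I.initMem⟩ (by simpa using P.additive_compile) hinit t' b i
  refine ⟨z / Q, ?_, ?_⟩
  · rw [heq, Input.run, hz]; push_cast; rfl
  · refine (bitSize_div_le (B := 2 ^ t' * B) hQ (by exact_mod_cast hzB)).trans ?_
    have h1 := size_mul_le (2 ^ t') B
    have h2 : Nat.size (2 ^ t') = t' + 1 := Nat.size_pow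
    have h3 := eval_mono P.time (Nat.le_add_right n (∑ i, bitSize (r i)))
    have h4 : Fintype.card (Fin n ⊕ (Fin n ⊕ Fin (n + 1))) = n + (n + (n + 1)) := by simp
    simp only [Polynomial.eval_add, Polynomial.eval_mul, Polynomial.eval_X, Polynomial.eval_ofNat]
    omega

end OracleRAM

namespace OracleRAM

/-! ### The program -/

namespace SProg

/-- The scalar variable `a`, kept in the cell `a[0]`. -/
def var (a : ℕ) : NatExpr := .cell a (.lit 0)

/-- `b[i] := e` for all `i < n`, where `e` may refer to `i` as the scalar `c`. -/
def fill (c b : ℕ) (e : NatExpr) : SProg := .forLoop c 0 (.setNat b (var c) e)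

/-- Tests whether the arc from `u` (scalar `14`) to `v` (scalar `15`) of type `t` exists: writes a
nonzero number to the scalar `12` if so, and the slack `w t u - w t v` to the real scalar `5`. A
nonzero entry `8[t]` says that the matroid of type `t` is the dual one, so that the complement of
the candidate is to be tested. -/
def arc (t : ℕ) : SProg :=
  .seq (.setNat 12 (.lit 0) (.lit 0)) <|
  .seq (.subReal 5 (.lit 0) (3 + t) (var 14) (3 + t) (var 15)) <|
  .ite (.natLt (.lit 0) (.cell (3 + t) (var 14))) .skip <|
  .ite (.natLt (.cell (3 + t) (var 15)) (.lit 1)) .skip <|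
  .seq (fill 13 7 (.cell (3 + t) (var 13))) <|
  .seq (.setNat 7 (var 15) (.lit 0)) <|
  .seq (.setNat 7 (var 14) (.lit 1)) <|
  .seq (.ite (.natLt (.lit 0) (.cell 8 (.lit t)))
    (fill 13 7 (.sub (.lit 1) (.cell 7 (var 13)))) .skip) <|
  .query 12 (.lit 0) 7

/-- Adds the cheapest element, with respect to the real array `b`, that keeps the set `s`
independent (if there is one). -/
def greedyStep (b s : ℕ) : SProg :=
  .seq (.setNat 19 (.lit 0) (.lit 0)) <|
  .seq (.forLoop 15 0 <|
    .ite (.natLt (.lit 0) (.cell s (var 15))) .skip <|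
    .seq (fill 13 7 (.cell s (var 13))) <|
    .seq (.setNat 7 (var 15) (.lit 1)) <|
    .seq (.query 12 (.lit 0) 7) <|
    .ite (.natLt (var 12) (.lit 1)) .skip <|
    .ite (.natLt (var 19) (.lit 1))
      (.seq (.setNat 19 (.lit 0) (.lit 1)) (.setNat 20 (.lit 0) (var 15))) <|
    .ite (.realLe b (var 20) b (var 15)) .skip (.setNat 20 (.lit 0) (var 15))) <|
  .ite (.natLt (.lit 0) (var 19)) (.setNat s (var 20) (.lit 1)) .skip

/-- The greedy algorithm: a basis of minimum weight with respect to the real array `b`. -/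
def greedy (b s : ℕ) : SProg :=
  .seq (fill 13 s (.lit 0)) (.forLoop 16 0 (greedyStep b s))

/-- In round `r` (scalar `16`) of the breadth first search: if `u` has label `r + 1`, `v` is not yet
labelled, and the arc from `u` to `v` of type `t` is tight, then `v` gets the label `r + 2`. -/
def bfsArc (t : ℕ) : SProg :=
  .ite (.natLt (.lit 0) (.cell 9 (var 15))) .skip <|
  .ite (.natLt (.cell 9 (var 14)) (.add (var 16) (.lit 1))) .skip <|
  .ite (.natLt (.add (var 16) (.lit 1)) (.cell 9 (var 14))) .skip <|
  .seq (arc t) <|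
  .ite (.natLt (var 12) (.lit 1)) .skip <|
  .ite (.realLe 5 (.lit 0) 9 (.lit 0))
    (.seq (.setNat 9 (var 15) (.add (var 16) (.lit 2))) <|
      .seq (.setNat 10 (var 15) (var 14)) <|
      .setNat 11 (var 15) (.lit t))
    .skip

/-- Breadth first search: labels in array `9`, predecessors in `10`, types of arcs in `11`. -/
def bfs : SProg :=
  .seq (fill 13 9 (.sub (.sub (.lit 1) (.cell 3 (var 13))) (.cell 4 (var 13)))) <|
  .forLoop 16 0 <| .forLoop 14 0 <| .forLoop 15 0 <| .seq (bfsArc 0) (bfsArc 1)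

/-- Looks for a labelled element in both sets; found or not is recorded in the scalar `19`, the
element in the scalar `20`. -/
def findSink : SProg :=
  .seq (.setNat 19 (.lit 0) (.lit 0)) <|
  .forLoop 15 0 <|
    .ite (.natLt (.cell 9 (var 15)) (.lit 1)) .skip <|
    .ite (.natLt (.cell 3 (var 15)) (.lit 1)) .skip <|
    .ite (.natLt (.cell 4 (var 15)) (.lit 1)) .skip <|
    .seq (.setNat 19 (.lit 0) (.lit 1)) (.setNat 20 (.lit 0) (var 15))

/-- One backward step along the search path: exchanges the last arc. -/
def augmentStep : SProg :=
  .ite (.natLt (.cell 9 (var 20)) (.lit 2)) .skip <|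
  .seq (.ite (.natLt (.cell 11 (var 20)) (.lit 1))
    (.seq (.setNat 3 (var 20) (.lit 0)) (.setNat 3 (.cell 10 (var 20)) (.lit 1)))
    (.seq (.setNat 4 (var 20) (.lit 0)) (.setNat 4 (.cell 10 (var 20)) (.lit 1)))) <|
  .setNat 20 (.lit 0) (.cell 10 (var 20))

/-- Exchanges the arcs of the search path to the element in the scalar `20`. -/
def augment : SProg := .forLoop 16 0 augmentStep

/-- Updates the minimum slack by the arc from `u` to `v` of type `t`, if `u` is labelled and `v`
not. -/
def slackArc (t : ℕ) : SProg :=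
  .ite (.natLt (.cell 9 (var 14)) (.lit 1)) .skip <|
  .ite (.natLt (.lit 0) (.cell 9 (var 15))) .skip <|
  .seq (arc t) <|
  .ite (.natLt (var 12) (.lit 1)) .skip <|
  .ite (.natLt (var 19) (.lit 1))
    (.seq (.setNat 19 (.lit 0) (.lit 1)) (.copyReal 6 (.lit 0) 5 (.lit 0))) <|
  .ite (.realLe 5 (.lit 0) 6 (.lit 0)) (.copyReal 6 (.lit 0) 5 (.lit 0)) .skip

/-- The minimum slack, in the real scalar `6`, of the arcs that leave the set of labelled elements;
the scalar `19` tells whether there is such an arc. -/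
def minSlack : SProg :=
  .seq (.setNat 19 (.lit 0) (.lit 0)) <|
  .forLoop 14 0 <| .forLoop 15 0 <| .seq (slackArc 0) (slackArc 1)

/-- Raises the weights of the unlabelled elements by the minimum slack. -/
def raise : SProg :=
  .forLoop 15 0 <|
    .ite (.natLt (.lit 0) (.cell 9 (var 15))) .skip <|
    .seq (.addReal 3 (var 15) 3 (var 15) 6 (.lit 0)) (.addReal 4 (var 15) 4 (var 15) 6 (.lit 0))

/-- One step of the primal-dual method: augmentation if possible, otherwise a change of weights. -/
def improve : SProg :=
  .seq bfs <| .seq findSink <|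
  .ite (.natLt (.lit 0) (var 19)) augment <|
  .seq minSlack <| .ite (.natLt (.lit 0) (var 19)) raise .skip

/-- Computes in the real scalar `7` the objective value of the current pair `(X, Y)`, where `X` is
the array `3`, and `Y`, which is written to the array `23`, is the array `4` or its complement. -/
def evaluate : SProg :=
  .seq (.ite (.natLt (.lit 0) (.cell 8 (.lit 1)))
    (fill 13 23 (.sub (.lit 1) (.cell 4 (var 13)))) (fill 13 23 (.cell 4 (var 13)))) <|
  .seq (.setNat 22 (.lit 0) (.lit 0)) <|
  .seq (.copyReal 7 (.lit 0) 9 (.lit 0)) <|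
  .seq (.forLoop 15 0 <|
    .seq (.ite (.natLt (.lit 0) (.cell 3 (var 15)))
      (.addReal 7 (.lit 0) 7 (.lit 0) 0 (var 15)) .skip) <|
    .seq (.ite (.natLt (.lit 0) (.cell 23 (var 15)))
      (.addReal 7 (.lit 0) 7 (.lit 0) 1 (var 15)) .skip) <|
    .ite (.natLt (.lit 0) (.cell 3 (var 15)))
      (.ite (.natLt (.lit 0) (.cell 23 (var 15))) .skip
        (.setNat 22 (.lit 0) (.add (var 22) (.lit 1))))
      (.ite (.natLt (.lit 0) (.cell 23 (var 15)))
        (.setNat 22 (.lit 0) (.add (var 22) (.lit 1))) .skip)) <|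
  .addReal 7 (.lit 0) 7 (.lit 0) 2 (var 22)

/-- Records the current pair and its value as the best one. -/
def save : SProg :=
  .seq (fill 13 1 (.cell 3 (var 13))) <| .seq (fill 13 2 (.cell 23 (var 13))) <|
  .copyReal 8 (.lit 0) 7 (.lit 0)

/-- Starts with the two greedy bases. For `f = 0` the second set is the basis `Y` itself with the
cost `c₂`, for `f = 1` its complement with the cost `-c₂`. -/
def setup (f : ℕ) : SProg :=
  .seq (.setNat 8 (.lit 1) (.lit f)) <|
  .seq (fill 13 3 (.cell 5 (var 13))) <|
  .seq (fill 13 4 (if f = 0 then .cell 6 (var 13) else .sub (.lit 1) (.cell 6 (var 13)))) <|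
  .forLoop 15 0 <|
    .seq (.copyReal 3 (var 15) 0 (var 15)) <|
    if f = 0 then .copyReal 4 (var 15) 1 (var 15) else .subReal 4 (var 15) 9 (.lit 0) 1 (var 15)

/-- Follows the primal-dual method and keeps the best pair seen. -/
def search : SProg :=
  .forLoop 17 1 <| .forLoop 18 1 <|
    .seq evaluate <| .seq (.ite (.realLe 8 (.lit 0) 7 (.lit 0)) .skip save) improve

/-- The complete algorithm. -/
def main : SProg :=
  .seq (greedy 0 5) <| .seq (greedy 1 6) <|
  .seq (setup 0) <| .seq evaluate <| .seq save <| .seq search <|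
  .seq (setup 1) search

lemma main_wellFormed : main.WellFormed ∧ 0 ∉ main.natWrites := by
  refine ⟨?_, by decide⟩
  simp [main, search, setup, save, evaluate, improve, raise, minSlack, slackArc, augment, augmentStep,
    findSink, bfs, bfsArc, greedy, greedyStep, arc, fill, WellFormed, natWrites]

end SProg

/-! ### Correctness of the subroutines -/

open MatroidPair

lemma Memory.mem_toFinset {n : ℕ} {m : Memory} {a : ℕ} {e : Fin n} :
    e ∈ m.toFinset n a ↔ m.nat a e ≠ 0 := by
  simp [Memory.toFinset]

lemma Memory.toFinset_congr {n : ℕ} {m m' : Memory} {a a' : ℕ}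
    (h : ∀ i < n, m.nat a i = m'.nat a' i) : m.toFinset n a = m'.toFinset n a' := by
  ext e
  rw [Memory.mem_toFinset, Memory.mem_toFinset, h e e.2]

namespace SProg

section Fill

variable {n : ℕ} (Ind : Finset (Fin n) → Prop)

lemma exec_seq (P Q : SProg) (m : Memory) :
    (seq P Q).exec Ind m = Q.exec Ind (P.exec Ind m) := rfl

lemma exec_ite_pos {c : Test} {P Q : SProg} {m : Memory} (h : c.Holds m) :
    (ite c P Q).exec Ind m = P.exec Ind m := by rw [exec, if_pos h]

lemma exec_ite_neg {c : Test} {P Q : SProg} {m : Memory} (h : ¬ c.Holds m) :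
    (ite c P Q).exec Ind m = Q.exec Ind m := by rw [exec, if_neg h]

@[simp] lemma eval_var (m : Memory) (a : ℕ) : (var a).eval m = m.nat a 0 := rfl

lemma exec_fill {c b : ℕ} {e : NatExpr} {g : ℕ → ℕ} {m₀ : Memory} (hbc : b ≠ c)
    (he : ∀ j < n, ∀ m, (∀ a, a ≠ c → a ≠ b → m.nat a = m₀.nat a) → m.nat c 0 = j →
      m.nat b j = m₀.nat b j → e.eval m = g j) (i : ℕ) :
    ((fill c b e).exec Ind m₀).nat b i = if i < n then g i else m₀.nat b i := by
  refine exec_for Ind (k := 0)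
    (fun j m => ∀ i, m.nat b i = if i < j then g i else m₀.nat b i) ?_ ?_ i
  · intro i
    simp [Memory.writeNat_nat_of_ne _ _ _ hbc]
  · intro j hj m h1 _ h3 h4 i
    rw [Memory.writeNat_nat_of_ne _ _ _ hbc, exec, Memory.writeNat_nat, eval_var, h3,
      he j hj m (fun a ha hb => h1 a (by simp [natWrites, ha, hb])) h3 (by simp [h4]), h4]
    simp only [true_and]
    split_ifs <;> first | omega | simp_all

end Fill

end SProg
end OracleRAM

namespace OracleRAM
open MatroidPair
namespace SProg

/-! ### Exchange arcs in memory -/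

section Arc

variable {n : ℕ}

/-- The independence oracle of `M`. -/
def oracle (M : Matroid (Fin n)) (S : Finset (Fin n)) : Prop := M.Indep (S : Set (Fin n))

/-- The matroid whose bases are the possible values of the set of type `t`. -/
def matroidOf (M : Matroid (Fin n)) (m : Memory) (t : Fin 2) : Matroid (Fin n) :=
  if m.nat 8 t = 0 then M else M✶

/-- The current pair of sets, kept in the arrays `3` and `4`. -/
def setOf (n : ℕ) (m : Memory) (t : Fin 2) : Finset (Fin n) := m.toFinset n (3 + t)

/-- The current shifted weights, kept in the arrays `3` and `4`. -/
def weightOf (n : ℕ) (m : Memory) (t : Fin 2) (e : Fin n) : ℝ := m.real (3 + t) e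

variable {M : Matroid (Fin n)}

lemma isBase_exchange_iff {W : Finset (Fin n)} (hW : M.IsBase (W : Set (Fin n))) {u v : Fin n}
    (hu : u ∉ W) : M.IsBase (insert u (W.erase v) : Finset (Fin n)) ↔
      oracle M (insert u (W.erase v)) := by
  refine ⟨fun h => h.indep, fun h => ?_⟩
  have := hW.exchange_isBase_of_indep (e := v) (f := u) (by simpa using hu) (by
    simpa [oracle] using h)
  simpa using this

lemma isBase_dual_exchange_iff (hE : M.E = Set.univ) {W : Finset (Fin n)}
    (hW : M✶.IsBase (W : Set (Fin n))) {u v : Fin n} (hu : u ∉ W) (hv : v ∈ W) :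
    M✶.IsBase (insert u (W.erase v) : Finset (Fin n)) ↔ oracle M (insert u (W.erase v))ᶜ := by
  have hdual : ∀ S : Finset (Fin n), M✶.IsBase (S : Set (Fin n)) ↔
      M.IsBase ((Sᶜ : Finset (Fin n)) : Set (Fin n)) := by
    intro S
    rw [Matroid.dual_isBase_iff (by simp [hE]), hE, Finset.coe_compl, Set.compl_eq_univ_sdiff]
  have hne : v ≠ u := by rintro rfl; exact hu hv
  have : (insert u (W.erase v))ᶜ = insert v (Wᶜ.erase u) := by
    ext e
    simp only [Finset.mem_compl, Finset.mem_insert, Finset.mem_erase]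
    grind
  rw [hdual, this]
  exact isBase_exchange_iff ((hdual W).1 hW) (by simpa using hv)

lemma arc_spec (hE : M.E = Set.univ) {m : Memory} {t : Fin 2} {u v : Fin n}
    (hu : m.nat 14 0 = u) (hv : m.nat 15 0 = v)
    (hW : (matroidOf M m t).IsBase (setOf n m t : Set (Fin n))) :
    (((arc t).exec (oracle M) m).nat 12 0 ≠ 0 ↔ Exch (matroidOf M m t) (setOf n m t) u v) ∧
    ((arc t).exec (oracle M) m).real 5 0 = weightOf n m t u - weightOf n m t v := by
  have ht : (t : ℕ) < 2 := t.2
  set m₂ := (m.writeNat 12 0 0).writeReal 5 0 (m.real (3 + t) u - m.real (3 + t) v) with hm₂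
  have hn : ∀ a, a ≠ 12 → m₂.nat a = m.nat a := fun a ha => by
    rw [hm₂, Memory.writeReal_nat, Memory.writeNat_nat_of_ne _ _ _ ha]
  have h12 : m₂.nat 12 0 = 0 := by simp [hm₂]
  have h5 : m₂.real 5 0 = weightOf n m t u - weightOf n m t v := by simp [hm₂, weightOf]
  have hstart : ∀ P : SProg, (SProg.seq (.setNat 12 (.lit 0) (.lit 0)) (.seq
      (.subReal 5 (.lit 0) (3 + t) (var 14) (3 + t) (var 15)) P)).exec (oracle M) m =
      P.exec (oracle M) m₂ := by
    intro P
    simp only [exec, NatExpr.eval, eval_var, hm₂, Memory.writeNat_real]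
    rw [Memory.writeNat_nat_of_ne _ _ _ (by decide), Memory.writeNat_nat_of_ne _ _ _ (by decide),
      hu, hv]
  rw [arc, hstart]
  have h3 : m₂.nat (3 + t) = m.nat (3 + t) := hn _ (by omega)
  have hu₂ : m₂.nat 14 0 = u := by rw [hn _ (by decide), hu]
  have hv₂ : m₂.nat 15 0 = v := by rw [hn _ (by decide), hv]
  refine ⟨?_, ?_⟩
  swap
  · rw [exec_real, h5]
    simp [fill, realWrites]
  by_cases huW : u ∈ setOf n m t
  · have : 0 < m.nat (3 + t) u := by
      rw [setOf, Memory.mem_toFinset] at huW; omega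
    rw [exec_ite_pos _ (by simpa [Test.Holds, NatExpr.eval, h3, hu₂] using this)]
    simp [exec, h12, Exch, huW]
  have huW' : m.nat (3 + t) u = 0 := by
    rw [setOf, Memory.mem_toFinset] at huW; omega
  rw [exec_ite_neg _ (by simp [Test.Holds, NatExpr.eval, h3, hu₂, huW'])]
  by_cases hvW : v ∈ setOf n m t
  swap
  · have : m.nat (3 + t) v = 0 := by
      rw [setOf, Memory.mem_toFinset] at hvW; omega
    rw [exec_ite_pos _ (by simp [Test.Holds, NatExpr.eval, h3, hv₂, this])]
    simp [exec, h12, Exch, hvW]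
  have hvW' : m.nat (3 + t) v ≠ 0 := by
    rwa [setOf, Memory.mem_toFinset] at hvW
  rw [exec_ite_neg _ (by simpa [Test.Holds, NatExpr.eval, h3, hv₂, Nat.pos_iff_ne_zero] using hvW')]
  rw [exec_seq, exec_seq, exec_seq, exec_seq]
  set m₃ := (fill 13 7 (.cell (3 + t) (var 13))).exec (oracle M) m₂ with hm₃
  have h37 : ∀ i < n, m₃.nat 7 i = m.nat (3 + t) i := by
    intro i hi
    rw [hm₃, exec_fill _ (g := fun i => m.nat (3 + t) i) (by decide), if_pos hi]
    intro j hj m' h1 h2 h4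
    simp [NatExpr.eval, h1 (3 + t) (by omega) (by omega), h2, h3]
  have hn₃ : ∀ a, a ≠ 7 → a ≠ 13 → m₃.nat a = m₂.nat a := fun a h h' => by
    rw [hm₃, exec_nat]
    simp [fill, natWrites, h, h']
  set m₅ := (SProg.setNat 7 (var 14) (.lit 1)).exec (oracle M)
    ((SProg.setNat 7 (var 15) (.lit 0)).exec (oracle M) m₃) with hm₅
  have hn₅ : ∀ a, a ≠ 7 → m₅.nat a = m₃.nat a := fun a h => by
    rw [hm₅, exec_nat _ (by simp [natWrites, h]), exec_nat _ (by simp [natWrites, h])]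
  have h57 : ∀ i : Fin n, m₅.nat 7 i ≠ 0 ↔ i ∈ insert u ((setOf n m t).erase v) := by
    intro i
    have e1 : m₃.nat 14 0 = u := by rw [hn₃ _ (by decide) (by decide), hu₂]
    have e2 : m₃.nat 15 0 = v := by rw [hn₃ _ (by decide) (by decide), hv₂]
    have e3 : (m₃.writeNat 7 v 0).nat 14 0 = u := by
      rw [Memory.writeNat_nat_of_ne _ _ _ (by decide), e1]
    simp only [hm₅, exec, eval_var, NatExpr.eval, e2, e3]
    rw [Memory.writeNat_nat, Memory.writeNat_nat, h37 i i.2]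
    simp only [true_and, Finset.mem_insert, Finset.mem_erase, setOf, Memory.mem_toFinset,
      ← Fin.ext_iff]
    split_ifs <;> simp_all
  have h58 : m₅.nat 8 t = m.nat 8 t := by
    rw [hn₅ _ (by decide), hn₃ _ (by decide) (by decide), hn _ (by decide)]
  by_cases hf : m.nat 8 t = 0
  · rw [exec_ite_neg _ (by simp [Test.Holds, NatExpr.eval, h58, hf]), exec, exec]
    simp only [NatExpr.eval, Memory.writeNat_nat_self]
    have hS : m₅.toFinset n 7 = insert u ((setOf n m t).erase v) := by
      ext i; rw [Memory.mem_toFinset, h57]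
    rw [matroidOf, if_pos hf] at hW ⊢
    rw [hS, ← isBase_exchange_iff hW huW, Exch]
    simp [huW, hvW]
  · rw [exec_ite_pos _ (by simpa [Test.Holds, NatExpr.eval, h58, Nat.pos_iff_ne_zero] using hf),
      exec]
    simp only [NatExpr.eval, Memory.writeNat_nat_self]
    have hS : ((fill 13 7 (.sub (.lit 1) (.cell 7 (var 13)))).exec (oracle M) m₅).toFinset n 7 =
        (insert u ((setOf n m t).erase v))ᶜ := by
      ext i
      rw [Memory.mem_toFinset, Finset.mem_compl, ← h57,
        exec_fill _ (g := fun i => 1 - m₅.nat 7 i) (by decide), if_pos i.2]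
      · omega
      · intro j hj m' h1 h2 h4
        simp [NatExpr.eval, h2, h4]
    rw [matroidOf, if_neg hf] at hW ⊢
    rw [hS, ← isBase_dual_exchange_iff hE hW huW hvW, Exch]
    simp [huW, hvW]

end Arc

end SProg
end OracleRAM

namespace OracleRAM
open MatroidPair
namespace SProg

/-! ### The greedy algorithm -/

section Greedy

variable {n : ℕ} {M : Matroid (Fin n)}

lemma greedyStep_spec {b s : ℕ} (hs : s < 7) (m : Memory) :
    ((∀ v ∉ m.toFinset n s, ¬ oracle M (insert v (m.toFinset n s))) ∧
      ((greedyStep b s).exec (oracle M) m).toFinset n s = m.toFinset n s) ∨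
    ∃ e ∉ m.toFinset n s, oracle M (insert e (m.toFinset n s)) ∧
      (∀ v ∉ m.toFinset n s, oracle M (insert v (m.toFinset n s)) → m.real b e ≤ m.real b v) ∧
      ((greedyStep b s).exec (oracle M) m).toFinset n s = insert e (m.toFinset n s) := by
  set S := m.toFinset n s with hS
  rw [greedyStep, exec_seq, exec_seq]
  set m₁ := (SProg.setNat 19 (.lit 0) (.lit 0)).exec (oracle M) m with hm₁
  have hs₁ : m₁.nat s = m.nat s := exec_nat _ (by simp [natWrites]; omega) _
  set body : SProg := _
  set m₂ := (SProg.forLoop 15 0 body).exec (oracle M) m₁ with hm₂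
  have hs₂ : m₂.nat s = m.nat s := by
    rw [hm₂, exec_nat _ (by simp [fill, natWrites, body]; omega), hs₁]
  have hinv : (m₂.nat 19 0 = 0 ∧ ∀ v : Fin n, (v : ℕ) < n + 0 → v ∉ S → ¬ oracle M (insert v S)) ∨
      (m₂.nat 19 0 ≠ 0 ∧ ∃ e : Fin n, m₂.nat 20 0 = e ∧ e ∉ S ∧ oracle M (insert e S) ∧
        ∀ v : Fin n, (v : ℕ) < n + 0 → v ∉ S → oracle M (insert v S) → m.real b e ≤ m.real b v) := by
    refine exec_for (oracle M) (P := body) (c := 15) (k := 0) (m₀ := m₁)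
      (fun j m₂ => (m₂.nat 19 0 = 0 ∧ ∀ v : Fin n, (v : ℕ) < j → v ∉ S → ¬ oracle M (insert v S)) ∨
      (m₂.nat 19 0 ≠ 0 ∧ ∃ e : Fin n, m₂.nat 20 0 = e ∧ e ∉ S ∧ oracle M (insert e S) ∧
        ∀ v : Fin n, (v : ℕ) < j → v ∉ S → oracle M (insert v S) → m.real b e ≤ m.real b v)) ?_ ?_
    · left
      rw [Memory.writeNat_nat_of_ne _ _ _ (by decide)]
      simp [hm₁, exec, NatExpr.eval]
    · intro j hj m' h1 h2 h3 h4
      rw [Memory.writeNat_nat_of_ne _ _ _ (by decide), Memory.writeNat_nat_of_ne _ _ _ (by decide)]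
      have hs' : m'.nat s = m.nat s := by
        rw [h1 s (by simp [fill, natWrites, body]; omega), hs₁]
      have hreal : m'.real b = m.real b := by
        rw [h2 b (by simp [fill, realWrites, body])]; rfl
      set v : Fin n := ⟨j, by omega⟩ with hv
      have hlt : ∀ x : Fin n, (x : ℕ) < j + 1 ↔ (x : ℕ) < j ∨ x = v := by
        intro x; rw [Fin.ext_iff]; exact Nat.lt_succ_iff_lt_or_eq
      simp only [hlt]
      by_cases hvS : v ∈ S
      · have : m.nat s j ≠ 0 := by
          simpa [hS, Memory.mem_toFinset] using hvS
        rw [exec_ite_pos _ (by simpa [Test.Holds, NatExpr.eval, h3, hs', Nat.pos_iff_ne_zero] using this),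
          exec]
        rcases h4 with ⟨h5, h6⟩ | ⟨h5, e, h6, h7, h8, h9⟩
        · refine Or.inl ⟨h5, ?_⟩
          rintro x (hx | rfl) hxS
          · exact h6 x hx hxS
          · exact absurd hvS hxS
        · refine Or.inr ⟨h5, e, h6, h7, h8, ?_⟩
          rintro x (hx | rfl) hxS
          · exact h9 x hx hxS
          · exact absurd hvS hxS
      have hvS' : m.nat s j = 0 := by
        simpa [hS, Memory.mem_toFinset] using hvS
      rw [exec_ite_neg _ (by simp [Test.Holds, NatExpr.eval, h3, hs', hvS']), exec_seq, exec_seq,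
        exec_seq]
      set m₃ := (fill 13 7 (.cell s (var 13))).exec (oracle M) m' with hm₃
      have h37 : ∀ i < n, m₃.nat 7 i = m.nat s i := by
        intro i hi
        rw [hm₃, exec_fill _ (g := fun i => m.nat s i) (by decide), if_pos hi]
        intro j hj m' h1 h2 h4
        simp [NatExpr.eval, h1 s (by omega) (by omega), h2, hs']
      set m₄ := (SProg.setNat 7 (var 15) (.lit 1)).exec (oracle M) m₃ with hm₄
      have h4S : m₄.toFinset n 7 = insert v S := by
        ext i
        have e1 : m₃.nat 15 0 = j := by
          rw [hm₃, exec_nat _ (by simp [fill, natWrites]), h3]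
        rw [Memory.mem_toFinset, hm₄, exec, Memory.writeNat_nat, eval_var, e1, h37 i i.2,
          Finset.mem_insert, hS, Memory.mem_toFinset, Fin.ext_iff]
        simp only [NatExpr.eval, true_and, hv]
        split_ifs <;> simp_all
      set m₅ := (SProg.query 12 (.lit 0) 7).exec (oracle M) m₄ with hm₅
      have h512 : m₅.nat 12 0 = 0 ↔ ¬ oracle M (insert v S) := by
        rw [hm₅, exec, h4S, NatExpr.eval, Memory.writeNat_nat_self]
        split_ifs <;> simp_all
      have hn₅ : ∀ a, a ≠ 7 → a ≠ 12 → a ≠ 13 → m₅.nat a = m'.nat a := by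
        intro a h h' h''
        rw [hm₅, exec_nat _ (by simp [natWrites, h']), hm₄, exec_nat _ (by simp [natWrites, h]),
          hm₃, exec_nat _ (by simp [fill, natWrites, h, h''])]
      have hr₅ : m₅.real b = m.real b := by
        rw [hm₅, exec_real _ (by simp [realWrites]), hm₄, exec_real _ (by simp [realWrites]),
          hm₃, exec_real _ (by simp [fill, realWrites]), hreal]
      have h519 := hn₅ 19 (by decide) (by decide) (by decide)
      have h520 := hn₅ 20 (by decide) (by decide) (by decide)
      have h515 : m₅.nat 15 0 = j := by rw [hn₅ 15 (by decide) (by decide) (by decide), h3]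
      by_cases hind : oracle M (insert v S)
      swap
      · rw [exec_ite_pos _ (by simpa [Test.Holds, NatExpr.eval, h512] using hind), exec, h519, h520]
        rcases h4 with ⟨h5, h6⟩ | ⟨h5, e, h6, h7, h8, h9⟩
        · refine Or.inl ⟨h5, ?_⟩
          rintro x (hx | rfl) hxS
          · exact h6 x hx hxS
          · exact hind
        · refine Or.inr ⟨h5, e, h6, h7, h8, ?_⟩
          rintro x (hx | rfl) hxS hx'
          · exact h9 x hx hxS hx'
          · exact absurd hx' hind
      rw [exec_ite_neg _ (by simpa [Test.Holds, NatExpr.eval, h512] using hind)]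
      rcases h4 with ⟨h5, h6⟩ | ⟨h5, e, h6, h7, h8, h9⟩
      · rw [exec_ite_pos _ (by simp [Test.Holds, NatExpr.eval, h519, h5])]
        refine Or.inr ⟨by simp [exec, NatExpr.eval, Memory.writeNat_nat], v, ?_, hvS, hind, ?_⟩
        · simp [exec, NatExpr.eval, Memory.writeNat_nat, h515, hv]
        · rintro x (hx | rfl) hxS hx'
          · exact absurd hx' (h6 x hx hxS)
          · exact le_rfl
      · rw [exec_ite_neg _ (by simp [Test.Holds, NatExpr.eval, h519, h5])]
        right
        by_cases hle : m.real b e ≤ m.real b v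
        · rw [exec_ite_pos _ (by simpa [Test.Holds, NatExpr.eval, h520, hr₅, h6, h515] using hle),
            exec, h519, h520]
          refine ⟨h5, e, h6, h7, h8, ?_⟩
          rintro x (hx | rfl) hxS hx'
          · exact h9 x hx hxS hx'
          · exact hle
        · rw [exec_ite_neg _ (by simpa [Test.Holds, NatExpr.eval, h520, hr₅, h6, h515] using hle)]
          refine ⟨by simp [exec, NatExpr.eval, Memory.writeNat_nat, h519, h5], v, ?_, hvS, hind, ?_⟩
          · simp [exec, NatExpr.eval, h515, hv]
          · rintro x (hx | rfl) hxS hx'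
            · exact (not_le.1 hle).le.trans (h9 x hx hxS hx')
            · exact le_rfl
  rcases hinv with ⟨h1, h2⟩ | ⟨h1, e, h2, h3, h4, h5⟩
  · refine Or.inl ⟨fun v => h2 v (by omega), ?_⟩
    rw [exec_ite_neg _ (by simp [Test.Holds, NatExpr.eval, h1]), exec, hS]
    exact Memory.toFinset_congr fun i _ => by rw [hs₂]
  · refine Or.inr ⟨e, h3, h4, fun v => h5 v (by omega), ?_⟩
    rw [exec_ite_pos _ (by simpa [Test.Holds, NatExpr.eval, Nat.pos_iff_ne_zero] using h1), exec]
    ext i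
    rw [Memory.mem_toFinset, Memory.writeNat_nat, eval_var, h2, hs₂, Finset.mem_insert, hS,
      Memory.mem_toFinset, Fin.ext_iff]
    simp only [NatExpr.eval, true_and]
    split_ifs <;> simp_all

/-- The greedy invariant: among independent exchanges, no single one improves the set. It is
preserved because the element added is the cheapest one, and is itself replaceable only by costlier
ones. -/
lemma greedy_spec {b s : ℕ} (hs : s < 7) (m : Memory) :
    IsMinBase M (fun e => m.real b e) (((greedy b s).exec (oracle M) m).toFinset n s) := by
  rw [greedy, exec_seq]
  set m₁ := (fill 13 s (.lit 0)).exec (oracle M) m with hm₁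
  have h1 : m₁.toFinset n s = ∅ := by
    ext i
    rw [Memory.mem_toFinset, hm₁, exec_fill _ (g := fun _ => 0) (by omega), if_pos i.2]
    · simp
    · intros; rfl
  let Inv : ℕ → Memory → Prop := fun j m₂ => oracle M (m₂.toFinset n s) ∧
      (∀ u v, u ∉ m₂.toFinset n s → v ∈ m₂.toFinset n s →
        oracle M (insert u ((m₂.toFinset n s).erase v)) → m.real b v ≤ m.real b u) ∧
      (j ≤ (m₂.toFinset n s).card ∨ ∀ v ∉ m₂.toFinset n s, ¬ oracle M (insert v (m₂.toFinset n s)))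
  have hinv : Inv (n + 0) ((SProg.forLoop 16 0 (greedyStep b s)).exec (oracle M) m₁) := by
    refine exec_for (oracle M) Inv ?_ ?_
    · have : (m₁.writeNat 16 0 0).toFinset n s = ∅ := by
        rw [← h1]
        exact Memory.toFinset_congr fun i _ => by rw [Memory.writeNat_nat_of_ne _ _ _ (by omega)]
      simp [Inv, this, oracle]
    · intro j hj m' _ h2 h3 ⟨h4, h5, h6⟩
      have hS : ∀ m'' : Memory, (m''.writeNat 16 0 (j + 1)).toFinset n s = m''.toFinset n s :=
        fun m'' => Memory.toFinset_congr fun i _ => by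
          rw [Memory.writeNat_nat_of_ne _ _ _ (by omega)]
      have hr : m'.real b = m.real b := by
        rw [h2 b (by simp [greedyStep, fill, realWrites]), hm₁, exec_real _ (by simp [fill, realWrites])]
      dsimp only [Inv]
      rw [hS]
      rcases greedyStep_spec (M := M) (b := b) hs m' with ⟨h7, h8⟩ | ⟨e, h7, h8, h9, h10⟩
      · rw [h8]
        exact ⟨h4, h5, Or.inr h7⟩
      · rw [h10]
        set S := m'.toFinset n s
        rw [hr] at h9
        refine ⟨h8, fun u v hu hv huv => ?_, ?_⟩
        · rw [Finset.mem_insert, not_or] at hu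
          by_cases hve : v = e
          · subst hve
            rw [Finset.erase_insert h7] at huv
            exact h9 u hu.2 huv
          · refine h5 u v hu.2 (Finset.mem_of_mem_insert_of_ne hv hve) (huv.subset ?_)
            rw [Finset.coe_subset]
            exact Finset.insert_subset_insert _ (Finset.erase_subset_erase _ (Finset.subset_insert _ _))
        · rw [Finset.card_insert_of_notMem h7]
          rcases h6 with h6 | h6
          · left; omega
          · exact absurd h8 (h6 e h7)
  obtain ⟨h4, h5, h6⟩ := hinv
  set S := ((SProg.forLoop 16 0 (greedyStep b s)).exec (oracle M) m₁).toFinset n s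
  have hmax : ∀ v ∉ S, ¬ oracle M (insert v S) := by
    rcases h6 with h6 | h6
    · intro v hv
      have : S.card < Fintype.card (Fin n) := Finset.card_lt_univ_of_notMem hv
      rw [Fintype.card_fin] at this
      omega
    · exact h6
  refine isMinBase_of_exch ?_ fun u v huv => h5 u v huv.1 huv.2.1 huv.2.2.indep
  obtain ⟨B, hB, hSB⟩ := h4.exists_isBase_superset
  have : (S : Set (Fin n)) = B := by
    refine hSB.antisymm fun v hv => ?_
    by_contra hvS
    refine hmax v (by simpa using hvS) (hB.indep.subset ?_)
    rw [Finset.coe_insert]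
    exact Set.insert_subset hv hSB
  rwa [this]

end Greedy

end SProg
end OracleRAM

namespace OracleRAM
open MatroidPair
namespace SProg

/-! ### Breadth first search -/

section BFS

variable {n : ℕ} {M : Matroid (Fin n)}

lemma mem_setOf_zero {m : Memory} {v : Fin n} : v ∈ setOf n m 0 ↔ m.nat 3 v ≠ 0 :=
  Memory.mem_toFinset

lemma mem_setOf_one {m : Memory} {v : Fin n} : v ∈ setOf n m 1 ↔ m.nat 4 v ≠ 0 :=
  Memory.mem_toFinset

/-- The two memories describe the same pair of sets, weights and matroids. -/
structure SameState (m m₀ : Memory) : Prop where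
  nat3 : m.nat 3 = m₀.nat 3
  nat4 : m.nat 4 = m₀.nat 4
  nat8 : m.nat 8 = m₀.nat 8
  real3 : m.real 3 = m₀.real 3
  real4 : m.real 4 = m₀.real 4
  real9 : m.real 9 = m₀.real 9

lemma SameState.trans {m m' m'' : Memory} (h : SameState m m') (h' : SameState m' m'') :
    SameState m m'' :=
  ⟨h.1.trans h'.1, h.2.trans h'.2, h.3.trans h'.3, h.4.trans h'.4, h.5.trans h'.5, h.6.trans h'.6⟩

lemma SameState.setOf_eq {m m₀ : Memory} (h : SameState m m₀) : setOf n m = setOf n m₀ := by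
  funext t
  refine Memory.toFinset_congr fun i _ => ?_
  fin_cases t
  · simp [h.nat3]
  · simp [h.nat4]

lemma SameState.weightOf_eq {m m₀ : Memory} (h : SameState m m₀) : weightOf n m = weightOf n m₀ := by
  funext t e
  fin_cases t
  · simp [weightOf, h.real3]
  · simp [weightOf, h.real4]

lemma SameState.matroidOf_eq {m m₀ : Memory} (h : SameState m m₀) :
    matroidOf M m = matroidOf M m₀ := by
  funext t
  rw [matroidOf, matroidOf, h.nat8]

lemma sameState_exec {P : SProg} (h3 : 3 ∉ P.natWrites) (h4 : 4 ∉ P.natWrites) (h8 : 8 ∉ P.natWrites)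
    (h3' : 3 ∉ P.realWrites) (h4' : 4 ∉ P.realWrites) (h9 : 9 ∉ P.realWrites) (m : Memory) :
    SameState (P.exec (oracle M) m) m :=
  ⟨exec_nat _ h3 _, exec_nat _ h4 _, exec_nat _ h8 _, exec_real _ h3' _, exec_real _ h4' _,
    exec_real _ h9 _⟩

lemma sameState_of_frame {P : SProg} {c : ℕ} {m m₀ : Memory}
    (h1 : ∀ a ∉ c :: P.natWrites, m.nat a = m₀.nat a) (h2 : ∀ b ∉ P.realWrites, m.real b = m₀.real b)
    (h3 : 3 ∉ c :: P.natWrites) (h4 : 4 ∉ c :: P.natWrites) (h8 : 8 ∉ c :: P.natWrites)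
    (h3' : 3 ∉ P.realWrites) (h4' : 4 ∉ P.realWrites) (h9 : 9 ∉ P.realWrites) : SameState m m₀ :=
  ⟨h1 _ h3, h1 _ h4, h1 _ h8, h2 _ h3', h2 _ h4', h2 _ h9⟩

lemma arc_natWrites (t : ℕ) : (arc t).natWrites = [12, 13, 7, 7, 7, 13, 7, 12] := rfl

lemma arc_realWrites (t : ℕ) : (arc t).realWrites = [5] := rfl

/-- `arc_spec` relative to an earlier memory. -/
lemma arc_spec' (hE : M.E = Set.univ) {m m₀ : Memory} (hm : SameState m m₀) {t : Fin 2} {u v : Fin n}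
    (hu : m.nat 14 0 = u) (hv : m.nat 15 0 = v)
    (hW : ∀ t, (matroidOf M m₀ t).IsBase (setOf n m₀ t : Set (Fin n))) :
    (((arc t).exec (oracle M) m).nat 12 0 ≠ 0 ↔ Exch (matroidOf M m₀ t) (setOf n m₀ t) u v) ∧
    ((arc t).exec (oracle M) m).real 5 0 = weightOf n m₀ t u - weightOf n m₀ t v := by
  rw [← hm.setOf_eq, ← hm.weightOf_eq, ← hm.matroidOf_eq] at *
  exact arc_spec hE hu hv (hW t)

/-- The loop invariant of round `r` of the search: `L`, `p`, `y` hold the labels, predecessors and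
types of arcs, and `Done t u v` says that the arc from `u` to `v` has been treated in this round. -/
structure BFSInv (N : Fin 2 → Matroid (Fin n)) (w : Fin 2 → Fin n → ℝ) (W : Fin 2 → Finset (Fin n))
    (r : ℕ) (Done : Fin 2 → Fin n → Fin n → Prop) (L p y : ℕ → ℕ) : Prop where
  source : ∀ v : Fin n, L v = 1 ↔ ∀ t, v ∉ W t
  parent : ∀ v : Fin n, 2 ≤ L v → ∃ (u : Fin n) (t : Fin 2), p v = u ∧ y v = t ∧ L u + 1 = L v ∧
    Tight N w W t u v
  le : ∀ v : Fin n, L v ≤ r + 2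
  closed : ∀ (t : Fin 2) (u v : Fin n), L u ≠ 0 → Tight N w W t u v →
    (L u ≤ r ∨ L u = r + 1 ∧ Done t u v) → L v ≠ 0 ∧ L v ≤ L u + 1

variable {N : Fin 2 → Matroid (Fin n)} {w : Fin 2 → Fin n → ℝ} {W : Fin 2 → Finset (Fin n)}
  {r : ℕ} {Done Done' : Fin 2 → Fin n → Fin n → Prop} {L p y L' p' y' : ℕ → ℕ}

lemma BFSInv.weaken (h : BFSInv N w W r Done L p y) (hD : ∀ t u v, Done' t u v → Done t u v) :
    BFSInv N w W r Done' L p y :=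
  ⟨h.source, h.parent, h.le, fun t u v h1 h2 h3 => h.closed t u v h1 h2
    (h3.imp_right fun h4 => ⟨h4.1, hD _ _ _ h4.2⟩)⟩

/-- The invariant is preserved when one arc is treated. -/
lemma BFSInv.step (h : BFSInv N w W r Done L p y) {t : Fin 2} {u v : Fin n}
    (hstep : (L v = 0 ∧ L u = r + 1 ∧ Tight N w W t u v ∧
        (∀ i, L' i = if i = v then r + 2 else L i) ∧ (∀ i, p' i = if i = v then (u : ℕ) else p i) ∧
        (∀ i, y' i = if i = v then (t : ℕ) else y i)) ∨
      (¬ (L v = 0 ∧ L u = r + 1 ∧ Tight N w W t u v) ∧ L' = L ∧ p' = p ∧ y' = y))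
    (hD : ∀ t' u' v', Done' t' u' v' → Done t' u' v' ∨ t' = t ∧ u' = u ∧ v' = v) :
    BFSInv N w W r Done' L' p' y' := by
  rcases hstep with ⟨hv, hu, hT, hL, hp, hy⟩ | ⟨hno, rfl, rfl, rfl⟩
  · have hne : ∀ x : Fin n, L x ≠ 0 → (x : ℕ) ≠ v := by
      intro x hx hxv; rw [hxv] at hx; exact hx hv
    have hL' : ∀ x : Fin n, L x ≠ 0 → L' x = L x := fun x hx => by rw [hL, if_neg (hne x hx)]
    have hLv : L' v = r + 2 := by rw [hL, if_pos rfl]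
    refine ⟨fun x => ?_, fun x hx => ?_, fun x => ?_, fun t' a b ha hT' hD' => ?_⟩
    · rw [← h.source x, hL]
      split_ifs with hxv
      · rw [hxv]; omega
      · rfl
    · by_cases hxv : (x : ℕ) = v
      · have hxv' : x = v := Fin.ext hxv
        refine ⟨u, t, by rw [hp, if_pos hxv], by rw [hy, if_pos hxv], ?_, hxv' ▸ hT⟩
        rw [hL' u (by omega), hxv, hLv, hu]
      · rw [hL, if_neg hxv] at hx
        obtain ⟨a, t', h1, h2, h3, h4⟩ := h.parent x hx
        refine ⟨a, t', by rw [hp, if_neg hxv, h1], by rw [hy, if_neg hxv, h2], ?_, h4⟩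
        rw [hL' a (by omega), hL' x (by omega), h3]
    · rw [hL]
      split_ifs
      · exact le_rfl
      · exact h.le x
    · by_cases hav : (a : ℕ) = v
      · rw [hav, hLv] at hD'; omega
      rw [hL a, if_neg hav] at ha hD' ⊢
      by_cases hb : (b : ℕ) = v
      · rw [hb, hLv]
        refine ⟨by omega, ?_⟩
        rcases hD' with h1 | ⟨h1, _⟩
        · have := (h.closed t' a b ha hT' (Or.inl h1)).1
          rw [hb] at this
          exact absurd hv this
        · omega
      · rw [hL, if_neg hb]
        refine h.closed t' a b ha hT' (hD'.imp_right fun h1 => ⟨h1.1, ?_⟩)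
        rcases hD _ _ _ h1.2 with h2 | ⟨_, _, h2⟩
        · exact h2
        · exact absurd (by rw [h2]) hb
  · refine ⟨h.source, h.parent, h.le, fun t' a b ha hT' hD' => ?_⟩
    rcases hD' with h1 | ⟨h1, h2⟩
    · exact h.closed t' a b ha hT' (Or.inl h1)
    · rcases hD _ _ _ h2 with h3 | ⟨rfl, rfl, rfl⟩
      · exact h.closed t' a b ha hT' (Or.inr ⟨h1, h3⟩)
      · have := h.le b
        exact ⟨fun h4 => hno ⟨h4, h1, hT'⟩, by omega⟩

lemma BFSInv.next (h : BFSInv N w W r Done L p y) (hD : ∀ t u v, Done t u v) :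
    BFSInv N w W (r + 1) (fun _ _ _ => False) L p y :=
  ⟨h.source, h.parent, fun v => (h.le v).trans (by omega), fun t u v h1 h2 h3 =>
    h.closed t u v h1 h2 (by
      rcases h3 with h3 | ⟨_, h3⟩
      · rcases Nat.le_succ_iff.1 h3 with h3 | h3
        · exact Or.inl h3
        · exact Or.inr ⟨h3, hD _ _ _⟩
      · exact h3.elim)⟩

/-- The predecessors in array `10`. -/
def predOf (n : ℕ) (m : Memory) (v : Fin n) : Fin n :=
  if h : m.nat 10 v < n then ⟨m.nat 10 v, h⟩ else v

/-- The types of arcs in array `11`. -/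
def typOf (n : ℕ) (m : Memory) (v : Fin n) : Fin 2 := if m.nat 11 v = 0 then 0 else 1

/-- After `n` rounds the search is complete: a label `n + 1` would require `n + 1` elements with
different labels on the path to it. -/
lemma BFSInv.isBFS {m : Memory}
    (h : BFSInv N w W n (fun _ _ _ => False) (m.nat 9) (m.nat 10) (m.nat 11))
    (hle : ∀ v : Fin n, m.nat 9 v ≤ n + 1) :
    IsBFS N w W (fun v => m.nat 9 v) (predOf n m) (typOf n m) ∧ ∀ v : Fin n, m.nat 9 v ≤ n := by
  have hlevels : ∀ k, ∀ v : Fin n, m.nat 9 v = k + 1 → ∀ j ≤ k, ∃ x : Fin n, m.nat 9 x = j + 1 := by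
    intro k
    induction k with
    | zero => intro v hv j hj; exact ⟨v, by omega⟩
    | succ k ih =>
      intro v hv j hj
      rcases Nat.le_succ_iff.1 hj with hj | rfl
      · obtain ⟨u, _, _, _, hu, _⟩ := h.parent v (by omega)
        exact ih u (by omega) j hj
      · exact ⟨v, hv⟩
  have hn : ∀ v : Fin n, m.nat 9 v ≤ n := by
    intro v
    by_contra hv
    have hsub : Finset.Icc 1 (n + 1) ⊆ Finset.univ.image fun x : Fin n => m.nat 9 x := by
      intro j hj
      rw [Finset.mem_Icc] at hj
      obtain ⟨x, hx⟩ := hlevels n v (by have := hle v; omega) (j - 1) (by omega)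
      rw [Finset.mem_image]
      exact ⟨x, Finset.mem_univ _, by omega⟩
    have := (Finset.card_le_card hsub).trans Finset.card_image_le
    simp at this
  refine ⟨⟨h.source, fun v hv => ?_, fun t u v hu hT => ?_⟩, hn⟩
  · obtain ⟨u, t, h1, h2, h3, h4⟩ := h.parent v hv
    have hp : predOf n m v = u := by
      rw [predOf, dif_pos (by rw [h1]; exact u.2)]
      exact Fin.ext h1
    have ht : typOf n m v = t := by
      rw [typOf, h2]
      fin_cases t <;> simp
    rw [hp, ht]
    exact ⟨h3, h4⟩
  · exact h.closed t u v hu hT (Or.inl (hn u))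

lemma bfsArc_spec (hE : M.E = Set.univ) {m m₀ : Memory} (hm : SameState m m₀) {t : Fin 2}
    {u v : Fin n} (hu : m.nat 14 0 = u) (hv : m.nat 15 0 = v) (h9 : m.real 9 0 = 0)
    (hW : ∀ t, (matroidOf M m₀ t).IsBase (setOf n m₀ t : Set (Fin n))) :
    (m.nat 9 v = 0 ∧ m.nat 9 u = m.nat 16 0 + 1 ∧
      Tight (matroidOf M m₀) (weightOf n m₀) (setOf n m₀) t u v ∧
      (∀ i, ((bfsArc t).exec (oracle M) m).nat 9 i = if i = v then m.nat 16 0 + 2 else m.nat 9 i) ∧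
      (∀ i, ((bfsArc t).exec (oracle M) m).nat 10 i = if i = v then (u : ℕ) else m.nat 10 i) ∧
      (∀ i, ((bfsArc t).exec (oracle M) m).nat 11 i = if i = v then (t : ℕ) else m.nat 11 i)) ∨
    (¬ (m.nat 9 v = 0 ∧ m.nat 9 u = m.nat 16 0 + 1 ∧
        Tight (matroidOf M m₀) (weightOf n m₀) (setOf n m₀) t u v) ∧
      ((bfsArc t).exec (oracle M) m).nat 9 = m.nat 9 ∧
      ((bfsArc t).exec (oracle M) m).nat 10 = m.nat 10 ∧
      ((bfsArc t).exec (oracle M) m).nat 11 = m.nat 11) := by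
  rw [bfsArc]
  by_cases h1 : m.nat 9 v = 0
  swap
  · rw [exec_ite_pos _ (by simpa [Test.Holds, NatExpr.eval, hv, Nat.pos_iff_ne_zero] using h1), exec]
    exact Or.inr ⟨fun h => h1 h.1, rfl, rfl, rfl⟩
  rw [exec_ite_neg _ (by simp [Test.Holds, NatExpr.eval, hv, h1])]
  by_cases h2 : m.nat 9 u < m.nat 16 0 + 1
  · rw [exec_ite_pos _ (by simpa [Test.Holds, NatExpr.eval, hu] using h2), exec]
    exact Or.inr ⟨fun h => by omega, rfl, rfl, rfl⟩
  rw [exec_ite_neg _ (by simpa [Test.Holds, NatExpr.eval, hu] using h2)]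
  by_cases h3 : m.nat 16 0 + 1 < m.nat 9 u
  · rw [exec_ite_pos _ (by simpa [Test.Holds, NatExpr.eval, hu] using h3), exec]
    exact Or.inr ⟨fun h => by omega, rfl, rfl, rfl⟩
  rw [exec_ite_neg _ (by simpa [Test.Holds, NatExpr.eval, hu] using h3), exec_seq]
  obtain ⟨h4, h5⟩ := arc_spec' hE hm (t := t) hu hv hW
  set m₁ := (arc t).exec (oracle M) m with hm₁
  have hn : ∀ a ∉ [12, 13, 7], m₁.nat a = m.nat a := fun a ha =>
    exec_nat _ (by rw [arc_natWrites]; simp at ha ⊢; tauto) _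
  have h9' : m₁.real 9 0 = 0 := by rw [hm₁, exec_real _ (by simp [arc_realWrites]), h9]
  have e9 := hn 9 (by decide)
  have e10 := hn 10 (by decide)
  have e11 := hn 11 (by decide)
  have e14 := hn 14 (by decide)
  have e15 := hn 15 (by decide)
  have e16 := hn 16 (by decide)
  by_cases h6 : m₁.nat 12 0 = 0
  · rw [exec_ite_pos _ (by simp [Test.Holds, NatExpr.eval, h6]), exec]
    exact Or.inr ⟨fun h => h4.2 h.2.2.1 h6, e9, e10, e11⟩
  rw [exec_ite_neg _ (by simpa [Test.Holds, NatExpr.eval] using h6)]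
  by_cases h7 : weightOf n m₀ t u ≤ weightOf n m₀ t v
  · rw [exec_ite_pos _ (by simpa [Test.Holds, NatExpr.eval, h5, h9'] using h7)]
    refine Or.inl ⟨h1, by omega, ⟨h4.1 h6, h7⟩, fun i => ?_, fun i => ?_, fun i => ?_⟩ <;>
    simp [exec, NatExpr.eval, Memory.writeNat_nat, e9, e10, e11, e14, e15, e16, hu, hv]
  · rw [exec_ite_neg _ (by simpa [Test.Holds, NatExpr.eval, h5, h9'] using h7), exec]
    exact Or.inr ⟨fun h => h7 h.2.2.2, e9, e10, e11⟩

theorem bfs_spec (hE : M.E = Set.univ) (m₀ : Memory) (h9 : m₀.real 9 0 = 0)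
    (hW : ∀ t, (matroidOf M m₀ t).IsBase (setOf n m₀ t : Set (Fin n))) :
    let m := bfs.exec (oracle M) m₀
    IsBFS (matroidOf M m₀) (weightOf n m₀) (setOf n m₀) (fun v => m.nat 9 v) (predOf n m)
      (typOf n m) ∧ ∀ v : Fin n, m.nat 9 v ≤ n := by
  intro m
  let Inv : ℕ → (Fin 2 → Fin n → Fin n → Prop) → Memory → Prop := fun r Done m =>
    BFSInv (matroidOf M m₀) (weightOf n m₀) (setOf n m₀) r Done (m.nat 9) (m.nat 10) (m.nat 11)
  have hcounter : ∀ c j r Done m, c ∉ [9, 10, 11] → Inv r Done m → Inv r Done (m.writeNat c 0 j) := by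
    intro c j r Done m hc h
    simp only [List.mem_cons, List.not_mem_nil, or_false, not_or] at hc
    dsimp only [Inv]
    rw [Memory.writeNat_nat_of_ne _ _ _ (Ne.symm hc.1), Memory.writeNat_nat_of_ne _ _ _ (Ne.symm hc.2.1),
      Memory.writeNat_nat_of_ne _ _ _ (Ne.symm hc.2.2)]
    exact h
  set m₁ := (fill 13 9 (.sub (.sub (.lit 1) (.cell 3 (var 13))) (.cell 4 (var 13)))).exec (oracle M) m₀
    with hm₁
  have h19 : ∀ v : Fin n, m₁.nat 9 v = (1 - m₀.nat 3 v) - m₀.nat 4 v := by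
    intro v
    rw [hm₁, exec_fill _ (g := fun i => (1 - m₀.nat 3 i) - m₀.nat 4 i) (by decide), if_pos v.2]
    intro j hj m' h1 h2 _
    simp [NatExpr.eval, h1 3, h1 4, h2]
  have hsame₁ : SameState m₁ m₀ := by
    apply sameState_exec <;> simp [fill, natWrites, realWrites]
  have hstart : Inv 0 (fun _ _ _ => False) m₁ ∧ ∀ v : Fin n, m₁.nat 9 v ≤ 1 := by
    have hle : ∀ v : Fin n, m₁.nat 9 v ≤ 1 := fun v => by rw [h19]; omega
    refine ⟨⟨fun v => ?_, fun v hv => ?_, fun v => ?_, fun t u v hu _ hD => ?_⟩, hle⟩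
    · rw [h19, Fin.forall_fin_two, mem_setOf_zero, mem_setOf_one]
      omega
    · have := hle v; omega
    · have := hle v; omega
    · rcases hD with hD | ⟨_, hD⟩
      · exact absurd (Nat.le_zero.1 hD) hu
      · exact hD.elim
  -- The label bound `r + 1` at the beginning of round `r` is one better than the invariant's.
  have hmain : (fun r m => Inv r (fun _ _ _ => False) m ∧ ∀ v : Fin n, m.nat 9 v ≤ r + 1) (n + 0) m := by
    refine exec_for (oracle M) (m₀ := m₁) (c := 16) (k := 0)
      (P := .forLoop 14 0 (.forLoop 15 0 (.seq (bfsArc 0) (bfsArc 1))))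
      (fun r m => Inv r (fun _ _ _ => False) m ∧ ∀ v : Fin n, m.nat 9 v ≤ r + 1) ?_ ?_
    · refine ⟨hcounter _ _ _ _ _ (by decide) hstart.1, fun v => ?_⟩
      rw [Memory.writeNat_nat_of_ne _ _ _ (by decide)]
      exact hstart.2 v
    intro r hr m₂ hn₂ hr₂ h16 ⟨hinv, _⟩
    have hsame₂ : SameState m₂ m₀ := by
      refine SameState.trans (sameState_of_frame hn₂ hr₂ ?_ ?_ ?_ ?_ ?_ ?_) hsame₁ <;>
      simp [bfsArc, arc_natWrites, arc_realWrites, natWrites, realWrites]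
    suffices h : Inv r (fun _ _ _ => True)
        ((SProg.forLoop 14 0 (.forLoop 15 0 (.seq (bfsArc 0) (bfsArc 1)))).exec (oracle M) m₂) by
      refine ⟨hcounter _ _ _ _ _ (by decide) (h.next fun _ _ _ => trivial), fun v => ?_⟩
      rw [Memory.writeNat_nat_of_ne _ _ _ (by decide)]
      exact h.le v
    have hu := exec_for (oracle M) (m₀ := m₂) (c := 14) (k := 0)
      (P := .forLoop 15 0 (.seq (bfsArc 0) (bfsArc 1)))
      (fun a m => Inv r (fun _ u _ => (u : ℕ) < a) m) ?_ ?_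
    · exact BFSInv.weaken hu fun _ u _ _ => by have := u.2; omega
    · exact hcounter _ _ _ _ _ (by decide) (hinv.weaken fun _ _ _ h => absurd h (by omega))
    intro a ha m₃ hn₃ hr₃ h14 hinv₃
    have hsame₃ : SameState m₃ m₀ := by
      refine SameState.trans (sameState_of_frame hn₃ hr₃ ?_ ?_ ?_ ?_ ?_ ?_) hsame₂ <;>
      simp [bfsArc, arc_natWrites, arc_realWrites, natWrites, realWrites]
    have h16₃ : m₃.nat 16 0 = r := by
      rw [hn₃ 16 (by simp [bfsArc, arc_natWrites, natWrites]), h16]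
    refine hcounter _ _ _ _ _ (by decide) ?_
    have hv := exec_for (oracle M) (m₀ := m₃) (c := 15) (k := 0)
      (P := .seq (bfsArc 0) (bfsArc 1))
      (fun b m => Inv r (fun _ u v => (u : ℕ) < a ∨ (u : ℕ) = a ∧ (v : ℕ) < b) m) ?_ ?_
    · exact BFSInv.weaken hv fun _ u v h => by have := v.2; omega
    · exact hcounter _ _ _ _ _ (by decide) (hinv₃.weaken fun _ _ _ h => by omega)
    intro b hb m₄ hn₄ hr₄ h15 hinv₄
    have hsame₄ : SameState m₄ m₀ := by
      refine SameState.trans (sameState_of_frame hn₄ hr₄ ?_ ?_ ?_ ?_ ?_ ?_) hsame₃ <;>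
      simp [bfsArc, arc_natWrites, arc_realWrites, natWrites, realWrites]
    have h16₄ : m₄.nat 16 0 = r := by
      rw [hn₄ 16 (by simp [bfsArc, arc_natWrites, natWrites]), h16₃]
    have h14₄ : m₄.nat 14 0 = a := by
      rw [hn₄ 14 (by simp [bfsArc, arc_natWrites, natWrites]), h14]
    refine hcounter _ _ _ _ _ (by decide) ?_
    rw [exec_seq]
    have s0 := bfsArc_spec hE hsame₄ (t := 0) (u := ⟨a, by omega⟩) (v := ⟨b, by omega⟩) h14₄ h15
      (by rw [hsame₄.real9, h9]) hW
    have hsame₅ : SameState ((bfsArc 0).exec (oracle M) m₄) m₀ := by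
      refine SameState.trans (sameState_exec ?_ ?_ ?_ ?_ ?_ ?_ _) hsame₄ <;>
      simp [bfsArc, arc_natWrites, arc_realWrites, natWrites, realWrites]
    have e14 : ((bfsArc 0).exec (oracle M) m₄).nat 14 0 = a := by
      rw [exec_nat _ (by simp [bfsArc, arc_natWrites, natWrites]), h14₄]
    have e15 : ((bfsArc 0).exec (oracle M) m₄).nat 15 0 = b := by
      rw [exec_nat _ (by simp [bfsArc, arc_natWrites, natWrites]), h15]
    have e16 : ((bfsArc 0).exec (oracle M) m₄).nat 16 0 = r := by
      rw [exec_nat _ (by simp [bfsArc, arc_natWrites, natWrites]), h16₄]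
    have s1 := bfsArc_spec hE hsame₅ (t := 1) (u := ⟨a, by omega⟩) (v := ⟨b, by omega⟩) e14 e15
      (by rw [hsame₅.real9, h9]) hW
    rw [h16₄] at s0
    rw [e16] at s1
    refine BFSInv.step (BFSInv.step hinv₄ s0 (fun _ _ _ h => h)) s1 ?_
    intro t u v huv
    simp only [Fin.ext_iff]
    omega
  exact BFSInv.isBFS hmain.1 hmain.2

end BFS

end SProg
end OracleRAM

namespace OracleRAM
open MatroidPair
namespace SProg

/-! ### Augmentation and change of weights -/

section Improve

variable {n : ℕ} {M : Matroid (Fin n)}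

lemma findSink_spec (m₀ : Memory) :
    let m := findSink.exec (oracle M) m₀
    (m.nat 19 0 = 0 ∧ ∀ v : Fin n, m₀.nat 9 v ≠ 0 → ¬ ∀ t, v ∈ setOf n m₀ t) ∨
    (m.nat 19 0 ≠ 0 ∧ ∃ s : Fin n, m.nat 20 0 = s ∧ m₀.nat 9 s ≠ 0 ∧ ∀ t, s ∈ setOf n m₀ t) := by
  intro m
  set m₁ := (SProg.setNat 19 (.lit 0) (.lit 0)).exec (oracle M) m₀ with hm₁
  have hn₁ : ∀ a, a ≠ 19 → m₁.nat a = m₀.nat a := fun a ha => exec_nat _ (by simp [natWrites, ha]) _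
  simp only [Fin.forall_fin_two, mem_setOf_zero, mem_setOf_one]
  set body : SProg := .ite (.natLt (.cell 9 (var 15)) (.lit 1)) .skip <|
    .ite (.natLt (.cell 3 (var 15)) (.lit 1)) .skip <|
    .ite (.natLt (.cell 4 (var 15)) (.lit 1)) .skip <|
    .seq (.setNat 19 (.lit 0) (.lit 1)) (.setNat 20 (.lit 0) (var 15)) with hbody
  have h := exec_for (oracle M) (m₀ := m₁) (c := 15) (k := 0) (P := body)
    (fun j m => (m.nat 19 0 = 0 ∧ ∀ v : Fin n, (v : ℕ) < j → m₀.nat 9 v ≠ 0 →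
        ¬ (m₀.nat 3 v ≠ 0 ∧ m₀.nat 4 v ≠ 0)) ∨
      (m.nat 19 0 ≠ 0 ∧ ∃ s : Fin n, m.nat 20 0 = s ∧ m₀.nat 9 s ≠ 0 ∧ m₀.nat 3 s ≠ 0 ∧
        m₀.nat 4 s ≠ 0)) ?_ ?_
  · rcases h with ⟨h1, h2⟩ | h1
    · exact Or.inl ⟨h1, fun v => h2 v (by omega)⟩
    · exact Or.inr h1
  · left
    rw [Memory.writeNat_nat_of_ne _ _ _ (by decide)]
    simp [hm₁, exec, NatExpr.eval]
  · intro j hj m₂ hn₂ _ h15 hinv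
    rw [Memory.writeNat_nat_of_ne _ _ _ (by decide), Memory.writeNat_nat_of_ne _ _ _ (by decide)]
    have e9 : m₂.nat 9 = m₀.nat 9 := by rw [hn₂ 9 (by simp [hbody, natWrites]), hn₁ _ (by decide)]
    have e3 : m₂.nat 3 = m₀.nat 3 := by rw [hn₂ 3 (by simp [hbody, natWrites]), hn₁ _ (by decide)]
    have e4 : m₂.nat 4 = m₀.nat 4 := by rw [hn₂ 4 (by simp [hbody, natWrites]), hn₁ _ (by decide)]
    by_cases hc : m₀.nat 9 j ≠ 0 ∧ m₀.nat 3 j ≠ 0 ∧ m₀.nat 4 j ≠ 0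
    · right
      rw [hbody, exec_ite_neg _ (by simpa [Test.Holds, NatExpr.eval, h15, e9] using hc.1),
        exec_ite_neg _ (by simpa [Test.Holds, NatExpr.eval, h15, e3] using hc.2.1),
        exec_ite_neg _ (by simpa [Test.Holds, NatExpr.eval, h15, e4] using hc.2.2)]
      refine ⟨by simp [exec, NatExpr.eval, Memory.writeNat_nat], ⟨j, by omega⟩, ?_, hc⟩
      simp [exec, NatExpr.eval, Memory.writeNat_nat, h15]
    · have hskip : body.exec (oracle M) m₂ = m₂ := by
        simp only [hbody, exec, Test.Holds, NatExpr.eval, eval_var, h15, e9, e3, e4]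
        split_ifs
        · rfl
        · rfl
        · rfl
        · exact absurd ⟨by omega, by omega, by omega⟩ hc
      rw [hskip]
      refine hinv.imp_left fun ⟨h1, h2⟩ => ⟨h1, fun v hv hv9 hv34 => ?_⟩
      rcases Nat.lt_succ_iff_lt_or_eq.1 hv with hv | hv
      · exact h2 v hv hv9 hv34
      · rw [hv] at hv9 hv34
        exact hc ⟨hv9, hv34⟩

lemma augmentStep_spec {m : Memory} {x y : Fin n} {t : Fin 2} (hx : m.nat 20 0 = x)
    (hL : 2 ≤ m.nat 9 x) (hy : m.nat 10 x = y) (ht : typOf n m x = t) :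
    (augmentStep.exec (oracle M) m).nat 20 0 = y ∧
    setOf n (augmentStep.exec (oracle M) m) =
      fun t' => if t = t' then insert y ((setOf n m t').erase x) else setOf n m t' := by
  rw [augmentStep, exec_ite_neg _ (by simp only [Test.Holds, NatExpr.eval, eval_var, hx]; omega),
    exec_seq]
  rw [typOf] at ht
  split_ifs at ht with h11
  · subst ht
    rw [exec_ite_pos _ (by simp [Test.Holds, NatExpr.eval, hx, h11])]
    refine ⟨by simp [exec, NatExpr.eval, Memory.writeNat_nat, hx, hy], ?_⟩
    funext t'
    ext e
    fin_cases t'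
    · simp only [Fin.zero_eta, if_true, Finset.mem_insert, Finset.mem_erase, mem_setOf_zero]
      simp only [exec, NatExpr.eval, eval_var, Memory.writeNat_nat, hx, Fin.ext_iff]
      simp
      split_ifs <;> simp_all [Fin.ext_iff]
    · simp only [Fin.mk_one, zero_ne_one, if_false, mem_setOf_one]
      simp [exec, NatExpr.eval, Memory.writeNat_nat]
  · subst ht
    rw [exec_ite_neg _ (by simpa [Test.Holds, NatExpr.eval, hx] using h11)]
    refine ⟨by simp [exec, NatExpr.eval, Memory.writeNat_nat, hx, hy], ?_⟩
    funext t'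
    ext e
    fin_cases t'
    · simp only [Fin.zero_eta, one_ne_zero, if_false, mem_setOf_zero]
      simp [exec, NatExpr.eval, Memory.writeNat_nat]
    · simp only [Fin.mk_one, if_true, Finset.mem_insert, Finset.mem_erase, mem_setOf_one]
      simp only [exec, NatExpr.eval, eval_var, Memory.writeNat_nat, hx, Fin.ext_iff]
      simp
      split_ifs <;> simp_all [Fin.ext_iff]

lemma augment_spec {N : Fin 2 → Matroid (Fin n)} {w : Fin 2 → Fin n → ℝ} {m₀ : Memory} {s : Fin n}
    (h : IsBFS N w (setOf n m₀) (fun v => m₀.nat 9 v) (predOf n m₀) (typOf n m₀))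
    (hs : m₀.nat 20 0 = s) (hL : m₀.nat 9 s ≠ 0) (hn : m₀.nat 9 s ≤ n) :
    setOf n (augment.exec (oracle M) m₀) =
      toggled (setOf n m₀) (predOf n m₀) (typOf n m₀) s (m₀.nat 9 s - 1) := by
  set l := m₀.nat 9 s with hl
  have hcounter : ∀ (m : Memory) j, setOf n (m.writeNat 16 0 j) = setOf n m := fun m j =>
    funext fun t => Memory.toFinset_congr fun i _ => by
      rw [Memory.writeNat_nat_of_ne _ _ _ (by omega)]
  have hmain := exec_for (oracle M) (m₀ := m₀) (c := 16) (k := 0) (P := augmentStep)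
    (fun j m => m.nat 20 0 = ((predOf n m₀)^[min j (l - 1)] s : Fin n) ∧
      setOf n m = toggled (setOf n m₀) (predOf n m₀) (typOf n m₀) s (min j (l - 1))) ?_ ?_
  · rw [min_eq_right (by omega)] at hmain
    exact hmain.2
  · refine ⟨?_, ?_⟩
    · rw [Memory.writeNat_nat_of_ne _ _ _ (by decide), hs]; simp
    · rw [hcounter]; simp [toggled]
  · intro j hj m hnat _ _ ⟨h1, h2⟩
    rw [Memory.writeNat_nat_of_ne _ _ _ (by decide), hcounter]
    have e9 : m.nat 9 = m₀.nat 9 := hnat 9 (by simp [augmentStep, natWrites])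
    have e10 : m.nat 10 = m₀.nat 10 := hnat 10 (by simp [augmentStep, natWrites])
    have e11 : m.nat 11 = m₀.nat 11 := hnat 11 (by simp [augmentStep, natWrites])
    by_cases hjl : j < l - 1
    · have hmin : min j (l - 1) = j := min_eq_left hjl.le
      have hmin' : min (j + 1) (l - 1) = j + 1 := min_eq_left hjl
      rw [hmin] at h1 h2
      rw [hmin']
      set x := (predOf n m₀)^[j] s with hx
      have hlev : m₀.nat 9 x = l - j := h.level (s := s) (k := j) (by omega)
      have hpar := (h.parent x (by omega)).1
      have hp : m₀.nat 10 x = predOf n m₀ x := by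
        by_cases hlt : m₀.nat 10 x < n
        · rw [predOf, dif_pos hlt]
        · rw [predOf, dif_neg hlt] at hpar
          omega
      obtain ⟨h3, h4⟩ := augmentStep_spec (M := M) (t := typOf n m₀ x) h1 (by rw [e9]; omega)
        (by rw [e10, hp]) (by rw [typOf, typOf, e11])
      rw [Function.iterate_succ_apply', ← hx]
      refine ⟨h3, ?_⟩
      rw [h4, h2]
      funext t
      simp only [toggled, Function.iterate_succ_apply', ← hx]
    · have hmin : min j (l - 1) = l - 1 := min_eq_right (by omega)
      have hmin' : min (j + 1) (l - 1) = l - 1 := min_eq_right (by omega)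
      rw [hmin] at h1 h2
      rw [hmin']
      have hlev : m₀.nat 9 ((predOf n m₀)^[l - 1] s) = l - (l - 1) :=
        h.level (s := s) (k := l - 1) (by omega)
      rw [augmentStep, exec_ite_pos _ (by
        simp only [Test.Holds, NatExpr.eval, eval_var, h1, e9, hlev]; omega), exec]
      exact ⟨h1, h2⟩

/-- The state of the search for the minimum slack after the arcs in `Done` have been treated. -/
def SlackInv (N : Fin 2 → Matroid (Fin n)) (w : Fin 2 → Fin n → ℝ) (W : Fin 2 → Finset (Fin n))
    (L : ℕ → ℕ) (Done : Fin 2 → Fin n → Fin n → Prop) (found : ℕ) (δ : ℝ) : Prop :=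
  (found = 0 ∧ ∀ t u v, Done t u v → L u ≠ 0 → L v = 0 → ¬ Exch (N t) (W t) u v) ∨
  (found ≠ 0 ∧ (∃ (t : Fin 2) (u v : Fin n), L u ≠ 0 ∧ L v = 0 ∧ Exch (N t) (W t) u v ∧
      w t u - w t v = δ) ∧
    ∀ t u v, Done t u v → L u ≠ 0 → L v = 0 → Exch (N t) (W t) u v → δ ≤ w t u - w t v)

lemma SlackInv.weaken {N : Fin 2 → Matroid (Fin n)} {w : Fin 2 → Fin n → ℝ}
    {W : Fin 2 → Finset (Fin n)} {L : ℕ → ℕ} {Done Done' : Fin 2 → Fin n → Fin n → Prop} {f : ℕ}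
    {δ : ℝ} (h : SlackInv N w W L Done f δ) (hD : ∀ t u v, Done' t u v → Done t u v) :
    SlackInv N w W L Done' f δ :=
  h.imp (fun h => ⟨h.1, fun t u v h' => h.2 t u v (hD _ _ _ h')⟩)
    fun h => ⟨h.1, h.2.1, fun t u v h' => h.2.2 t u v (hD _ _ _ h')⟩

lemma slackArc_spec (hE : M.E = Set.univ) {m m₀ : Memory} (hm : SameState m m₀) {t : Fin 2}
    {u v : Fin n} (hu : m.nat 14 0 = u) (hv : m.nat 15 0 = v)
    (hW : ∀ t, (matroidOf M m₀ t).IsBase (setOf n m₀ t : Set (Fin n)))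
    {Done Done' : Fin 2 → Fin n → Fin n → Prop}
    (h : SlackInv (matroidOf M m₀) (weightOf n m₀) (setOf n m₀) (m.nat 9) Done (m.nat 19 0) (m.real 6 0))
    (hD : ∀ t' u' v', Done' t' u' v' → Done t' u' v' ∨ t' = t ∧ u' = u ∧ v' = v) :
    SlackInv (matroidOf M m₀) (weightOf n m₀) (setOf n m₀) (m.nat 9) Done'
      (((slackArc t).exec (oracle M) m).nat 19 0) (((slackArc t).exec (oracle M) m).real 6 0) := by
  -- If the new arc is not one to be counted, nothing changes.
  have hskip : ∀ m' : Memory, m'.nat 19 = m.nat 19 → m'.real 6 = m.real 6 →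
      (m.nat 9 u ≠ 0 → m.nat 9 v = 0 → ¬ Exch (matroidOf M m₀ t) (setOf n m₀ t) u v) →
      SlackInv (matroidOf M m₀) (weightOf n m₀) (setOf n m₀) (m.nat 9) Done' (m'.nat 19 0)
        (m'.real 6 0) := by
    intro m' e19 e6 hno
    rw [e19, e6]
    rcases h with ⟨h1, h2⟩ | ⟨h1, h2, h3⟩
    · refine Or.inl ⟨h1, fun t' u' v' hd hu' hv' => ?_⟩
      rcases hD _ _ _ hd with hd | ⟨rfl, rfl, rfl⟩
      · exact h2 _ _ _ hd hu' hv'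
      · exact hno hu' hv'
    · refine Or.inr ⟨h1, h2, fun t' u' v' hd hu' hv' he => ?_⟩
      rcases hD _ _ _ hd with hd | ⟨rfl, rfl, rfl⟩
      · exact h3 _ _ _ hd hu' hv' he
      · exact absurd he (hno hu' hv')
  rw [slackArc]
  by_cases h1 : m.nat 9 u = 0
  · rw [exec_ite_pos _ (by simp [Test.Holds, NatExpr.eval, hu, h1]), exec]
    exact hskip m rfl rfl fun h => absurd h1 h
  rw [exec_ite_neg _ (by simpa [Test.Holds, NatExpr.eval, hu] using h1)]
  by_cases h2 : m.nat 9 v = 0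
  swap
  · rw [exec_ite_pos _ (by simpa [Test.Holds, NatExpr.eval, hv, Nat.pos_iff_ne_zero] using h2), exec]
    exact hskip m rfl rfl fun _ h => absurd h h2
  rw [exec_ite_neg _ (by simp [Test.Holds, NatExpr.eval, hv, h2]), exec_seq]
  obtain ⟨h4, h5⟩ := arc_spec' hE hm (t := t) hu hv hW
  set m₁ := (arc t).exec (oracle M) m with hm₁
  have e19 : m₁.nat 19 = m.nat 19 := exec_nat _ (by simp [arc_natWrites]) _
  have e6 : m₁.real 6 = m.real 6 := exec_real _ (by simp [arc_realWrites]) _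
  by_cases h6 : m₁.nat 12 0 = 0
  · rw [exec_ite_pos _ (by simp [Test.Holds, NatExpr.eval, h6]), exec]
    exact hskip m₁ e19 e6 fun _ _ h => h4.2 h h6
  rw [exec_ite_neg _ (by simpa [Test.Holds, NatExpr.eval] using h6)]
  have hex := h4.1 h6
  rcases h with ⟨h7, h8⟩ | ⟨h7, h8, h9⟩
  · rw [exec_ite_pos _ (by simp [Test.Holds, NatExpr.eval, e19, h7])]
    simp only [exec, NatExpr.eval, Memory.writeNat_real, Memory.writeReal_nat,
      Memory.writeNat_nat_self, Memory.writeReal_real_self, h5]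
    refine Or.inr ⟨one_ne_zero, ⟨t, u, v, h1, h2, hex, rfl⟩, fun t' u' v' hd hu' hv' he => ?_⟩
    rcases hD _ _ _ hd with hd | ⟨rfl, rfl, rfl⟩
    · exact absurd he (h8 _ _ _ hd hu' hv')
    · exact le_rfl
  · rw [exec_ite_neg _ (by simpa [Test.Holds, NatExpr.eval, e19] using h7)]
    by_cases h10 : weightOf n m₀ t u - weightOf n m₀ t v ≤ m.real 6 0
    · rw [exec_ite_pos _ (by simpa [Test.Holds, NatExpr.eval, h5, e6] using h10)]
      simp only [exec, NatExpr.eval, Memory.writeReal_nat, Memory.writeReal_real_self, h5, e19]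
      refine Or.inr ⟨h7, ⟨t, u, v, h1, h2, hex, rfl⟩, fun t' u' v' hd hu' hv' he => ?_⟩
      rcases hD _ _ _ hd with hd | ⟨rfl, rfl, rfl⟩
      · exact h10.trans (h9 _ _ _ hd hu' hv' he)
      · exact le_rfl
    · rw [exec_ite_neg _ (by simpa [Test.Holds, NatExpr.eval, h5, e6] using h10), exec, e19, e6]
      refine Or.inr ⟨h7, h8, fun t' u' v' hd hu' hv' he => ?_⟩
      rcases hD _ _ _ hd with hd | ⟨rfl, rfl, rfl⟩
      · exact h9 _ _ _ hd hu' hv' he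
      · exact (not_le.1 h10).le

lemma minSlack_spec (hE : M.E = Set.univ) (m₀ : Memory)
    (hW : ∀ t, (matroidOf M m₀ t).IsBase (setOf n m₀ t : Set (Fin n))) :
    SlackInv (matroidOf M m₀) (weightOf n m₀) (setOf n m₀) (m₀.nat 9) (fun _ _ _ => True)
      ((minSlack.exec (oracle M) m₀).nat 19 0) ((minSlack.exec (oracle M) m₀).real 6 0) := by
  let Inv : (Fin 2 → Fin n → Fin n → Prop) → Memory → Prop := fun Done m =>
    SlackInv (matroidOf M m₀) (weightOf n m₀) (setOf n m₀) (m₀.nat 9) Done (m.nat 19 0) (m.real 6 0)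
  have hcounter : ∀ c j Done m, c ≠ 19 → Inv Done m → Inv Done (m.writeNat c 0 j) := by
    intro c j Done m hc h
    dsimp only [Inv]
    rw [Memory.writeNat_nat_of_ne _ _ _ (Ne.symm hc)]
    exact h
  rw [minSlack, exec_seq]
  set m₁ := (SProg.setNat 19 (.lit 0) (.lit 0)).exec (oracle M) m₀ with hm₁
  have hsame₁ : SameState m₁ m₀ := by
    apply sameState_exec <;> simp [natWrites, realWrites]
  have h9₁ : m₁.nat 9 = m₀.nat 9 := exec_nat _ (by simp [natWrites]) _
  have hu := exec_for (oracle M) (m₀ := m₁) (c := 14) (k := 0)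
    (P := .forLoop 15 0 (.seq (slackArc 0) (slackArc 1))) (fun a m => Inv (fun _ u _ => (u : ℕ) < a) m) ?_ ?_
  · exact SlackInv.weaken hu fun _ u _ _ => by have := u.2; omega
  · refine hcounter _ _ _ _ (by decide) (Or.inl ⟨by simp [hm₁, exec, NatExpr.eval], ?_⟩)
    intro _ _ _ h; omega
  intro a ha m₂ hn₂ hr₂ h14 hinv₂
  have hsame₂ : SameState m₂ m₀ := by
    refine SameState.trans (sameState_of_frame hn₂ hr₂ ?_ ?_ ?_ ?_ ?_ ?_) hsame₁ <;>
    simp [slackArc, arc_natWrites, arc_realWrites, natWrites, realWrites]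
  have h9₂ : m₂.nat 9 = m₀.nat 9 := by
    rw [hn₂ 9 (by simp [slackArc, arc_natWrites, natWrites]), h9₁]
  refine hcounter _ _ _ _ (by decide) ?_
  have hv := exec_for (oracle M) (m₀ := m₂) (c := 15) (k := 0) (P := .seq (slackArc 0) (slackArc 1))
    (fun b m => Inv (fun _ u v => (u : ℕ) < a ∨ (u : ℕ) = a ∧ (v : ℕ) < b) m) ?_ ?_
  · exact SlackInv.weaken hv fun _ u v h => by have := v.2; omega
  · exact hcounter _ _ _ _ (by decide) (hinv₂.weaken fun _ _ _ h => by omega)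
  intro b hb m₃ hn₃ hr₃ h15 hinv₃
  have hsame₃ : SameState m₃ m₀ := by
    refine SameState.trans (sameState_of_frame hn₃ hr₃ ?_ ?_ ?_ ?_ ?_ ?_) hsame₂ <;>
    simp [slackArc, arc_natWrites, arc_realWrites, natWrites, realWrites]
  have h9₃ : m₃.nat 9 = m₀.nat 9 := by
    rw [hn₃ 9 (by simp [slackArc, arc_natWrites, natWrites]), h9₂]
  have h14₃ : m₃.nat 14 0 = a := by
    rw [hn₃ 14 (by simp [slackArc, arc_natWrites, natWrites]), h14]
  refine hcounter _ _ _ _ (by decide) ?_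
  rw [exec_seq]
  set m₄ := (slackArc 0).exec (oracle M) m₃ with hm₄
  have hsame₄ : SameState m₄ m₀ := by
    refine SameState.trans (sameState_exec ?_ ?_ ?_ ?_ ?_ ?_ _) hsame₃ <;>
    simp [slackArc, arc_natWrites, arc_realWrites, natWrites, realWrites]
  have e14 : m₄.nat 14 0 = a := by
    rw [hm₄, exec_nat _ (by simp [slackArc, arc_natWrites, natWrites]), h14₃]
  have e15 : m₄.nat 15 0 = b := by
    rw [hm₄, exec_nat _ (by simp [slackArc, arc_natWrites, natWrites]), h15]
  have e9 : m₄.nat 9 = m₀.nat 9 := by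
    rw [hm₄, exec_nat _ (by simp [slackArc, arc_natWrites, natWrites]), h9₃]
  have s0 := slackArc_spec hE hsame₃ (t := 0) (u := ⟨a, by omega⟩) (v := ⟨b, by omega⟩) h14₃ h15 hW
    (Done' := fun t u v => ((u : ℕ) < a ∨ (u : ℕ) = a ∧ (v : ℕ) < b) ∨
      t = 0 ∧ u = ⟨a, by omega⟩ ∧ v = ⟨b, by omega⟩)
    (by rw [h9₃]; exact hinv₃) (fun _ _ _ h => h)
  have s1 := slackArc_spec hE hsame₄ (t := 1) (u := ⟨a, by omega⟩) (v := ⟨b, by omega⟩) e14 e15 hW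
    (Done' := fun _ u v => (u : ℕ) < a ∨ (u : ℕ) = a ∧ (v : ℕ) < b + 1)
    (by rw [e9, ← h9₃]; exact s0) (by
      intro t u v huv
      simp only [Fin.ext_iff]
      omega)
  rw [e9] at s1
  exact s1

lemma raise_spec (m₀ : Memory) :
    weightOf n (raise.exec (oracle M) m₀) = fun t (e : Fin n) => weightOf n m₀ t e +
      if m₀.nat 9 e ≠ 0 then 0 else m₀.real 6 0 := by
  set body : SProg := .ite (.natLt (.lit 0) (.cell 9 (var 15))) .skip <|
    .seq (.addReal 3 (var 15) 3 (var 15) 6 (.lit 0)) (.addReal 4 (var 15) 4 (var 15) 6 (.lit 0))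
    with hbody
  have h := exec_for (oracle M) (m₀ := m₀) (c := 15) (k := 0) (P := body)
    (fun j m => ∀ i, (m.real 3 i = m₀.real 3 i + if i < j ∧ m₀.nat 9 i = 0 then m₀.real 6 0 else 0) ∧
      (m.real 4 i = m₀.real 4 i + if i < j ∧ m₀.nat 9 i = 0 then m₀.real 6 0 else 0)) ?_ ?_
  · have h' : ∀ e : Fin n, ((e : ℕ) < n + 0 ∧ m₀.nat 9 e = 0) ↔ ¬ m₀.nat 9 e ≠ 0 := by
      intro e; have := e.2; omega
    funext t e
    rw [← ite_not]
    simp only [← h' e]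
    fin_cases t
    · exact (h e).1
    · exact (h e).2
  · simp
  · intro j hj m hn hr h15 hinv i
    have e9 : m.nat 9 = m₀.nat 9 := hn 9 (by simp [hbody, natWrites])
    have e6 : m.real 6 = m₀.real 6 := hr 6 (by simp [hbody, realWrites])
    simp only [Memory.writeNat_real]
    obtain ⟨h1, h2⟩ := hinv i
    by_cases hj9 : m₀.nat 9 j = 0
    · rw [hbody, exec_ite_neg _ (by simp [Test.Holds, NatExpr.eval, h15, e9, hj9])]
      simp only [exec, NatExpr.eval, eval_var, h15, Memory.writeReal_nat, Memory.writeReal_real, e6]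
      by_cases hij : i = j
      · subst hij
        simp [hj9] at h1 h2 ⊢
        simp [h1, h2]
      · have : i < j + 1 ↔ i < j := by omega
        simp [hij, h1, h2, this]
    · rw [hbody, exec_ite_pos _ (by simpa [Test.Holds, NatExpr.eval, h15, e9, Nat.pos_iff_ne_zero]
        using hj9), exec, h1, h2]
      have : (i < j + 1 ∧ m₀.nat 9 i = 0) ↔ (i < j ∧ m₀.nat 9 i = 0) := by
        constructor
        · rintro ⟨h3, h4⟩
          refine ⟨lt_of_le_of_ne (Nat.le_of_lt_succ h3) ?_, h4⟩
          rintro rfl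
          exact hj9 h4
        · rintro ⟨h3, h4⟩
          exact ⟨by omega, h4⟩
      simp only [this, and_self]

/-- One step of the primal-dual method either decreases the intersection by one element, or enlarges
the set reached by tight arcs, or changes nothing because the intersection is minimal. -/
theorem improve_spec (hE : M.E = Set.univ) {c : Fin 2 → Fin n → ℝ} (m₀ : Memory)
    (h9 : m₀.real 9 0 = 0) (hc : Certified (matroidOf M m₀) c (weightOf n m₀) (setOf n m₀)) :
    let m := improve.exec (oracle M) m₀
    Certified (matroidOf M m₀) c (weightOf n m) (setOf n m) ∧
    ((setOf n m 0 ∩ setOf n m 1).card + 1 = (setOf n m₀ 0 ∩ setOf n m₀ 1).card ∨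
      (setOf n m = setOf n m₀ ∧ (reach (matroidOf M m₀) (weightOf n m₀) (setOf n m₀)).card <
        (reach (matroidOf M m₀) (weightOf n m) (setOf n m)).card) ∨
      (setOf n m = setOf n m₀ ∧ ∀ W' : Fin 2 → Finset (Fin n),
        (∀ t, (matroidOf M m₀ t).IsBase (W' t : Set (Fin n))) →
        (setOf n m₀ 0 ∩ setOf n m₀ 1).card ≤ (W' 0 ∩ W' 1).card)) := by
  intro m
  have hW : ∀ t, (matroidOf M m₀ t).IsBase (setOf n m₀ t : Set (Fin n)) := fun t => (hc.1 t).1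
  have hEt : ∀ t, (matroidOf M m₀ t).E = Set.univ := by
    intro t
    rw [matroidOf]
    split_ifs
    · exact hE
    · rw [Matroid.dual_ground, hE]
  obtain ⟨hbfs, hle⟩ := bfs_spec hE m₀ h9 hW
  set m₁ := bfs.exec (oracle M) m₀ with hm₁
  have hsame₁ : SameState m₁ m₀ := by
    apply sameState_exec <;>
    simp [bfs, bfsArc, fill, arc_natWrites, arc_realWrites, natWrites, realWrites]
  set m₂ := findSink.exec (oracle M) m₁ with hm₂
  have hsame₂ : SameState m₂ m₀ := by
    refine SameState.trans (sameState_exec ?_ ?_ ?_ ?_ ?_ ?_ _) hsame₁ <;>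
    simp [findSink, natWrites, realWrites]
  have e9 : m₂.nat 9 = m₁.nat 9 := exec_nat _ (by simp [findSink, natWrites]) _
  have e10 : m₂.nat 10 = m₁.nat 10 := exec_nat _ (by simp [findSink, natWrites]) _
  have e11 : m₂.nat 11 = m₁.nat 11 := exec_nat _ (by simp [findSink, natWrites]) _
  have ep : predOf n m₂ = predOf n m₁ := by funext v; simp only [predOf, e10]
  have et : typOf n m₂ = typOf n m₁ := by funext v; simp only [typOf, e11]
  rw [← ep, ← et, ← e9] at hbfs
  rw [← e9] at hle
  have hm : m = (SProg.ite (.natLt (.lit 0) (var 19)) augment (.seq minSlack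
      (.ite (.natLt (.lit 0) (var 19)) raise .skip))).exec (oracle M) m₂ := rfl
  have hfind := findSink_spec (M := M) m₁
  rw [hsame₁.setOf_eq] at hfind
  rcases hfind with ⟨h19, hsink⟩ | ⟨h19, s, h20, hs9, hs⟩
  swap
  · rw [exec_ite_pos _ (by simpa [Test.Holds, NatExpr.eval, Nat.pos_iff_ne_zero] using h19)] at hm
    rw [← hsame₂.setOf_eq] at hbfs hs
    rw [← e9] at hs9
    have haug := augment_spec (M := M) hbfs h20 hs9 (hle s)
    have hw : weightOf n m = weightOf n m₂ := by
      funext t e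
      rw [weightOf, weightOf, hm, exec_real _ (by simp [augment, augmentStep, realWrites])]
    rw [← hsame₂.setOf_eq, ← hsame₂.weightOf_eq] at hc
    rw [← hsame₂.weightOf_eq] at hbfs
    obtain ⟨h1, h2⟩ := hc.augment hEt hbfs hs9 hs
    rw [← haug, ← hm] at h1 h2
    refine ⟨hw ▸ h1, Or.inl ?_⟩
    rw [h2, hsame₂.setOf_eq]
  rw [exec_ite_neg _ (by simpa [Test.Holds, NatExpr.eval] using h19), exec_seq] at hm
  set R := reach (matroidOf M m₀) (weightOf n m₀) (setOf n m₀) with hR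
  have hmemR : ∀ v, v ∈ R ↔ m₂.nat 9 v ≠ 0 := fun v => hbfs.mem_reach v
  have hsrc : ∀ e, (∀ t, e ∉ setOf n m₀ t) → e ∈ R := by
    intro e he
    have : m₂.nat 9 e = 1 := (hbfs.source e).2 he
    rw [hmemR, this]
    exact one_ne_zero
  have hsinkR : ∀ e, (∀ t, e ∈ setOf n m₀ t) → e ∉ R := fun e he heR =>
    hsink e (by rw [← e9]; exact (hmemR e).1 heR) he
  have hslack := minSlack_spec (M := M) hE m₂ (by
    rw [hsame₂.matroidOf_eq, hsame₂.setOf_eq]; exact hW)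
  set m₃ := minSlack.exec (oracle M) m₂ with hm₃
  rw [hsame₂.matroidOf_eq, hsame₂.setOf_eq, hsame₂.weightOf_eq] at hslack
  have hsame₃ : SameState m₃ m₀ := by
    refine SameState.trans (sameState_exec ?_ ?_ ?_ ?_ ?_ ?_ _) hsame₂ <;>
    simp [minSlack, slackArc, arc_natWrites, arc_realWrites, natWrites, realWrites]
  have e9' : m₃.nat 9 = m₂.nat 9 :=
    exec_nat _ (by simp [minSlack, slackArc, arc_natWrites, natWrites]) _
  rcases hslack with ⟨h1, h2⟩ | ⟨h1, ⟨t, u, v, hu, hv, hex, hδ⟩, h3⟩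
  · rw [exec_ite_neg _ (by simpa [Test.Holds, NatExpr.eval] using h1), exec] at hm
    rw [hm, hsame₃.setOf_eq, hsame₃.weightOf_eq]
    refine ⟨hc, Or.inr (Or.inr ⟨rfl, fun W' hW' => ?_⟩)⟩
    refine hc.card_inter_le hsrc hsinkR (fun t u hu v hv => h2 t u v trivial ?_ ?_) hW'
    · exact (hmemR u).1 hu
    · simpa [hmemR] using hv
  · rw [exec_ite_pos _ (by simpa [Test.Holds, NatExpr.eval, Nat.pos_iff_ne_zero] using h1)] at hm
    have hset : setOf n m = setOf n m₀ := by
      rw [← hsame₃.setOf_eq, hm]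
      funext t
      refine Memory.toFinset_congr fun i _ => ?_
      rw [exec_nat _ (by simp [raise, natWrites]; omega)]
    have hwt : weightOf n m = fun t e => weightOf n m₀ t e + if e ∈ R then 0 else m₃.real 6 0 := by
      rw [hm, raise_spec, hsame₃.weightOf_eq, e9']
      funext t e
      simp only [hmemR]
    have hδ0 : 0 ≤ m₃.real 6 0 := by
      have := (hc.1 t).le_of_exch hex
      linarith
    rw [hset, hwt]
    refine ⟨hc.raise hδ0 hsrc hsinkR fun t u hu v hv he => ?_, Or.inr (Or.inl ⟨rfl, ?_⟩)⟩
    · have := h3 t u v trivial ((hmemR u).1 hu) (by simpa [hmemR] using hv) he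
      linarith
    · exact reach_card_lt ((hmemR u).2 hu) (by simpa [← hR, hmemR] using hv) hex (by linarith)

end Improve

end SProg
end OracleRAM

namespace OracleRAM
open MatroidPair
namespace SProg

/-! ### The search over all intersection sizes -/

section Pairs

variable {n : ℕ}

/-- `S` itself for `f = 0`, otherwise its complement. -/
def complIf (f : ℕ) (S : Finset (Fin n)) : Finset (Fin n) := if f = 0 then S else Sᶜ

/-- The pair `(M, M)` for `f = 0`, otherwise `(M, M✶)`. -/
def pairMatroid (M : Matroid (Fin n)) (f : ℕ) (t : Fin 2) : Matroid (Fin n) :=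
  if t = 0 ∨ f = 0 then M else M✶

/-- The costs for which the pair `(X, complIf f Y)` costs `c₁(X) + c₂(Y)`, up to a constant. -/
def pairCost (I : Input n) (f : ℕ) (t : Fin 2) (e : Fin n) : ℝ :=
  if t = 0 then I.c₁ e else if f = 0 then I.c₂ e else - I.c₂ e

/-- The objective value of the pair of bases encoded by `W`. -/
noncomputable def value (I : Input n) (f : ℕ) (W : Fin 2 → Finset (Fin n)) : ℝ :=
  objTri I.c₁ I.c₂ I.C (W 0) (complIf f (W 1))

lemma isBase_compl_iff (I : Input n) (S : Finset (Fin n)) :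
    I.M✶.IsBase ((Sᶜ : Finset (Fin n)) : Set (Fin n)) ↔ I.M.IsBase (S : Set (Fin n)) := by
  rw [Matroid.dual_isBase_iff (by simp [I.ground]), I.ground, Finset.coe_compl,
    ← Set.compl_eq_univ_sdiff, compl_compl]

lemma pairMatroid_isBase_iff (I : Input n) (f : ℕ) (W : Fin 2 → Finset (Fin n)) :
    (∀ t, (pairMatroid I.M f t).IsBase (W t : Set (Fin n))) ↔
      I.M.IsBase (W 0 : Set (Fin n)) ∧ I.M.IsBase (complIf f (W 1) : Set (Fin n)) := by
  rw [Fin.forall_fin_two]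
  by_cases hf : f = 0
  · simp [pairMatroid, complIf, hf]
  · have := isBase_compl_iff I (W 1)ᶜ
    rw [compl_compl] at this
    simp only [pairMatroid, complIf, hf, if_false, or_false, if_true, one_ne_zero, this]

lemma card_eq_of_isBase {M : Matroid (Fin n)} {X Y : Finset (Fin n)}
    (hX : M.IsBase (X : Set (Fin n))) (hY : M.IsBase (Y : Set (Fin n))) : X.card = Y.card := by
  have := hX.ncard_eq_ncard_of_isBase hY
  simpa using this

lemma card_symmDiff {α : Type*} [DecidableEq α] (X Y : Finset α) :
    (symmDiff X Y).card = (X \ Y).card + (Y \ X).card := by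
  rw [symmDiff_def, Finset.sup_eq_union, Finset.card_union_of_disjoint disjoint_sdiff_sdiff]

lemma cost_compl (c : Fin n → ℝ) (S : Finset (Fin n)) :
    cost (fun e => - c e) Sᶜ = cost c S - cost c Finset.univ := by
  have := Finset.sum_add_sum_compl S c
  simp only [cost, Finset.sum_neg_distrib]
  linarith

/-- The size of the symmetric difference of two bases depends only on the size of the intersection
of the encoding pair. -/
lemma card_symmDiff_complIf {M : Matroid (Fin n)} {f : ℕ} {X Y X' Y' : Finset (Fin n)}
    (hX : M.IsBase (X : Set (Fin n))) (hY : M.IsBase (complIf f Y : Set (Fin n)))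
    (hX' : M.IsBase (X' : Set (Fin n))) (hY' : M.IsBase (complIf f Y' : Set (Fin n)))
    (h : (X ∩ Y).card = (X' ∩ Y').card) :
    (symmDiff X (complIf f Y)).card = (symmDiff X' (complIf f Y')).card := by
  have c1 := card_eq_of_isBase hX hX'
  have c2 := card_eq_of_isBase hX hY
  have c3 := card_eq_of_isBase hX' hY'
  rw [card_symmDiff, card_symmDiff]
  have e1 := Finset.card_inter_add_card_sdiff X (complIf f Y)
  have e2 := Finset.card_inter_add_card_sdiff (complIf f Y) X
  have e3 := Finset.card_inter_add_card_sdiff X' (complIf f Y')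
  have e4 := Finset.card_inter_add_card_sdiff (complIf f Y') X'
  rw [Finset.inter_comm] at e2 e4
  by_cases hf : f = 0
  · simp only [complIf, hf, if_true] at *
    omega
  · simp only [complIf, hf, if_false] at *
    have h1 : X \ Yᶜ = X ∩ Y := by ext; simp
    have h2 : X' \ Y'ᶜ = X' ∩ Y' := by ext; simp
    rw [h1] at e1 ⊢
    rw [h2] at e3 ⊢
    omega

lemma value_le_of_certified (I : Input n) {f : ℕ} {w : Fin 2 → Fin n → ℝ}
    {W W' : Fin 2 → Finset (Fin n)} (h : Certified (pairMatroid I.M f) (pairCost I f) w W)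
    (hW' : ∀ t, (pairMatroid I.M f t).IsBase (W' t : Set (Fin n)))
    (hc : (W' 0 ∩ W' 1).card = (W 0 ∩ W 1).card) : value I f W ≤ value I f W' := by
  have h1 := h.cost_le hW' hc
  obtain ⟨hX, hY⟩ := (pairMatroid_isBase_iff I f W).1 fun t => (h.1 t).1
  obtain ⟨hX', hY'⟩ := (pairMatroid_isBase_iff I f W').1 hW'
  have h2 := card_symmDiff_complIf hX hY hX' hY' hc.symm
  rw [value, value, objTri, objTri, h2]
  have hcost : ∃ k : ℝ, ∀ V : Finset (Fin n),
      cost (pairCost I f 1) V = cost I.c₂ (complIf f V) + k := by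
    by_cases hf : f = 0
    · exact ⟨0, fun V => by simp [complIf, hf, pairCost, cost]⟩
    · refine ⟨- cost I.c₂ Finset.univ, fun V => ?_⟩
      have h3 := cost_compl I.c₂ Vᶜ
      rw [compl_compl] at h3
      have e2 : pairCost I f 1 = fun e => - I.c₂ e := by funext e; simp [pairCost, hf]
      rw [e2, complIf, if_neg hf, h3, sub_eq_add_neg]
  obtain ⟨k, hk⟩ := hcost
  have h0 : ∀ V : Finset (Fin n), cost (pairCost I f 0) V = cost I.c₁ V := fun V => by
    simp [pairCost, cost]
  rw [hk, hk, h0, h0] at h1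
  linarith

end Pairs

section Search

variable {n : ℕ} {I : Input n}

/-- The memory holds the input data, a zero, and the mark that the first matroid is `M` itself. -/
structure InputState (I : Input n) (m : Memory) : Prop where
  c₁ : ∀ e : Fin n, m.real 0 e = I.c₁ e
  c₂ : ∀ e : Fin n, m.real 1 e = I.c₂ e
  C : ∀ k ≤ n, m.real 2 k = I.C k
  zero : m.real 9 0 = 0
  flag : m.nat 8 0 = 0

lemma InputState.congr {m m' : Memory} (h : InputState I m) (h0 : m'.real 0 = m.real 0)
    (h1 : m'.real 1 = m.real 1) (h2 : m'.real 2 = m.real 2) (h9 : m'.real 9 = m.real 9)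
    (h8 : m'.nat 8 0 = m.nat 8 0) : InputState I m' :=
  ⟨by rw [h0]; exact h.c₁, by rw [h1]; exact h.c₂, by rw [h2]; exact h.C, by rw [h9]; exact h.zero,
    by rw [h8]; exact h.flag⟩

lemma InputState.exec {m : Memory} (h : InputState I m) (P : SProg) (h8 : 8 ∉ P.natWrites)
    (hr : ∀ b ∈ [0, 1, 2, 9], b ∉ P.realWrites) : InputState I (P.exec (oracle I.M) m) :=
  h.congr (exec_real _ (hr 0 (by simp)) _) (exec_real _ (hr 1 (by simp)) _)
    (exec_real _ (hr 2 (by simp)) _) (exec_real _ (hr 9 (by simp)) _) (by rw [exec_nat _ h8])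

lemma InputState.matroidOf_eq {m : Memory} (h : InputState I m) :
    matroidOf I.M m = pairMatroid I.M (m.nat 8 1) := by
  funext t
  rw [matroidOf, pairMatroid]
  fin_cases t
  · simp [h.flag]
  · simp

lemma evaluate_spec {m₀ : Memory} (h : InputState I m₀) :
    (evaluate.exec (oracle I.M) m₀).real 7 0 = value I (m₀.nat 8 1) (setOf n m₀) ∧
    (evaluate.exec (oracle I.M) m₀).toFinset n 23 = complIf (m₀.nat 8 1) (setOf n m₀ 1) := by
  rw [evaluate, exec_seq, exec_seq, exec_seq, exec_seq]
  set Q : SProg := .ite (.natLt (.lit 0) (.cell 8 (.lit 1)))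
    (fill 13 23 (.sub (.lit 1) (.cell 4 (var 13)))) (fill 13 23 (.cell 4 (var 13))) with hQ
  set m₁ := Q.exec (oracle I.M) m₀ with hm₁
  have hn₁ : ∀ a, a ≠ 13 → a ≠ 23 → m₁.nat a = m₀.nat a := fun a h h' =>
    exec_nat _ (by simp [hQ, fill, natWrites, h, h']) _
  have hr₁ : m₁.real = m₀.real := funext fun b => exec_real _ (by simp [hQ, fill, realWrites]) _
  have hY : m₁.toFinset n 23 = complIf (m₀.nat 8 1) (setOf n m₀ 1) := by
    ext i
    rw [Memory.mem_toFinset, hm₁, hQ, complIf]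
    by_cases hf : m₀.nat 8 1 = 0
    · rw [exec_ite_neg _ (by simp [Test.Holds, NatExpr.eval, hf]), if_pos hf, mem_setOf_one,
        exec_fill _ (g := fun i => m₀.nat 4 i) (by decide), if_pos i.2]
      intro j hj m' h1 h2 _
      simp [NatExpr.eval, h1 4, h2]
    · rw [exec_ite_pos _ (by simpa [Test.Holds, NatExpr.eval, Nat.pos_iff_ne_zero] using hf),
        if_neg hf, Finset.mem_compl, mem_setOf_one,
        exec_fill _ (g := fun i => 1 - m₀.nat 4 i) (by decide), if_pos i.2]
      · omega
      · intro j hj m' h1 h2 _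
        simp [NatExpr.eval, h1 4, h2]
  set Y := complIf (m₀.nat 8 1) (setOf n m₀ 1)
  set m₂ := (SProg.copyReal 7 (.lit 0) 9 (.lit 0)).exec (oracle I.M)
    ((SProg.setNat 22 (.lit 0) (.lit 0)).exec (oracle I.M) m₁) with hm₂
  have hn₂ : ∀ a, a ≠ 22 → m₂.nat a = m₁.nat a := fun a ha => by
    rw [hm₂, exec_nat _ (by simp [natWrites]), exec_nat _ (by simp [natWrites, ha])]
  have hr₂ : ∀ b, b ≠ 7 → m₂.real b = m₀.real b := fun b hb => by
    rw [hm₂, exec_real _ (by simp [realWrites, hb]), exec_real _ (by simp [realWrites]), hr₁]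
  set body : SProg := _
  set m₃ := (SProg.forLoop 15 0 body).exec (oracle I.M) m₂ with hm₃
  have hr₃ : ∀ b, b ≠ 7 → m₃.real b = m₀.real b := fun b hb => by
    rw [hm₃, exec_real _ (by simp [body, realWrites, hb]), hr₂ b hb]
  have hn₃ : m₃.nat 23 = m₁.nat 23 := by
    rw [hm₃, exec_nat _ (by simp [body, natWrites]), hn₂ _ (by decide)]
  have hinv : m₃.real 7 0 = ∑ i ∈ Finset.range (n + 0), ((if m₁.nat 3 i ≠ 0 then m₀.real 0 i else 0) +
        (if m₁.nat 23 i ≠ 0 then m₀.real 1 i else 0)) ∧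
      m₃.nat 22 0 = ∑ i ∈ Finset.range (n + 0), if (m₁.nat 3 i ≠ 0 ↔ m₁.nat 23 i = 0) then 1 else 0 := by
    refine exec_for (oracle I.M) (P := body) (c := 15) (k := 0) (m₀ := m₂) (fun j m₃ =>
      m₃.real 7 0 = ∑ i ∈ Finset.range j, ((if m₁.nat 3 i ≠ 0 then m₀.real 0 i else 0) +
        (if m₁.nat 23 i ≠ 0 then m₀.real 1 i else 0)) ∧
      m₃.nat 22 0 = ∑ i ∈ Finset.range j, if (m₁.nat 3 i ≠ 0 ↔ m₁.nat 23 i = 0) then 1 else 0) ?_ ?_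
    · refine ⟨?_, ?_⟩
      · simp [hm₂, exec, NatExpr.eval, hr₁, h.zero]
      · simp [hm₂, exec, NatExpr.eval, Memory.writeNat_nat]
    · intro j hj m hn hr h15 ⟨h1, h2⟩
      rw [Finset.sum_range_succ, Finset.sum_range_succ, ← h1, ← h2, Memory.writeNat_real,
        Memory.writeNat_nat_of_ne _ _ _ (by decide)]
      have e3 : m.nat 3 = m₁.nat 3 := by
        rw [hn 3 (by simp [body, natWrites]), hn₂ _ (by decide)]
      have e23 : m.nat 23 = m₁.nat 23 := by
        rw [hn 23 (by simp [body, natWrites]), hn₂ _ (by decide)]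
      have r0 : m.real 0 = m₀.real 0 := by
        rw [hr 0 (by simp [body, realWrites]), hr₂ _ (by decide)]
      have r1 : m.real 1 = m₀.real 1 := by
        rw [hr 1 (by simp [body, realWrites]), hr₂ _ (by decide)]
      by_cases hX : m₁.nat 3 j = 0 <;> by_cases hYj : m₁.nat 23 j = 0 <;>
      simp [body, exec, Test.Holds, NatExpr.eval, h15, e3, e23, r0, r1, hX, hYj, Nat.pos_iff_ne_zero,
        Memory.writeReal_real, add_assoc]
  have hX : ∀ i : Fin n, m₁.nat 3 i ≠ 0 ↔ i ∈ setOf n m₀ 0 := fun i => by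
    rw [mem_setOf_zero, hn₁ _ (by decide) (by decide)]
  have hY' : ∀ i : Fin n, m₁.nat 23 i ≠ 0 ↔ i ∈ Y := fun i => by
    rw [← hY, Memory.mem_toFinset]
  obtain ⟨h1, h2⟩ := hinv
  rw [add_zero, Finset.sum_range] at h1 h2
  have hcard : m₃.nat 22 0 = (symmDiff (setOf n m₀ 0) Y).card := by
    rw [h2, ← Finset.card_filter]
    congr 1
    ext i
    have a1 := hX i
    have a2 := hY' i
    simp only [Finset.mem_filter, Finset.mem_univ, true_and, Finset.mem_symmDiff]
    tauto
  refine ⟨?_, ?_⟩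
  · rw [exec]
    simp only [NatExpr.eval, eval_var, Memory.writeReal_real_self]
    rw [hcard, hr₃ 2 (by decide), h.C _ (by
      refine (Finset.card_le_univ _).trans ?_
      simp), h1, Finset.sum_add_distrib, value, objTri]
    simp only [hX, hY', h.c₁, h.c₂, cost, ← Finset.sum_filter, Finset.filter_mem_eq_inter,
      Finset.univ_inter]
    rfl
  · rw [← hY]
    refine Memory.toFinset_congr fun i _ => ?_
    rw [exec_nat _ (by simp [natWrites]), hn₃]

lemma save_spec (m₀ : Memory) :
    (save.exec (oracle I.M) m₀).toFinset n 1 = m₀.toFinset n 3 ∧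
    (save.exec (oracle I.M) m₀).toFinset n 2 = m₀.toFinset n 23 ∧
    (save.exec (oracle I.M) m₀).real 8 0 = m₀.real 7 0 := by
  rw [save, exec_seq, exec_seq]
  set m₁ := (fill 13 1 (.cell 3 (var 13))).exec (oracle I.M) m₀ with hm₁
  set m₂ := (fill 13 2 (.cell 23 (var 13))).exec (oracle I.M) m₁ with hm₂
  refine ⟨Memory.toFinset_congr fun i hi => ?_, Memory.toFinset_congr fun i hi => ?_, ?_⟩
  · rw [exec_nat _ (by simp [natWrites]), hm₂, exec_nat _ (by simp [fill, natWrites]), hm₁,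
      exec_fill _ (g := fun i => m₀.nat 3 i) (by decide), if_pos hi]
    intro j hj m' h1 h2 _
    simp [NatExpr.eval, h1 3, h2]
  · rw [exec_nat _ (by simp [natWrites]), hm₂,
      exec_fill _ (g := fun i => m₀.nat 23 i) (by decide), if_pos hi]
    intro j hj m' h1 h2 _
    simp only [NatExpr.eval, eval_var, h1 23 (by decide) (by decide), h2]
    rw [hm₁, exec_nat _ (by simp [fill, natWrites])]
  · simp only [exec, NatExpr.eval, Memory.writeReal_real_self]
    rw [hm₂, exec_real _ (by simp [fill, realWrites]), hm₁, exec_real _ (by simp [fill, realWrites])]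

/-- The arrays `1` and `2` hold a pair of bases, and the real scalar `8` its objective value. -/
structure BestState (I : Input n) (m : Memory) : Prop where
  fst : I.M.IsBase (m.toFinset n 1 : Set (Fin n))
  snd : I.M.IsBase (m.toFinset n 2 : Set (Fin n))
  val : m.real 8 0 = objTri I.c₁ I.c₂ I.C (m.toFinset n 1) (m.toFinset n 2)

lemma BestState.congr {m m' : Memory} (h : BestState I m) (h1 : m'.nat 1 = m.nat 1)
    (h2 : m'.nat 2 = m.nat 2) (h8 : m'.real 8 = m.real 8) : BestState I m' := by
  have e1 : m'.toFinset n 1 = m.toFinset n 1 := Memory.toFinset_congr fun i _ => by rw [h1]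
  have e2 : m'.toFinset n 2 = m.toFinset n 2 := Memory.toFinset_congr fun i _ => by rw [h2]
  exact ⟨e1 ▸ h.fst, e2 ▸ h.snd, by rw [e1, e2, h8, h.val]⟩

/-- A bound for the number of steps of the primal-dual method that are still to come. -/
noncomputable def measure (I : Input n) (f : ℕ) (m : Memory) : ℕ :=
  (setOf n m 0 ∩ setOf n m 1).card * (n + 1) +
    (n - (reach (pairMatroid I.M f) (weightOf n m) (setOf n m)).card)

/-- The invariant of the search: the current pair is certified, and the best pair seen is at least
as good as all pairs whose intersection is larger than the current one, but at most as large as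
the initial one (`i₀`). After `j` steps there are either few steps left, or all pairs with small
intersection have been taken into account. -/
structure SearchInv (I : Input n) (f i₀ : ℕ) (v₀ : ℝ) (j : ℕ) (m : Memory) : Prop where
  input : InputState I m
  flag : m.nat 8 1 = f
  best : BestState I m
  le : m.real 8 0 ≤ v₀
  cert : Certified (pairMatroid I.M f) (pairCost I f) (weightOf n m) (setOf n m)
  seen : ∀ W' : Fin 2 → Finset (Fin n), (∀ t, (pairMatroid I.M f t).IsBase (W' t : Set (Fin n))) →
    (setOf n m 0 ∩ setOf n m 1).card < (W' 0 ∩ W' 1).card → (W' 0 ∩ W' 1).card ≤ i₀ →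
    m.real 8 0 ≤ value I f W'
  progress : measure I f m + j ≤ n * (n + 1) + n ∨
    ∀ W' : Fin 2 → Finset (Fin n), (∀ t, (pairMatroid I.M f t).IsBase (W' t : Set (Fin n))) →
      (W' 0 ∩ W' 1).card ≤ i₀ → m.real 8 0 ≤ value I f W'

lemma SearchInv.writeNat {f i₀ j : ℕ} {v₀ : ℝ} {m : Memory} (h : SearchInv I f i₀ v₀ j m) {a k : ℕ}
    (ha : a ∈ [17, 18]) : SearchInv I f i₀ v₀ j (m.writeNat a 0 k) := by
  simp only [List.mem_cons, List.not_mem_nil, or_false] at ha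
  have hn : ∀ b < 17, (m.writeNat a 0 k).nat b = m.nat b := fun b hb =>
    Memory.writeNat_nat_of_ne _ _ _ (by omega)
  have hset : setOf n (m.writeNat a 0 k) = setOf n m := funext fun t =>
    Memory.toFinset_congr fun i _ => by rw [hn _ (by omega)]
  have hw : weightOf n (m.writeNat a 0 k) = weightOf n m := rfl
  refine ⟨h.input.congr rfl rfl rfl rfl (by rw [hn _ (by decide)]), by rw [hn _ (by decide), h.flag],
    h.best.congr (hn _ (by decide)) (hn _ (by decide)) rfl, h.le, ?_, ?_, ?_⟩
  · rw [hset, hw]; exact h.cert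
  · rw [hset]; exact h.seen
  · rw [measure, hset, hw]; exact h.progress

lemma SearchInv.step {f i₀ j : ℕ} {v₀ : ℝ} {m : Memory} (h : SearchInv I f i₀ v₀ j m) :
    SearchInv I f i₀ v₀ (j + 1) ((SProg.seq evaluate (.seq
      (.ite (.realLe 8 (.lit 0) 7 (.lit 0)) .skip save) improve)).exec (oracle I.M) m) := by
  obtain ⟨hval, hY⟩ := evaluate_spec h.input
  rw [h.flag] at hval hY
  obtain ⟨hbX, hbY⟩ := (pairMatroid_isBase_iff I f _).1 fun t => (h.cert.1 t).1
  rw [exec_seq, exec_seq]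
  set m₁ := evaluate.exec (oracle I.M) m with hm₁
  have hn₁ : ∀ a ∉ [13, 15, 22, 23], m₁.nat a = m.nat a := fun a ha =>
    exec_nat _ (by simp [evaluate, fill, natWrites] at ha ⊢; tauto) _
  have hr₁ : ∀ b, b ≠ 7 → m₁.real b = m.real b := fun b hb =>
    exec_real _ (by simp [evaluate, fill, realWrites, hb]) _
  set Q : SProg := .ite (.realLe 8 (.lit 0) 7 (.lit 0)) .skip save with hQ
  set m₂ := Q.exec (oracle I.M) m₁ with hm₂
  have hn₂ : ∀ a ∉ [1, 2, 13], m₂.nat a = m₁.nat a := fun a ha =>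
    exec_nat _ (by simp [hQ, save, fill, natWrites] at ha ⊢; tauto) _
  have hr₂ : ∀ b, b ≠ 8 → m₂.real b = m₁.real b := fun b hb =>
    exec_real _ (by simp [hQ, save, fill, realWrites, hb]) _
  have hsame : SameState m₂ m := by
    constructor
    · rw [hn₂ _ (by decide), hn₁ _ (by decide)]
    · rw [hn₂ _ (by decide), hn₁ _ (by decide)]
    · rw [hn₂ _ (by decide), hn₁ _ (by decide)]
    · rw [hr₂ _ (by decide), hr₁ _ (by decide)]
    · rw [hr₂ _ (by decide), hr₁ _ (by decide)]
    · rw [hr₂ _ (by decide), hr₁ _ (by decide)]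
  have hin₂ : InputState I m₂ := h.input.congr (by rw [hr₂ _ (by decide), hr₁ _ (by decide)])
    (by rw [hr₂ _ (by decide), hr₁ _ (by decide)]) (by rw [hr₂ _ (by decide), hr₁ _ (by decide)])
    hsame.real9 (by rw [hsame.nat8])
  have hbest : BestState I m₂ ∧ m₂.real 8 0 ≤ m.real 8 0 ∧ m₂.real 8 0 ≤ value I f (setOf n m) := by
    have hb₁ : BestState I m₁ := h.best.congr (hn₁ _ (by decide)) (hn₁ _ (by decide)) (hr₁ _ (by decide))
    have e8 := hr₁ 8 (by decide)
    by_cases hle : m₁.real 8 0 ≤ m₁.real 7 0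
    · have : m₂ = m₁ := by
        rw [hm₂, hQ, exec_ite_pos _ (by simpa [Test.Holds, NatExpr.eval] using hle), exec]
      rw [this, ← hval, ← e8]
      exact ⟨hb₁, le_rfl, hle⟩
    · have : m₂ = save.exec (oracle I.M) m₁ := by
        rw [hm₂, hQ, exec_ite_neg _ (by simpa [Test.Holds, NatExpr.eval] using hle)]
      obtain ⟨h1, h2, h3⟩ := save_spec (I := I) m₁
      have hX : m₁.toFinset n 3 = setOf n m 0 :=
        Memory.toFinset_congr fun i _ => by rw [hn₁ _ (by decide)]; rfl
      rw [← this] at h1 h2 h3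
      rw [hX] at h1
      rw [hY] at h2
      refine ⟨⟨by rw [h1]; exact hbX, by rw [h2]; exact hbY, by rw [h1, h2, h3, hval, value]⟩, ?_, ?_⟩
      · rw [h3, ← e8]; exact (not_le.1 hle).le
      · rw [h3, hval]
  obtain ⟨hb₂, hle, hlev⟩ := hbest
  have hmat : matroidOf I.M m₂ = pairMatroid I.M f := by
    rw [hin₂.matroidOf_eq, hsame.nat8, h.flag]
  have himp := improve_spec (c := pairCost I f) I.ground m₂ hin₂.zero (by
    rw [hmat, hsame.weightOf_eq, hsame.setOf_eq]; exact h.cert)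
  set m₃ := improve.exec (oracle I.M) m₂ with hm₃
  rw [hmat, hsame.weightOf_eq, hsame.setOf_eq] at himp
  have hn₃ : ∀ a ∈ [1, 2, 8], m₃.nat a = m₂.nat a := fun a ha => by
    refine exec_nat _ ?_ _
    simp only [List.mem_cons, List.not_mem_nil, or_false] at ha
    rcases ha with rfl | rfl | rfl <;> decide
  have hr₃ : ∀ b ∈ [0, 1, 2, 8, 9], m₃.real b = m₂.real b := fun b hb => by
    refine exec_real _ ?_ _
    simp only [List.mem_cons, List.not_mem_nil, or_false] at hb
    rcases hb with rfl | rfl | rfl | rfl | rfl <;> decide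
  have e8 : m₃.real 8 = m₂.real 8 := hr₃ 8 (by simp)
  obtain ⟨hcert, hcases⟩ := himp
  -- All pairs at least as large as the pair before the step have now been taken into account.
  have hseen : ∀ W' : Fin 2 → Finset (Fin n),
      (∀ t, (pairMatroid I.M f t).IsBase (W' t : Set (Fin n))) →
      (setOf n m 0 ∩ setOf n m 1).card ≤ (W' 0 ∩ W' 1).card → (W' 0 ∩ W' 1).card ≤ i₀ →
      m₃.real 8 0 ≤ value I f W' := by
    intro W' hW' h1 h2
    rw [e8]
    rcases h1.lt_or_eq with h1 | h1
    · exact hle.trans (h.seen W' hW' h1 h2)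
    · exact hlev.trans (value_le_of_certified I h.cert hW' h1.symm)
  refine ⟨hin₂.congr (hr₃ _ (by simp)) (hr₃ _ (by simp)) (hr₃ _ (by simp)) (hr₃ _ (by simp))
      (by rw [hn₃ _ (by simp)]), by rw [hn₃ _ (by simp), hsame.nat8, h.flag],
    hb₂.congr (hn₃ _ (by simp)) (hn₃ _ (by simp)) e8, by rw [e8]; exact hle.trans h.le, hcert, ?_, ?_⟩
  · intro W' hW' h1 h2
    refine hseen W' hW' ?_ h2
    rcases hcases with hA | ⟨hB, _⟩ | ⟨hC, _⟩
    · omega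
    · rw [hB] at h1; exact h1.le
    · rw [hC] at h1; exact h1.le
  · rcases h.progress with hp | hp
    swap
    · exact Or.inr fun W' hW' h1 => by rw [e8]; exact hle.trans (hp W' hW' h1)
    have hR : ∀ w W, (reach (pairMatroid I.M f) w W).card ≤ n := fun w W =>
      (Finset.card_le_univ _).trans (by simp)
    rcases hcases with hA | ⟨hB, hB'⟩ | ⟨hC, hC'⟩
    · left
      rw [measure] at hp ⊢
      rw [← hA, Nat.succ_mul] at hp
      omega
    · left
      rw [measure] at hp ⊢
      rw [hB] at hB' ⊢
      have := hR (weightOf n m₃) (setOf n m)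
      omega
    · exact Or.inr fun W' hW' h1 => hseen W' hW' (hC' W' hW') h1

lemma search_spec {f i₀ : ℕ} {v₀ : ℝ} {m : Memory} (h : SearchInv I f i₀ v₀ 0 m) :
    SearchInv I f i₀ v₀ ((n + 1) * (n + 1)) (search.exec (oracle I.M) m) := by
  refine exec_for (oracle I.M) (c := 17) (k := 1) (fun a m => SearchInv I f i₀ v₀ (a * (n + 1)) m) ?_ ?_
  · rw [Nat.zero_mul]
    exact h.writeNat (by simp)
  intro a ha m₁ _ _ _ h₁
  refine SearchInv.writeNat ?_ (by simp)
  rw [Nat.succ_mul]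
  refine exec_for (oracle I.M) (c := 18) (k := 1)
    (fun b m => SearchInv I f i₀ v₀ (a * (n + 1) + b) m) ?_ ?_
  · exact h₁.writeNat (by simp)
  intro b hb m₂ _ _ _ h₂
  exact h₂.step.writeNat (by simp)

/-- Enough steps are made: the search ends with a pair that is at least as good as all pairs with
intersection at most the initial one. -/
lemma SearchInv.final {f i₀ : ℕ} {v₀ : ℝ} {m : Memory}
    (h : SearchInv I f i₀ v₀ ((n + 1) * (n + 1)) m) (W' : Fin 2 → Finset (Fin n))
    (hW' : ∀ t, (pairMatroid I.M f t).IsBase (W' t : Set (Fin n)))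
    (hi : (W' 0 ∩ W' 1).card ≤ i₀) : m.real 8 0 ≤ value I f W' := by
  rcases h.progress with hp | hp
  · exfalso
    have : (n + 1) * (n + 1) = n * (n + 1) + n + 1 := by ring
    omega
  · exact hp W' hW' hi

lemma setup_spec {f : ℕ} {m₀ : Memory} (h : InputState I m₀)
    (hX : IsMinBase I.M I.c₁ (m₀.toFinset n 5)) (hY : IsMinBase I.M I.c₂ (m₀.toFinset n 6)) :
    let m := (setup f).exec (oracle I.M) m₀
    InputState I m ∧ m.nat 8 1 = f ∧ setOf n m 0 = m₀.toFinset n 5 ∧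
    setOf n m 1 = complIf f (m₀.toFinset n 6) ∧
    Certified (pairMatroid I.M f) (pairCost I f) (weightOf n m) (setOf n m) := by
  intro m
  have hm : m = (setup f).exec (oracle I.M) m₀ := rfl
  rw [setup, exec_seq, exec_seq, exec_seq] at hm
  set m₁ := (SProg.setNat 8 (.lit 1) (.lit f)).exec (oracle I.M) m₀ with hm₁
  have hn₁ : ∀ a, a ≠ 8 → m₁.nat a = m₀.nat a := fun a ha => exec_nat _ (by simp [natWrites, ha]) _
  set m₂ := (fill 13 3 (.cell 5 (var 13))).exec (oracle I.M) m₁ with hm₂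
  set e4 : NatExpr := (if f = 0 then .cell 6 (var 13) else .sub (.lit 1) (.cell 6 (var 13))) with he4
  set m₃ := (fill 13 4 e4).exec (oracle I.M) m₂ with hm₃
  set body : SProg := .seq (.copyReal 3 (var 15) 0 (var 15))
    (if f = 0 then .copyReal 4 (var 15) 1 (var 15) else .subReal 4 (var 15) 9 (.lit 0) 1 (var 15))
    with hbody
  have hbn : body.natWrites = [] := by
    rw [hbody]; split_ifs <;> rfl
  have hbr : body.realWrites = [3, 4] := by
    rw [hbody]; split_ifs <;> rfl
  have hn₃ : ∀ a, a ≠ 3 → a ≠ 4 → a ≠ 13 → m₃.nat a = m₁.nat a := fun a h h' h'' => by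
    rw [hm₃, exec_nat _ (by simp [fill, natWrites, h', h'']), hm₂,
      exec_nat _ (by simp [fill, natWrites, h, h''])]
  have hr₃ : m₃.real = m₀.real := by
    funext b
    rw [hm₃, exec_real _ (by simp [fill, realWrites]), hm₂, exec_real _ (by simp [fill, realWrites])]
    rfl
  have hnm : ∀ a, a ≠ 15 → m.nat a = m₃.nat a := fun a ha => by
    rw [hm, exec_nat _ (by simp [natWrites, hbn, ha])]
  have hrm : ∀ b, b ≠ 3 → b ≠ 4 → m.real b = m₀.real b := fun b h h' => by
    rw [hm, exec_real _ (by simp [realWrites, hbr, h, h']), hr₃]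
  have h8 : ∀ i, m.nat 8 i = m₁.nat 8 i := fun i => by
    rw [hnm _ (by decide), hn₃ _ (by decide) (by decide) (by decide)]
  have hflag : m.nat 8 1 = f := by
    rw [h8]; simp [hm₁, exec, NatExpr.eval]
  have hset0 : setOf n m 0 = m₀.toFinset n 5 := by
    refine Memory.toFinset_congr fun i hi => ?_
    change m.nat 3 i = m₀.nat 5 i
    rw [hnm _ (by decide), hm₃, exec_nat _ (by simp [fill, natWrites]), hm₂,
      exec_fill _ (g := fun i => m₀.nat 5 i) (by decide), if_pos hi]
    intro j hj m' h1 h2 _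
    simp [NatExpr.eval, h1 5, h2, hn₁]
  have hset1 : setOf n m 1 = complIf f (m₀.toFinset n 6) := by
    have h6 : m₂.nat 6 = m₀.nat 6 := by
      rw [hm₂, exec_nat _ (by simp [fill, natWrites]), hn₁ _ (by decide)]
    ext i
    rw [mem_setOf_one, hnm _ (by decide), hm₃,
      exec_fill _ (g := fun i => if f = 0 then m₀.nat 6 i else 1 - m₀.nat 6 i) (by decide), if_pos i.2,
      complIf]
    · by_cases hf : f = 0
      · simp [hf, Memory.mem_toFinset]
      · simp only [hf, if_false, Finset.mem_compl, Memory.mem_toFinset]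
        omega
    · intro j hj m' h1 h2 _
      by_cases hf : f = 0
      · simp [he4, hf, NatExpr.eval, h1 6, h2, h6]
      · simp [he4, hf, NatExpr.eval, h1 6, h2, h6]
  have hw : weightOf n m = pairCost I f := by
    have := exec_for (oracle I.M) (m₀ := m₃) (P := body) (c := 15) (k := 0) (fun j m =>
      ∀ i < j, m.real 3 i = m₀.real 0 i ∧ m.real 4 i = if f = 0 then m₀.real 1 i else - m₀.real 1 i) ?_ ?_
    · rw [← hm] at this
      funext t e
      obtain ⟨h1, h2⟩ := this e (by omega)
      fin_cases t
      · simp [weightOf, pairCost, h1, h.c₁]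
      · simp [weightOf, pairCost, h2, h.c₂]
    · intro i hi; omega
    · intro j hj m' hn hr h15 hinv i hi
      have r0 : m'.real 0 = m₀.real 0 := by rw [hr 0 (by simp [hbr]), hr₃]
      have r1 : m'.real 1 = m₀.real 1 := by rw [hr 1 (by simp [hbr]), hr₃]
      have r9 : m'.real 9 0 = 0 := by rw [hr 9 (by simp [hbr]), hr₃, h.zero]
      rw [Memory.writeNat_real]
      by_cases hij : i = j
      · subst hij
        by_cases hf : f = 0 <;>
        simp [hbody, hf, exec, h15, Memory.writeReal_real, r0, r1, r9, NatExpr.eval]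
      · have := hinv i (by omega)
        by_cases hf : f = 0
        · simp only [hf, if_true] at this
          simp [hbody, hf, exec, h15, Memory.writeReal_real, hij, this]
        · simp only [hf, if_false] at this
          simp [hbody, hf, exec, h15, Memory.writeReal_real, hij, this]
  refine ⟨?_, hflag, hset0, hset1, fun t => ?_, fun _ => 0, 0, ?_⟩
  · refine h.congr (hrm _ (by decide) (by decide)) (hrm _ (by decide) (by decide))
      (hrm _ (by decide) (by decide)) (hrm _ (by decide) (by decide)) ?_
    rw [h8, hm₁, exec, Memory.writeNat_nat]
    simp [NatExpr.eval]
  · rw [hw]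
    have h0 : IsMinBase (pairMatroid I.M f 0) (pairCost I f 0) (setOf n m 0) := by
      have e1 : pairMatroid I.M f 0 = I.M := by simp [pairMatroid]
      have e2 : pairCost I f 0 = I.c₁ := by funext e; simp [pairCost]
      rw [hset0, e1, e2]
      exact hX
    have h1 : IsMinBase (pairMatroid I.M f 1) (pairCost I f 1) (setOf n m 1) := by
      rw [hset1]
      by_cases hf : f = 0
      · have e1 : pairMatroid I.M f 1 = I.M := by simp [pairMatroid, hf]
        have e2 : pairCost I f 1 = I.c₂ := by funext e; simp [pairCost, hf]
        rw [e1, e2, complIf, if_pos hf]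
        exact hY
      · have e1 : pairMatroid I.M f 1 = I.M✶ := by simp [pairMatroid, hf]
        have e2 : pairCost I f 1 = fun e => - I.c₂ e := by funext e; simp [pairCost, hf]
        rw [e1, e2, complIf, if_neg hf]
        refine ⟨(isBase_compl_iff I _).2 hY.1, fun W' hW' => ?_⟩
        have hW'' := (isBase_compl_iff I W'ᶜ).1 (by rwa [compl_compl])
        have h2 := hY.2 _ hW''
        have h3 := cost_compl I.c₂ W'ᶜ
        rw [compl_compl] at h3
        rw [cost_compl, h3]
        linarith
    fin_cases t
    · exact h0
    · exact h1
  · exact ⟨fun t e => by rw [hw, add_zero], fun _ => le_rfl, fun _ => le_rfl, fun _ _ => rfl,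
      fun _ _ => rfl⟩

lemma SearchInv.init {f : ℕ} {m : Memory} (hin : InputState I m) (hf : m.nat 8 1 = f)
    (hb : BestState I m)
    (hc : Certified (pairMatroid I.M f) (pairCost I f) (weightOf n m) (setOf n m)) :
    SearchInv I f (setOf n m 0 ∩ setOf n m 1).card (m.real 8 0) 0 m := by
  refine ⟨hin, hf, hb, le_rfl, hc, fun W' _ h1 h2 => by omega, Or.inl ?_⟩
  have h1 : (setOf n m 0 ∩ setOf n m 1).card ≤ n := (Finset.card_le_univ _).trans (by simp)
  have h2 := Nat.mul_le_mul_right (n + 1) h1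
  rw [measure]
  omega

theorem main_spec (I : Input n) :
    OptimalTri I.M I.c₁ I.c₂ I.C ((main.exec (oracle I.M) I.initMem).toFinset n 1)
      ((main.exec (oracle I.M) I.initMem).toFinset n 2) := by
  have hin₀ : InputState I I.initMem := by
    refine ⟨fun e => ?_, fun e => ?_, fun k hk => ?_, ?_, ?_⟩
    · simp [Input.initMem]
    · simp [Input.initMem]
    · simp [Input.initMem, hk]
    · simp [Input.initMem]
    · simp [Input.initMem]
  rw [main]
  simp only [exec_seq]
  set m₁ := (greedy 0 5).exec (oracle I.M) I.initMem with hm₁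
  have hX : IsMinBase I.M I.c₁ (m₁.toFinset n 5) := by
    have := greedy_spec (M := I.M) (b := 0) (s := 5) (by decide) I.initMem
    simpa only [hin₀.c₁] using this
  have hin₁ : InputState I m₁ := hin₀.exec _ (by decide) (by decide)
  set m₂ := (greedy 1 6).exec (oracle I.M) m₁ with hm₂
  have hY : IsMinBase I.M I.c₂ (m₂.toFinset n 6) := by
    have := greedy_spec (M := I.M) (b := 1) (s := 6) (by decide) m₁
    simpa only [hin₁.c₂] using this
  have hX₂ : m₂.toFinset n 5 = m₁.toFinset n 5 := Memory.toFinset_congr fun i _ => by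
    rw [hm₂, exec_nat _ (by decide)]
  rw [← hX₂] at hX
  have hin₂ : InputState I m₂ := hin₁.exec _ (by decide) (by decide)
  obtain ⟨hin₃, hf₃, hs0, hs1, hc₃⟩ := setup_spec (f := 0) hin₂ hX hY
  set m₃ := (setup 0).exec (oracle I.M) m₂ with hm₃
  set X₀ := m₂.toFinset n 5
  set Y₀ := m₂.toFinset n 6
  obtain ⟨hval, h23⟩ := evaluate_spec hin₃
  set m₄ := evaluate.exec (oracle I.M) m₃ with hm₄
  obtain ⟨hv1, hv2, hv8⟩ := save_spec (I := I) m₄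
  set m₅ := save.exec (oracle I.M) m₄ with hm₅
  have hsame₅ : SameState m₅ m₃ := by
    refine SameState.trans (m' := m₄) ?_ ?_ <;> apply sameState_exec <;> decide
  have hin₅ : InputState I m₅ :=
    (hin₃.exec evaluate (by decide) (by decide)).exec save (by decide) (by decide)
  have hb₅ : BestState I m₅ := by
    have h1 : m₅.toFinset n 1 = X₀ := by
      rw [hv1, ← hs0]
      refine Memory.toFinset_congr fun i _ => ?_
      rw [hm₄, exec_nat _ (by decide)]
      rfl
    have h2 : m₅.toFinset n 2 = Y₀ := by
      rw [hv2, h23, hf₃, hs1]; rfl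
    refine ⟨h1 ▸ hX.1, h2 ▸ hY.1, ?_⟩
    rw [hv8, hval, h1, h2, hf₃, value, hs0, hs1]
    rfl
  have hS₅ := SearchInv.init (f := 0) hin₅ (by rw [hsame₅.nat8, hf₃]) hb₅
    (by rw [hsame₅.weightOf_eq, hsame₅.setOf_eq]; exact hc₃)
  have hS₆ := search_spec hS₅
  set m₆ := search.exec (oracle I.M) m₅ with hm₆
  have h56 : ∀ a ∈ [5, 6], m₆.toFinset n a = m₂.toFinset n a := by
    intro a ha
    refine Memory.toFinset_congr fun i _ => ?_
    simp only [List.mem_cons, List.not_mem_nil, or_false] at ha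
    rcases ha with rfl | rfl <;>
    rw [hm₆, exec_nat _ (by decide), hm₅, exec_nat _ (by decide), hm₄, exec_nat _ (by decide), hm₃,
      exec_nat _ (by decide)]
  obtain ⟨hin₇, hf₇, ht0, ht1, hc₇⟩ := setup_spec (f := 1) hS₆.input
    (by rw [h56 5 (by simp)]; exact hX) (by rw [h56 6 (by simp)]; exact hY)
  rw [h56 5 (by simp)] at ht0
  rw [h56 6 (by simp)] at ht1
  set m₇ := (setup 1).exec (oracle I.M) m₆ with hm₇
  have e8 : m₇.real 8 = m₆.real 8 := exec_real _ (by decide) _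
  have hb₇ : BestState I m₇ := hS₆.best.congr (exec_nat _ (by decide) _) (exec_nat _ (by decide) _) e8
  have hS₈ := search_spec (SearchInv.init hin₇ hf₇ hb₇ hc₇)
  set m₈ := search.exec (oracle I.M) m₇ with hm₈
  refine ⟨hS₈.best.fst, hS₈.best.snd, fun X' Y' hX' hY' => ?_⟩
  rw [← hS₈.best.val]
  -- Pairs with a smaller intersection than the greedy pair are covered by the first search, those
  -- with a larger one by the second.
  rcases le_or_gt (X' ∩ Y').card (X₀ ∩ Y₀).card with hle | hgt
  · have h1 := hS₆.final ![X', Y'] ((pairMatroid_isBase_iff I 0 _).2 ⟨hX', hY'⟩) (by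
      rw [hsame₅.setOf_eq, hs0, hs1]
      exact hle)
    refine (hS₈.le.trans ?_).trans h1
    rw [e8]
  · have hcc : complIf 1 (Y'ᶜ) = Y' := by simp [complIf]
    have h1 := hS₈.final ![X', Y'ᶜ] ((pairMatroid_isBase_iff I 1 _).2 ⟨hX', by
        simpa [hcc] using hY'⟩) (by
      rw [ht0, ht1]
      change (X' ∩ Y'ᶜ).card ≤ (X₀ ∩ Y₀ᶜ).card
      rw [← Finset.sdiff_eq_inter_compl, ← Finset.sdiff_eq_inter_compl]
      have c1 := card_eq_of_isBase hX.1 hX'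
      have e1 := Finset.card_inter_add_card_sdiff X₀ Y₀
      have e2 := Finset.card_inter_add_card_sdiff X' Y'
      omega)
    simpa [value, hcc] using h1

end Search

end SProg
end OracleRAM

/-! ### Reduction to prescribed intersection sizes -/

namespace MatroidPair

variable {E : Type*}

lemma card_eq_rk {M : Matroid E} {X : Finset E} (hX : M.IsBase (X : Set E)) : X.card = rk M := by
  rw [rk, ← hX.encard_eq_eRank, Set.encard_coe_eq_coe_finsetCard, ENat.toNat_natCast]

lemma card_symmDiff_of_isBase [DecidableEq E] {M : Matroid E} {X Y : Finset E} (hX : M.IsBase (X : Set E))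
    (hY : M.IsBase (Y : Set E)) :
    (symmDiff X Y).card = rk M + rk M - 2 * (X ∩ Y).card := by
  have e1 := Finset.card_inter_add_card_sdiff X Y
  have e2 := Finset.card_inter_add_card_sdiff Y X
  rw [Finset.inter_comm] at e2
  rw [OracleRAM.SProg.card_symmDiff]
  have := card_eq_rk hX
  have := card_eq_rk hY
  omega

lemma card_inter_le_rk [DecidableEq E] {M : Matroid E} {X : Finset E}
    (hX : M.IsBase (X : Set E)) (Y : Finset E) :
    (X ∩ Y).card ≤ rk M :=
  (Finset.card_le_card Finset.inter_subset_left).trans (card_eq_rk hX).le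

end MatroidPair

theorem corollary4p1 :
    OracleRAM.SolvableInStronglyPolynomialTime
      (fun _ I X Y => MatroidPair.OptimalTri I.M I.c₁ I.c₂ I.C X Y) ∧
    ∀ (E : Type*) [Fintype E] [DecidableEq E] (M : Matroid E) (c₁ c₂ : E → ℝ) (C : ℕ → ℝ)
      (F : Set ℕ) (X Y : ℕ → Finset E) (v : ℕ → ℝ),
      F = {k | k ≤ MatroidPair.rk M ∧ ∃ X' Y', MatroidPair.FeasibleEq M M k X' Y'} →
      (∀ k ∈ F, MatroidPair.OptimalEq M M c₁ c₂ k (X k) (Y k)) →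
      (∀ k, v k = MatroidPair.cost c₁ (X k) + MatroidPair.cost c₂ (Y k) +
        C (MatroidPair.rk M + MatroidPair.rk M - 2 * k)) →
      (∃ k ∈ F, ∀ j ∈ F, v k ≤ v j) ∧
      ∀ k ∈ F, (∀ j ∈ F, v k ≤ v j) → MatroidPair.OptimalTri M c₁ c₂ C (X k) (Y k) := by

  refine ⟨OracleRAM.solvable_of_exec _ OracleRAM.SProg.main_wellFormed.1
    OracleRAM.SProg.main_wellFormed.2 fun n I => OracleRAM.SProg.main_spec I, ?_⟩
  intro E _ _ M c₁ c₂ C F X Y v hF hopt hv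
  have hval : ∀ k ∈ F, MatroidPair.objTri c₁ c₂ C (X k) (Y k) = v k := by
    intro k hk
    obtain ⟨hX, hY, hc⟩ := (hopt k hk).1
    rw [hv, MatroidPair.objTri, MatroidPair.card_symmDiff_of_isBase hX hY, hc]
  refine ⟨?_, fun k hk hmin => ⟨(hopt k hk).1.1, (hopt k hk).1.2.1, fun X' Y' hX' hY' => ?_⟩⟩
  · have hfin : F.Finite := (Set.finite_Iic (MatroidPair.rk M)).subset fun k hk => by
      rw [hF] at hk
      exact hk.1
    have hne : F.Nonempty := by
      obtain ⟨B, hB⟩ := M.exists_isBase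
      have hB' : M.IsBase ((Set.toFinite B).toFinset : Set E) := by simpa using hB
      rw [hF]
      exact ⟨_, MatroidPair.card_inter_le_rk hB' _, _, _, hB', hB', rfl⟩
    exact Set.exists_min_image F v hfin hne
  · have hj : (X' ∩ Y').card ∈ F := by
      rw [hF]
      exact ⟨MatroidPair.card_inter_le_rk hX' Y', X', Y', hX', hY', rfl⟩
    have h1 := (hopt _ hj).2 X' Y' ⟨hX', hY', rfl⟩
    have h2 := hmin _ hj
    rw [hval k hk]
    rw [hv (X' ∩ Y').card] at h2
    rw [MatroidPair.objTri, MatroidPair.card_symmDiff_of_isBase hX' hY']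
    linarith
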